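/- Let $Q,B$ be real constant $N\times N$ matrices with $Q=Q^\star\ge 0$, and let $K(t)=\frac1t\int_0^t e^{\sigma B}Qe^{\sigma B^\star}\,d\sigma$, where $M^\star$ denotes the transpose of $M$. Assume that $K(t)>0$ (positive definite) for every $t>0$. Put $\mathscr A u=\operatorname{tr}(Q\nabla^2u)+\langle BX,\nabla u\rangle$ and $$p(X,Y,t)=(4\pi)^{-N/2}\big(\det(tK(t))\big)^{-1/2}\exp\Big(-\frac{\langle K(t)^{-1}(Y-e^{tB}X),\,Y-e^{tB}X\rangle}{4t}\Big),\qquad P_tf(X)=\int_{\mathbb R^N}p(X,Y,t)f(Y)\,dY .$$ Let $0<s<1$ and $a=1-2s$. For $X,Y\in\mathbb R^N$ and $z,t>0$ define $$P^{(a)}_z(X,Y,t)=\frac{1}{2^{1-a}\Gamma(\frac{1-a}2)}\,\frac{z^{1-a}}{t^{\frac{3-a}2}}\,e^{-\frac{z^2}{4t}}\,p(X,Y,t),\qquad \mathscr P^{(a)}(X,Y,z)=\int_0^\infty P^{(a)}_z(X,Y,t)\,dt,$$ and, for a Schwartz function $\varphi$ on $\mathbb R^N$ (real or complex valued), $$U(X,z)=\int_{\mathbb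 R^N}\mathscr P^{(a)}(X,Y,z)\varphi(Y)\,dY,\qquad (-\mathscr A)^s\varphi(X)=-\frac{s}{\Gamma(1-s)}\int_0^\infty t^{-s-1}\big[P_t\varphi(X)-\varphi(X)\big]\,dt .$$ **Theorem 5.4.** All these integrals converge absolutely. One has $U\in C^\infty(\mathbb R^N\times(0,\infty))$ and $$z^a\Big(\mathscr A+\partial_{zz}+\frac az\,\partial_z\Big)U=0\quad\text{in }\mathbb R^N\times(0,\infty).$$ Moreover, as $z\to0^+$, $$U(\cdot,z)\to\varphi\quad\text{and}\quad -\frac{2^{-a}\Gamma(\frac{1-a}2)}{\Gamma(\frac{1+a}2)}\,z^a\partial_zU(\cdot,z)\to(-\mathscr A)^s\varphi\qquad\text{in }L^\infty(\mathbb R^N).$$ If in addition $\operatorname{tr}B\ge0$, both convergences also hold in $L^p(\mathbb R^N)$ for every $1\le p<\infty$. (Convergence in $L^p$, including $p=\infty$, comprises the assertion that the functions involved, for every $z>0$, and the limits belong to $L^p$.) -/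

import Mathlib

open MeasureTheory Filter Topology Set
open scoped Matrix ContDiff ENNReal

noncomputable section

namespace HormanderExtension

/-- The space of points `X`, i.e. `ℝ^N` with its Euclidean norm and Lebesgue measure. -/
abbrev Space (N : ℕ) : Type := EuclideanSpace ℝ (Fin N)

section Kernels

variable {N : ℕ} (Q B : Matrix (Fin N) (Fin N) ℝ)

/-- The covariance matrix `K(t) = (1/t) ∫₀ᵗ exp(sB) Q exp(sBᵀ) ds` (integrated entrywise). -/
def covariance (t : ℝ) : Matrix (Fin N) (Fin N) ℝ :=
  Matrix.of fun i j =>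
    (1 / t) * ∫ s in (0 : ℝ)..t, (NormedSpace.exp (s • B) * Q * NormedSpace.exp (s • Bᵀ)) i j

/-- The transition kernel
`p(X,Y,t) = (4π)^(-N/2) det(t K(t))^(-1/2) exp(-⟨K(t)⁻¹(Y - e^{tB}X), Y - e^{tB}X⟩ / (4t))`. -/
def transitionKernel (X Y : Space N) (t : ℝ) : ℝ :=
  (4 * Real.pi) ^ (-(N : ℝ) / 2) * (t • covariance Q B t).det ^ (-(1 / 2) : ℝ) *
    Real.exp (-(((covariance Q B t)⁻¹ *ᵥ (Y.ofLp - NormedSpace.exp (t • B) *ᵥ X.ofLp)) ⬝ᵥ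
      (Y.ofLp - NormedSpace.exp (t • B) *ᵥ X.ofLp)) / (4 * t))

/-- The Poisson kernel with parameter `t`:
`P_z^{(a)}(X,Y,t) = (2^{1-a} Γ((1-a)/2))⁻¹ z^{1-a} t^{-(3-a)/2} exp(-z²/(4t)) p(X,Y,t)`. -/
def poissonKernelTime (a : ℝ) (X Y : Space N) (z t : ℝ) : ℝ :=
  1 / (2 ^ (1 - a) * Real.Gamma ((1 - a) / 2)) * (z ^ (1 - a) / t ^ ((3 - a) / 2)) *
    Real.exp (-z ^ 2 / (4 * t)) * transitionKernel Q B X Y t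

/-- The subordinated Poisson kernel `𝒫^{(a)}(X,Y,z) = ∫₀^∞ P_z^{(a)}(X,Y,t) dt`. -/
def subordinatedKernel (a : ℝ) (X Y : Space N) (z : ℝ) : ℝ :=
  ∫ t in Ioi (0 : ℝ), poissonKernelTime Q B a X Y z t

variable {F : Type*} [NormedAddCommGroup F] [NormedSpace ℝ F]

/-- `P_t f(X) = ∫ p(X,Y,t) f(Y) dY`. -/
def semigroup (t : ℝ) (f : Space N → F) (X : Space N) : F :=
  ∫ Y, transitionKernel Q B X Y t • f Y

/-- The fractional power
`(-𝒜)^s f(X) = -(s/Γ(1-s)) ∫₀^∞ t^{-s-1} (P_t f(X) - f(X)) dt`. -/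
def fractionalPower (s : ℝ) (f : Space N → F) (X : Space N) : F :=
  (-(s / Real.Gamma (1 - s))) •
    ∫ t in Ioi (0 : ℝ), t ^ (-s - 1) • (semigroup Q B t f X - f X)

/-- `U(X,z) = ∫ 𝒫^{(a)}(X,Y,z) f(Y) dY`. -/
def extension (a : ℝ) (f : Space N → F) (X : Space N) (z : ℝ) : F :=
  ∫ Y, subordinatedKernel Q B a X Y z • f Y

/-- The partial derivative `∂_i u`. -/
def partialDeriv (i : Fin N) (u : Space N → F) (X : Space N) : F :=
  fderiv ℝ u X (EuclideanSpace.single i 1)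

/-- The operator `𝒜u(X) = tr(Q ∇²u(X)) + ⟨BX, ∇u(X)⟩`. -/
def diffusionOperator (u : Space N → F) (X : Space N) : F :=
  (∑ i, ∑ j, Q i j • partialDeriv j (partialDeriv i u) X) +
    ∑ i, (B *ᵥ X.ofLp) i • partialDeriv i u X

/-- The Bessel operator `∂_zz + (a/z) ∂_z`. -/
def besselOperator (a : ℝ) (v : ℝ → F) (z : ℝ) : F :=
  deriv (deriv v) z + (a / z) • deriv v z

/-- The extension operator `z^a (𝒜 + ∂_zz + (a/z) ∂_z)` acting on a function of `(X,z)`. -/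
def extensionOperator (a : ℝ) (V : Space N → ℝ → F) (X : Space N) (z : ℝ) : F :=
  z ^ a • (diffusionOperator Q B (fun X' => V X' z) X + besselOperator a (V X) z)

end Kernels

/-- Convergence `V(·,z) → f` in `L^p(ℝ^N)` as `z → 0⁺`, for functions `V(·,z)`, `z > 0`, and `f`
which belong to `L^p(ℝ^N)`; `p = ∞` is allowed. -/
def TendstoInLp {N : ℕ} {F : Type*} [NormedAddCommGroup F] (p : ℝ≥0∞)
    (V : Space N → ℝ → F) (f : Space N → F) : Prop :=
  (∀ z : ℝ, 0 < z → MemLp (fun X => V X z) p volume) ∧ MemLp f p volume ∧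
    Tendsto (fun z : ℝ => eLpNorm (fun X => V X z - f X) p volume) (𝓝[>] 0) (𝓝 0)

end HormanderExtension

end

open HormanderExtension

/-! Write the Poisson kernel as w(z,t) p(X,Y,t). For each z > 0 the weight w(z,·) is a probability
density on (0,∞), so Fubini gives U(X,z) = ∫ w(z,t) P_tφ(X) dt (`extension_eq`). Since ∫ w dt = 1
and hence ∫ ∂_z w dt = 0, the datum φ can be subtracted under both integrals: U - φ = ∫ w (P_tφ - φ)
dt and ∂_zU = ∫ ∂_z w (P_tφ - φ) dt.

Boundary behaviour. Everything rests on ‖P_tφ - φ‖_p ≤ C min(t,1) (`eLpNorm_semigroup_sub_le`). With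
R Rᵀ = tK(t), P_tφ(X) is the mean of φ(e^{tB}X + Ry) over a centred Gaussian y. By symmetry in y
only a second difference of φ remains, of size |Ry|² ≤ tr(tK(t)) |y|² = O(t)|y|², together with the
drift φ(e^{tB}X) - φ(X) = O(t). Composition with e^{tB} does not increase the L^p norm, because det
e^{tB} ≥ 1 when tr B ≥ 0; for p = ∞ no condition is needed. By Minkowski's inequality, a kernel with
|k(t)| ≤ A t^{-1-β}, 0 < β < 1, gives ‖∫ k(t)(P_tφ - φ) dt‖_p ≤ C A (`exists_eLpNorm_integral_le`).
The weight satisfies this with β = s and A proportional to z^{2s}; the difference between the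
Neumann kernel and -s t^{-s-1}/Γ(1-s) satisfies it with β = s + θ and A proportional to z^{2θ}, θ =
(1-s)/2. Both constants tend to 0 with z.

Smoothness and the equation. On the Fourier side P_tφ(X) = ∫ exp(2πi⟨e^{tBᵀ}ξ,X⟩ - 4π²⟨tK(t)ξ,ξ⟩)
φ̂(ξ) dξ. In the variable y = z² this makes z^{-2s}U an integral over (t,ξ) of exponentials of
linear forms in (X,y), and differentiation only multiplies the integrand by such forms. The growth
of e^{tBᵀ}ξ for large t is absorbed because ⟨tK(t)ξ,ξ⟩ ≥ c|e^{tBᵀ}ξ|² for t ≥ 1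
(`exists_energy_lower_flow`). The differential operator multiplies the integrand by its own
logarithmic derivative in t; the integrand vanishes at t = 0 and t = ∞, so the integral is zero
(`integral_time_extensionSymbol`). Real data are reduced to complex data.

Convergence of the kernel integral itself needs a bound for det(tK(t))^{-1/2}: the determinant
extends to an entire function that is not identically zero, hence vanishes to finite order at 0, and
it is nondecreasing in t. -/

namespace HormanderExtension

/-! ### Minkowski's integral inequality -/

section Minkowski

variable {T Ω F : Type*} [MeasurableSpace T] [MeasurableSpace Ω]
  [NormedAddCommGroup F] [NormedSpace ℝ F]

/-- A weighted form of Hölder's inequality. -/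
theorem lintegral_rpow_le_of_weight {μ : Measure T} {r : ℝ} (hr : 1 < r) {f m : T → ℝ≥0∞}
    (hf : AEMeasurable f μ) (hm : AEMeasurable m μ) (hm0 : ∀ᵐ t ∂μ, m t ≠ 0)
    (hmt : ∀ᵐ t ∂μ, m t ≠ ⊤) :
    (∫⁻ t, f t ∂μ) ^ r ≤ (∫⁻ t, m t ∂μ) ^ (r - 1) * ∫⁻ t, f t ^ r * m t ^ (1 - r) ∂μ := by
  have hr0 : 0 < r := by linarith
  have hr1 : 0 < r - 1 := by linarith
  have hpq : r.HolderConjugate (r / (r - 1)) := Real.HolderConjugate.conjExponent hr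
  -- Hölder for the factorization f = (f m^{-1/q}) · m^{1/q}, where 1/q = (r-1)/r.
  have key := ENNReal.lintegral_mul_le_Lp_mul_Lq μ hpq
    (f := fun t => f t * m t ^ (-((r - 1) / r))) (g := fun t => m t ^ ((r - 1) / r))
    (hf.mul (hm.pow_const _)) (hm.pow_const _)
  have e1 : ∫⁻ t, ((fun t => f t * m t ^ (-((r - 1) / r))) * fun t => m t ^ ((r - 1) / r)) t ∂μ
      = ∫⁻ t, f t ∂μ := by
    refine lintegral_congr_ae ?_
    filter_upwards [hm0, hmt] with t h0 ht
    simp only [Pi.mul_apply]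
    rw [mul_assoc, ← ENNReal.rpow_add _ _ h0 ht, neg_add_cancel, ENNReal.rpow_zero, mul_one]
  have e2 : ∫⁻ t, (f t * m t ^ (-((r - 1) / r))) ^ r ∂μ = ∫⁻ t, f t ^ r * m t ^ (1 - r) ∂μ := by
    refine lintegral_congr fun t => ?_
    rw [ENNReal.mul_rpow_of_nonneg _ _ hr0.le, ← ENNReal.rpow_mul]
    congr 2
    field_simp
    ring
  have e3 : ∫⁻ t, (m t ^ ((r - 1) / r)) ^ (r / (r - 1)) ∂μ = ∫⁻ t, m t ∂μ := by
    refine lintegral_congr fun t => ?_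
    rw [← ENNReal.rpow_mul, div_mul_div_cancel₀ hr0.ne', div_self hr1.ne', ENNReal.rpow_one]
  rw [e1, e2, e3] at key
  calc (∫⁻ t, f t ∂μ) ^ r ≤ _ := ENNReal.rpow_le_rpow key hr0.le
    _ = _ := by
      rw [ENNReal.mul_rpow_of_nonneg _ _ hr0.le, ← ENNReal.rpow_mul, ← ENNReal.rpow_mul,
        one_div_mul_cancel hr0.ne', ENNReal.rpow_one, mul_comm]
      congr 2
      field_simp

/-- Minkowski's integral inequality, in terms of a majorant of the `L^p` norms. -/
theorem eLpNorm_integral_le {μ : Measure T} {ν : Measure Ω} [SFinite μ] [SFinite ν]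
    {h : T → Ω → F} (hh : AEStronglyMeasurable (Function.uncurry h) (μ.prod ν))
    {p : ℝ≥0∞} (hp : 1 ≤ p) {m : T → ℝ≥0∞} (hm : AEMeasurable m μ) (hm0 : ∀ᵐ t ∂μ, m t ≠ 0)
    (hmt : ∀ᵐ t ∂μ, m t ≠ ⊤) (hle : ∀ᵐ t ∂μ, eLpNorm (h t) p ν ≤ m t) :
    eLpNorm (fun x => ∫ t, h t x ∂μ) p ν ≤ ∫⁻ t, m t ∂μ := by
  have hmeas : AEMeasurable (Function.uncurry fun t x => ‖h t x‖ₑ) (μ.prod ν) := hh.enorm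
  rcases eq_or_ne p ⊤ with rfl | hpt
  · rw [eLpNorm_exponent_top]
    refine eLpNormEssSup_le_of_ae_enorm_bound ?_
    -- Exchanging "a.e. t, a.e. x" for "a.e. x, a.e. t" requires a measurable set, hence the
    -- measurable representatives H and M.
    let H : T × Ω → ℝ≥0∞ := hmeas.mk
    have hHm : Measurable H := hmeas.measurable_mk
    let M : T → ℝ≥0∞ := hm.mk
    have hMm : Measurable M := hm.measurable_mk
    have e1 : ∀ᵐ t ∂μ, ∀ᵐ x ∂ν, ‖h t x‖ₑ = H (t, x) :=
      Measure.ae_ae_of_ae_prod hmeas.ae_eq_mk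
    have e2 : ∀ᵐ t ∂μ, ∀ᵐ x ∂ν, H (t, x) ≤ M t := by
      filter_upwards [e1, hle, hm.ae_eq_mk] with t ht h1 h2
      rw [eLpNorm_exponent_top] at h1
      filter_upwards [ht, ae_le_eLpNormEssSup (f := h t) (μ := ν)] with x hx hx2
      rw [← hx]
      exact (hx2.trans h1).trans_eq h2
    have e3 : ∀ᵐ x ∂ν, ∀ᵐ t ∂μ, H (t, x) ≤ M t :=
      (Measure.ae_ae_comm (p := fun t x => H (t, x) ≤ M t)
        (measurableSet_le hHm (hMm.comp measurable_fst))).1 e2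
    have e4 : ∀ᵐ x ∂ν, ∀ᵐ t ∂μ, ‖h t x‖ₑ = H (t, x) :=
      Measure.ae_ae_of_ae_prod (p := fun z : Ω × T => ‖h z.2 z.1‖ₑ = H (z.2, z.1))
        (Measure.measurePreserving_swap.quasiMeasurePreserving.ae hmeas.ae_eq_mk)
    filter_upwards [e3, e4] with x h3 h4
    refine (enorm_integral_le_lintegral_enorm _).trans (lintegral_mono_ae ?_)
    filter_upwards [h3, h4, hm.ae_eq_mk] with t h5 h6 h7
    rw [h6, h7]
    exact h5
  · have hp0 : p ≠ 0 := (zero_lt_one.trans_le hp).ne'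
    set r := p.toReal with hrdef
    have hr : 1 ≤ r := by
      have := ENNReal.toReal_mono hpt hp
      simpa using this
    have hr0 : 0 < r := by linarith
    have hcomm : ∀ g : T → Ω → ℝ≥0∞, AEMeasurable (Function.uncurry g) (μ.prod ν) →
        ∫⁻ x, ∫⁻ t, g t x ∂μ ∂ν = ∫⁻ t, ∫⁻ x, g t x ∂ν ∂μ := fun g hg =>
      (lintegral_lintegral_swap hg).symm
    have hpow : ∀ᵐ t ∂μ, ∫⁻ x, ‖h t x‖ₑ ^ r ∂ν ≤ m t ^ r := by
      filter_upwards [hle] with t ht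
      rw [eLpNorm_eq_lintegral_rpow_enorm_toReal hp0 hpt, ← hrdef] at ht
      have := ENNReal.rpow_le_rpow ht hr0.le
      rwa [← ENNReal.rpow_mul, one_div_mul_cancel hr0.ne', ENNReal.rpow_one] at this
    rw [eLpNorm_eq_lintegral_rpow_enorm_toReal hp0 hpt, ← hrdef]
    have main : ∫⁻ x, (∫⁻ t, ‖h t x‖ₑ ∂μ) ^ r ∂ν ≤ (∫⁻ t, m t ∂μ) ^ r := by
      rcases hr.eq_or_lt with h1 | h1
      · rw [← h1] at hpow ⊢
        simp only [ENNReal.rpow_one] at hpow ⊢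
        rw [hcomm _ hmeas]
        exact lintegral_mono_ae hpow
      · have hx : ∀ᵐ x ∂ν, AEMeasurable (fun t => ‖h t x‖ₑ) μ := by
          have := hh.prod_swap.prodMk_left
          filter_upwards [this] with x hx
          exact hx.enorm
        -- The majorant m itself serves as the Hölder weight, which avoids duality: after Tonelli
        -- the inner integral is at most m^r · m^{1-r} = m. This is why m must be neither 0 nor ∞.
        calc ∫⁻ x, (∫⁻ t, ‖h t x‖ₑ ∂μ) ^ r ∂ν
            ≤ ∫⁻ x, (∫⁻ t, m t ∂μ) ^ (r - 1) * ∫⁻ t, ‖h t x‖ₑ ^ r * m t ^ (1 - r) ∂μ ∂ν := by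
              refine lintegral_mono_ae ?_
              filter_upwards [hx] with x hx
              exact lintegral_rpow_le_of_weight h1 hx hm hm0 hmt
          _ = (∫⁻ t, m t ∂μ) ^ (r - 1) *
              ∫⁻ x, ∫⁻ t, ‖h t x‖ₑ ^ r * m t ^ (1 - r) ∂μ ∂ν := by
              refine lintegral_const_mul'' _ ?_
              exact AEMeasurable.lintegral_prod_right' (f := fun z : Ω × T =>
                ‖h z.2 z.1‖ₑ ^ r * m z.2 ^ (1 - r))
                ((hh.prod_swap.enorm.pow_const r).mul
                  ((hm.comp_snd (μ := ν)).pow_const _))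
          _ = (∫⁻ t, m t ∂μ) ^ (r - 1) *
              ∫⁻ t, ∫⁻ x, ‖h t x‖ₑ ^ r * m t ^ (1 - r) ∂ν ∂μ := by
              rw [hcomm]
              exact (hmeas.pow_const r).mul ((hm.comp_fst (ν := ν)).pow_const _)
          _ ≤ (∫⁻ t, m t ∂μ) ^ (r - 1) * ∫⁻ t, m t ∂μ := by
              refine mul_le_mul' le_rfl (lintegral_mono_ae ?_)
              filter_upwards [hpow, hm0, hmt] with t ht h0 hT
              rw [lintegral_mul_const' _ _ (ENNReal.rpow_ne_top_of_ne_zero h0 hT)]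
              calc _ ≤ m t ^ r * m t ^ (1 - r) := by gcongr
                _ = m t := by
                  rw [← ENNReal.rpow_add _ _ h0 hT]
                  simp
          _ = (∫⁻ t, m t ∂μ) ^ r := by
              conv_lhs => rw [← ENNReal.rpow_one (∫⁻ t, m t ∂μ), ← ENNReal.rpow_mul, one_mul]
              rw [← ENNReal.rpow_add_of_nonneg _ _ (by linarith) zero_le_one]
              simp
    calc (∫⁻ x, ‖∫ t, h t x ∂μ‖ₑ ^ r ∂ν) ^ (1 / r)
        ≤ (∫⁻ x, (∫⁻ t, ‖h t x‖ₑ ∂μ) ^ r ∂ν) ^ (1 / r) := by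
          gcongr
          exact enorm_integral_le_lintegral_enorm _
      _ ≤ ((∫⁻ t, m t ∂μ) ^ r) ^ (1 / r) := by gcongr
      _ = ∫⁻ t, m t ∂μ := by
          rw [← ENNReal.rpow_mul, mul_one_div_cancel hr0.ne', ENNReal.rpow_one]

end Minkowski

/-! ### The subordination weight w(z,t) and its derivative in z -/

section Subordination

/-- The substitution t ↦ 1/t with its Jacobian, in the shape given by the change of variables t ↦
t^p at p = -1. It reduces the integrals below to Gamma integrals. -/
theorem rpow_neg_mul_exp_neg_div_eq {r b t : ℝ} (ht : 0 < t) :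
    (|(-1 : ℝ)| * t ^ ((-1 : ℝ) - 1)) • ((t ^ (-1 : ℝ)) ^ (r - 2) * Real.exp (-(b * t ^ (-1 : ℝ))))
      = t ^ (-r) * Real.exp (-b / t) := by
  rw [← Real.rpow_mul ht.le, smul_eq_mul, abs_neg, abs_one, one_mul, ← mul_assoc,
    ← Real.rpow_add ht, Real.rpow_neg_one]
  congr 2 <;> ring

theorem integrableOn_rpow_neg_mul_exp_neg_div {r b : ℝ} (hr : 1 < r) (hb : 0 < b) :
    IntegrableOn (fun t : ℝ => t ^ (-r) * Real.exp (-b / t)) (Ioi 0) := by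
  have h := (integrableOn_Ioi_comp_rpow_iff
    (fun t : ℝ => t ^ (r - 2) * Real.exp (-(b * t))) (p := -1) (by norm_num)).2 (by
      have := integrableOn_rpow_mul_exp_neg_mul_rpow (s := r - 2) (p := 1) (b := b)
        (by linarith) one_pos hb
      simpa using this)
  exact h.congr_fun (fun t ht => rpow_neg_mul_exp_neg_div_eq ht) measurableSet_Ioi

theorem integral_rpow_neg_mul_exp_neg_div {r b : ℝ} (hr : 1 < r) (hb : 0 < b) :
    ∫ t in Ioi (0 : ℝ), t ^ (-r) * Real.exp (-b / t) = b ^ (1 - r) * Real.Gamma (r - 1) := by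
  have h := integral_comp_rpow_Ioi
    (fun t : ℝ => t ^ (r - 2) * Real.exp (-(b * t))) (p := -1) (by norm_num)
  rw [setIntegral_congr_fun measurableSet_Ioi
    (fun t ht => rpow_neg_mul_exp_neg_div_eq ht)] at h
  have h2 := Real.integral_rpow_mul_exp_neg_mul_Ioi (a := r - 1) (r := b) (by linarith) hb
  rw [h, show r - 2 = r - 1 - 1 by ring, h2, one_div, Real.inv_rpow hb.le,
    ← Real.rpow_neg hb.le, neg_sub]

theorem tendsto_rpow_neg_mul_exp_neg_div_atTop {r b : ℝ} (hr : 0 < r) :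
    Tendsto (fun t : ℝ => t ^ (-r) * Real.exp (-b / t)) atTop (𝓝 0) := by
  have h1 := tendsto_rpow_neg_atTop hr
  have h2 : Tendsto (fun t : ℝ => Real.exp (-b / t)) atTop (𝓝 (Real.exp 0)) :=
    (Real.continuous_exp.tendsto 0).comp (tendsto_const_nhds.div_atTop tendsto_id)
  simpa using h1.mul h2

theorem tendsto_rpow_neg_mul_exp_neg_div_nhdsGT {r b : ℝ} (hb : 0 < b) :
    Tendsto (fun t : ℝ => t ^ (-r) * Real.exp (-b / t)) (𝓝[>] 0) (𝓝 0) := by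
  have h1 := (tendsto_rpow_mul_exp_neg_mul_atTop_nhds_zero r b hb).comp tendsto_inv_nhdsGT_zero
  refine h1.congr' ?_
  filter_upwards [self_mem_nhdsWithin] with t ht
  simp only [Function.comp_apply]
  rw [Real.inv_rpow (le_of_lt ht), Real.rpow_neg (le_of_lt ht), div_eq_mul_inv]

/-- The weight `w(z,t)` which subordinates the Poisson kernel to the semigroup. -/
noncomputable def weight (s z t : ℝ) : ℝ :=
  1 / (2 ^ (2 * s) * Real.Gamma s) * (z ^ (2 * s) / t ^ (1 + s)) * Real.exp (-z ^ 2 / (4 * t))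

/-- The derivative of the weight in `z`. -/
noncomputable def weightDeriv (s z t : ℝ) : ℝ :=
  weight s z t * (2 * s / z - z / (2 * t))

theorem weight_eq {s z t : ℝ} (ht : 0 < t) :
    weight s z t = 1 / (2 ^ (2 * s) * Real.Gamma s) * z ^ (2 * s) *
      (t ^ (-(1 + s)) * Real.exp (-(z ^ 2 / 4) / t)) := by
  rw [weight, Real.rpow_neg ht.le, show -z ^ 2 / (4 * t) = -(z ^ 2 / 4) / t by field_simp]
  ring

theorem weight_nonneg {s z t : ℝ} (hs : 0 < s) (hz : 0 < z) (ht : 0 < t) : 0 ≤ weight s z t := by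
  have := Real.Gamma_pos_of_pos hs
  rw [weight]
  positivity

theorem integrableOn_weight {s z : ℝ} (hs : 0 < s) (hz : 0 < z) :
    IntegrableOn (weight s z) (Ioi 0) := by
  have h := (integrableOn_rpow_neg_mul_exp_neg_div (r := 1 + s) (b := z ^ 2 / 4)
    (by linarith) (by positivity)).const_mul (1 / (2 ^ (2 * s) * Real.Gamma s) * z ^ (2 * s))
  exact IntegrableOn.congr_fun h (fun t ht => (weight_eq ht).symm) measurableSet_Ioi

/-- With b = z²/4 the Gamma integral equals b^{-s} Γ(s), which is exactly the reciprocal of the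
prefactor. -/
theorem integral_weight {s z : ℝ} (hs : 0 < s) (hz : 0 < z) :
    ∫ t in Ioi (0 : ℝ), weight s z t = 1 := by
  rw [setIntegral_congr_fun measurableSet_Ioi (fun t ht => weight_eq ht), integral_const_mul,
    integral_rpow_neg_mul_exp_neg_div (by linarith) (by positivity)]
  have h1 := (Real.Gamma_pos_of_pos hs).ne'
  have h2 : (z ^ 2 / 4 : ℝ) ^ (1 - (1 + s)) = (2 ^ (2 * s)) / z ^ (2 * s) := by
    rw [show (z ^ 2 / 4 : ℝ) = (z / 2) ^ (2 : ℝ) by rw [Real.rpow_two]; ring,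
      ← Real.rpow_mul (by positivity), show 2 * (1 - (1 + s)) = - (2 * s) by ring,
      Real.rpow_neg (by positivity), Real.div_rpow hz.le zero_le_two, inv_div]
  have h3 : (0 : ℝ) < z ^ (2 * s) := Real.rpow_pos_of_pos hz _
  have h4 : (0 : ℝ) < 2 ^ (2 * s) := Real.rpow_pos_of_pos two_pos _
  rw [h2, show 1 + s - 1 = s by ring]
  field_simp

theorem hasDerivAt_weight {s z t : ℝ} (hz : 0 < z) (ht : 0 < t) :
    HasDerivAt (fun ζ => weight s ζ t) (weightDeriv s z t) z := by
  have h1 : HasDerivAt (fun ζ : ℝ => ζ ^ (2 * s)) (2 * s * z ^ (2 * s - 1)) z :=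
    Real.hasDerivAt_rpow_const (Or.inl hz.ne')
  have h2 : HasDerivAt (fun ζ : ℝ => -ζ ^ 2 / (4 * t)) (-(2 * z) / (4 * t)) z := by
    have := ((hasDerivAt_pow 2 z).neg).div_const (4 * t)
    simpa using this
  have h3 := ((h1.div_const (t ^ (1 + s))).const_mul
    (1 / (2 ^ (2 * s) * Real.Gamma s))).mul h2.exp
  refine h3.congr_deriv ?_
  rw [weightDeriv, weight, Real.rpow_sub hz, Real.rpow_one]
  field_simp
  ring

theorem measurable_weight (s z : ℝ) : Measurable (weight s z) := by
  unfold weight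
  fun_prop

theorem measurable_weightDeriv (s z : ℝ) : Measurable (weightDeriv s z) := by
  unfold weightDeriv
  have := measurable_weight s z
  fun_prop

/-- A bound for `∂_z w(z,t)`, uniform for `z` near `z₀`. -/
theorem exists_bound_weightDeriv {s z₀ : ℝ} (hs : 0 < s) (hz : 0 < z₀) :
    ∃ g : ℝ → ℝ, IntegrableOn g (Ioi 0) ∧
      ∀ t ∈ Ioi (0 : ℝ), ∀ z ∈ Ioo (z₀ / 2) (2 * z₀), |weightDeriv s z t| ≤ g t := by
  have hΓ := Real.Gamma_pos_of_pos hs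
  -- Worst cases over the interval (z₀/2, 2z₀): the exponential is largest at the left end, the
  -- power z^{2s} at the right end.
  set b := (z₀ / 2) ^ 2 / 4 with hb
  have hb0 : 0 < b := by positivity
  set K := 1 / (2 ^ (2 * s) * Real.Gamma s) * (2 * z₀) ^ (2 * s) with hK
  have hK0 : 0 < K := by positivity
  refine ⟨fun t => K * (4 * s / z₀) * (t ^ (-(1 + s)) * Real.exp (-b / t)) +
    K * z₀ * (t ^ (-(2 + s)) * Real.exp (-b / t)), ?_, fun t ht z hz' => ?_⟩
  · exact ((integrableOn_rpow_neg_mul_exp_neg_div (by linarith) hb0).const_mul _).add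
      ((integrableOn_rpow_neg_mul_exp_neg_div (by linarith) hb0).const_mul _)
  · have ht0 : 0 < t := ht
    have hz0 : 0 < z := by linarith [hz'.1]
    have hw : weight s z t ≤ K * (t ^ (-(1 + s)) * Real.exp (-b / t)) := by
      rw [weight_eq ht]
      have e1 : 1 / (2 ^ (2 * s) * Real.Gamma s) * z ^ (2 * s) ≤ K := by
        rw [hK]
        gcongr
        exact hz'.2.le
      have e2 : b ≤ z ^ 2 / 4 := by
        rw [hb]
        gcongr
        exact hz'.1.le
      gcongr
    have hw0 := weight_nonneg hs hz0 ht0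
    have h2 : |2 * s / z - z / (2 * t)| ≤ 4 * s / z₀ + z₀ / t := by
      refine (abs_sub _ _).trans ?_
      rw [abs_of_nonneg (by positivity), abs_of_nonneg (by positivity)]
      have e1 : 2 * s / z ≤ 4 * s / z₀ := by
        rw [div_le_div_iff₀ hz0 hz]
        nlinarith [hz'.1]
      have e2 : z / (2 * t) ≤ z₀ / t := by
        rw [div_le_div_iff₀ (by positivity) ht0]
        nlinarith [hz'.2]
      linarith
    rw [weightDeriv, abs_mul, abs_of_nonneg hw0]
    calc _ ≤ (K * (t ^ (-(1 + s)) * Real.exp (-b / t))) * (4 * s / z₀ + z₀ / t) := by gcongr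
      _ = _ := by
        simp only []
        rw [show -(2 + s) = -(1 + s) + (-1) by ring, Real.rpow_add ht0, Real.rpow_neg_one]
        field_simp

variable {F : Type*} [NormedAddCommGroup F] [NormedSpace ℝ F]

theorem integrableOn_weight_smul {s z K : ℝ} (hs : 0 < s) (hz : 0 < z) {u : ℝ → F}
    (hu : AEStronglyMeasurable u (volume.restrict (Ioi 0))) (hb : ∀ t : ℝ, 0 < t → ‖u t‖ ≤ K) :
    IntegrableOn (fun t => weight s z t • u t) (Ioi 0) :=
  (integrableOn_weight hs hz).smul_bdd K hu
    ((ae_restrict_iff' measurableSet_Ioi).2 (Eventually.of_forall hb))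

/-- Differentiation of a subordinated function in `z`. -/
theorem hasDerivAt_integral_weight_smul {s z K : ℝ} (hs : 0 < s) (hz : 0 < z) {u : ℝ → F}
    (hu : AEStronglyMeasurable u (volume.restrict (Ioi 0))) (hb : ∀ t : ℝ, 0 < t → ‖u t‖ ≤ K) :
    IntegrableOn (fun t => weightDeriv s z t • u t) (Ioi 0) ∧
    HasDerivAt (fun ζ => ∫ t in Ioi (0 : ℝ), weight s ζ t • u t)
      (∫ t in Ioi (0 : ℝ), weightDeriv s z t • u t) z := by
  obtain ⟨g, hg, hle⟩ := exists_bound_weightDeriv hs hz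
  refine hasDerivAt_integral_of_dominated_loc_of_deriv_le
    (F := fun ζ t => weight s ζ t • u t) (F' := fun ζ t => weightDeriv s ζ t • u t)
    (bound := fun t => g t * K) (s := Ioo (z / 2) (2 * z))
    (Ioo_mem_nhds (by linarith) (by linarith)) ?_ (integrableOn_weight_smul hs hz hu hb) ?_ ?_
    (hg.mul_const K) ?_
  · exact Eventually.of_forall fun ζ => (measurable_weight s ζ).aestronglyMeasurable.smul hu
  · exact (measurable_weightDeriv s z).aestronglyMeasurable.smul hu
  · refine (ae_restrict_iff' measurableSet_Ioi).2 (Eventually.of_forall fun t ht ζ hζ => ?_)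
    rw [norm_smul, Real.norm_eq_abs]
    have h0 : 0 ≤ g t := (abs_nonneg _).trans (hle t ht ζ hζ)
    exact mul_le_mul (hle t ht ζ hζ) (hb t ht) (norm_nonneg _) h0
  · refine (ae_restrict_iff' measurableSet_Ioi).2 (Eventually.of_forall fun t ht ζ hζ => ?_)
    exact (hasDerivAt_weight (by linarith [hζ.1]) ht).smul_const (u t)

theorem integrableOn_weightDeriv {s z : ℝ} (hs : 0 < s) (hz : 0 < z) :
    IntegrableOn (weightDeriv s z) (Ioi 0) := by
  have h := (hasDerivAt_integral_weight_smul (u := fun _ => (1 : ℝ)) (K := 1) hs hz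
    aestronglyMeasurable_const (fun _ _ => by simp)).1
  simpa using h

/-- The total mass of the weight does not depend on z, and differentiation under the integral is
legitimate. -/
theorem integral_weightDeriv {s z : ℝ} (hs : 0 < s) (hz : 0 < z) :
    ∫ t in Ioi (0 : ℝ), weightDeriv s z t = 0 := by
  have h := (hasDerivAt_integral_weight_smul (u := fun _ => (1 : ℝ)) (K := 1) hs hz
    aestronglyMeasurable_const (fun _ _ => by simp)).2
  simp only [smul_eq_mul, mul_one] at h
  have h2 : HasDerivAt (fun ζ => ∫ t in Ioi (0 : ℝ), weight s ζ t) 0 z := by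
    refine (hasDerivAt_const z (1 : ℝ)).congr_of_eventuallyEq ?_
    filter_upwards [lt_mem_nhds hz] with ζ hζ
    exact integral_weight hs hζ
  exact h.unique h2

end Subordination

/-! ### Smoothness of integrals of exponentials of linear forms -/

section ExpIntegral

variable {Ω E : Type*} [MeasurableSpace Ω] [NormedAddCommGroup E] [NormedSpace ℝ E]

/-- The functions `g` for which `x ↦ ∫ exp(ℓ_τ x) g(τ) dμ(τ)` can be differentiated under the
integral arbitrarily often on `O`. -/
structure ExpMajorized (μ : Measure Ω) (l : Ω → E →L[ℝ] ℂ) (O : Set E) (g : Ω → ℂ) : Prop where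
  aestronglyMeasurable : AEStronglyMeasurable g μ
  exists_majorant : ∀ x ∈ O, ∃ V ∈ 𝓝 x, ∃ M : Ω → ℝ, (∀ᵐ τ ∂μ, ∀ y ∈ V, (l τ y).re ≤ M τ) ∧
    ∀ k : ℕ, ∃ G : Ω → ℝ, Integrable G μ ∧ ∀ᵐ τ ∂μ, Real.exp (M τ) * ‖l τ‖ ^ k * ‖g τ‖ ≤ G τ

variable {μ : Measure Ω} {l : Ω → E →L[ℝ] ℂ} {O : Set E} {g : Ω → ℂ}

/-- One derivative in direction v multiplies the integrand by l(v). Majorants are demanded for every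
power k so that this costs only a shift k ↦ k + 1 and the class is stable. -/
theorem ExpMajorized.apply_mul (h : ExpMajorized μ l O g) (hl : AEStronglyMeasurable l μ) (v : E) :
    ExpMajorized μ l O (fun τ => l τ v * g τ) where
  aestronglyMeasurable := (hl.apply_continuousLinearMap v).mul h.aestronglyMeasurable
  exists_majorant x hx := by
    obtain ⟨V, hV, M, hM, hk⟩ := h.exists_majorant x hx
    refine ⟨V, hV, M, hM, fun k => ?_⟩
    obtain ⟨G, hG, hle⟩ := hk (k + 1)
    refine ⟨fun τ => ‖v‖ * G τ, hG.const_mul _, ?_⟩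
    filter_upwards [hle] with τ hτ
    calc Real.exp (M τ) * ‖l τ‖ ^ k * ‖l τ v * g τ‖
        ≤ Real.exp (M τ) * ‖l τ‖ ^ k * ((‖l τ‖ * ‖v‖) * ‖g τ‖) := by
          rw [norm_mul]
          gcongr
          exact (l τ).le_opNorm v
      _ = ‖v‖ * (Real.exp (M τ) * ‖l τ‖ ^ (k + 1) * ‖g τ‖) := by ring
      _ ≤ _ := by gcongr

theorem ExpMajorized.integrable (h : ExpMajorized μ l O g) (hl : AEStronglyMeasurable l μ)
    {x : E} (hx : x ∈ O) : Integrable (fun τ => Complex.exp (l τ x) * g τ) μ := by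
  obtain ⟨V, hV, M, hM, hk⟩ := h.exists_majorant x hx
  obtain ⟨G, hG, hle⟩ := hk 0
  refine hG.mono' ((Complex.continuous_exp.comp_aestronglyMeasurable
    (hl.apply_continuousLinearMap x)).mul h.aestronglyMeasurable) ?_
  filter_upwards [hM, hle] with τ h1 h2
  rw [norm_mul, Complex.norm_exp]
  refine le_trans ?_ h2
  rw [pow_zero, mul_one]
  gcongr
  exact h1 x (mem_of_mem_nhds hV)

/-- The derivative is described through its values on vectors, because each of these is again an
integral of the same type, ready for the next differentiation. -/
theorem ExpMajorized.hasFDerivAt (h : ExpMajorized μ l O g) (hl : AEStronglyMeasurable l μ)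
    {x : E} (hx : x ∈ O) :
    ∃ D : E →L[ℝ] ℂ, HasFDerivAt (fun x => ∫ τ, Complex.exp (l τ x) * g τ ∂μ) D x ∧
      ∀ v, D v = ∫ τ, Complex.exp (l τ x) * (l τ v * g τ) ∂μ := by
  obtain ⟨V, hV, M, hM, hk⟩ := h.exists_majorant x hx
  obtain ⟨G, hG, hle⟩ := hk 1
  have hexp : ∀ y, AEStronglyMeasurable (fun τ => Complex.exp (l τ y)) μ := fun y =>
    Complex.continuous_exp.comp_aestronglyMeasurable (hl.apply_continuousLinearMap y)
  have hD : AEStronglyMeasurable (fun τ => (Complex.exp (l τ x) * g τ) • l τ) μ :=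
    ((hexp x).mul h.aestronglyMeasurable).smul hl
  have hbound : ∀ᵐ τ ∂μ, ∀ y ∈ V, ‖(Complex.exp (l τ y) * g τ) • l τ‖ ≤ G τ := by
    filter_upwards [hM, hle] with τ h1 h2 y hy
    rw [norm_smul, norm_mul, Complex.norm_exp]
    calc Real.exp (l τ y).re * ‖g τ‖ * ‖l τ‖ ≤ Real.exp (M τ) * ‖g τ‖ * ‖l τ‖ := by
          gcongr
          exact h1 y hy
      _ = Real.exp (M τ) * ‖l τ‖ ^ 1 * ‖g τ‖ := by ring
      _ ≤ G τ := h2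
  refine ⟨∫ τ, (Complex.exp (l τ x) * g τ) • l τ ∂μ, ?_, fun v => ?_⟩
  · refine hasFDerivAt_integral_of_dominated_of_fderiv_le
      (F' := fun y τ => (Complex.exp (l τ y) * g τ) • l τ) (bound := G) hV
      (Eventually.of_forall fun y => (hexp y).mul h.aestronglyMeasurable) (h.integrable hl hx) hD
      hbound hG (Eventually.of_forall fun τ y _ => ?_)
    have := ((l τ).hasFDerivAt (x := y)).cexp.mul_const (g τ)
    refine this.congr_fderiv ?_
    ext v
    simp
    ring
  · have hint : Integrable (fun τ => (Complex.exp (l τ x) * g τ) • l τ) μ :=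
      hG.mono' hD (hbound.mono fun τ hτ => hτ x (mem_of_mem_nhds hV))
    rw [ContinuousLinearMap.integral_apply hint]
    refine integral_congr_ae (Eventually.of_forall fun τ => ?_)
    simp
    ring

theorem ExpMajorized.contDiffOn [FiniteDimensional ℝ E] (hl : AEStronglyMeasurable l μ)
    (hO : IsOpen O) (h : ExpMajorized μ l O g) :
    ContDiffOn ℝ ∞ (fun x => ∫ τ, Complex.exp (l τ x) * g τ ∂μ) O := by
  rw [contDiffOn_infty]
  intro n
  induction n generalizing g with
  | zero =>
    refine contDiffOn_zero.2 fun x hx => ?_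
    obtain ⟨D, hD, -⟩ := h.hasFDerivAt hl hx
    exact hD.continuousAt.continuousWithinAt
  | succ n ih =>
    have : ((n + 1 : ℕ) : WithTop ℕ∞) = (n : WithTop ℕ∞) + 1 := by norm_cast
    rw [this, contDiffOn_succ_iff_fderiv_of_isOpen hO]
    refine ⟨fun x hx => ?_, fun h => by simp at h, ?_⟩
    · obtain ⟨D, hD, -⟩ := h.hasFDerivAt hl hx
      exact hD.differentiableAt.differentiableWithinAt
    · refine contDiffOn_clm_apply.2 fun v => ?_
      refine (ih (h.apply_mul hl v)).congr fun x hx => ?_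
      obtain ⟨D, hD, hv⟩ := h.hasFDerivAt hl hx
      rw [hD.fderiv, hv]

end ExpIntegral

/-! ### The flow e^{tB} and the quadratic form of tK(t) -/

section Flow

open scoped RealInnerProductSpace

variable {N : ℕ}

/-- The linear flow `e^{tB}` on `ℝ^N`. -/
noncomputable def flow (B : Matrix (Fin N) (Fin N) ℝ) (t : ℝ) : Space N →L[ℝ] Space N :=
  Matrix.toEuclideanCLM (𝕜 := ℝ) (NormedSpace.exp (t • B))

variable (Q B : Matrix (Fin N) (Fin N) ℝ)

theorem ofLp_flow (t : ℝ) (x : Space N) :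
    (flow B t x).ofLp = NormedSpace.exp (t • B) *ᵥ x.ofLp :=
  Matrix.ofLp_toEuclideanCLM _ _

/-- The exponential depends only on the topology, so an auxiliary matrix norm may be chosen locally
to carry it to the normed algebra of operators, where its derivative is known. -/
theorem flow_eq_exp (t : ℝ) :
    flow B t = NormedSpace.exp (t • (Matrix.toEuclideanCLM (𝕜 := ℝ) B : Space N →L[ℝ] Space N)) := by
  let _ : NormedRing (Matrix (Fin N) (Fin N) ℝ) := Matrix.linftyOpNormedRing
  let _ : NormedAlgebra ℝ (Matrix (Fin N) (Fin N) ℝ) := Matrix.linftyOpNormedAlgebra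
  let _ : NormedAlgebra ℚ (Matrix (Fin N) (Fin N) ℝ) := NormedAlgebra.restrictScalars ℚ ℝ _
  have hc : Continuous (Matrix.toEuclideanCLM (n := Fin N) (𝕜 := ℝ)) :=
    LinearMap.continuous_of_finiteDimensional
      ((Matrix.toEuclideanCLM (n := Fin N) (𝕜 := ℝ)).toAlgEquiv.toLinearMap)
  have := NormedSpace.map_exp (Matrix.toEuclideanCLM (n := Fin N) (𝕜 := ℝ)) hc (t • B)
  exact this.trans (congrArg _ (map_smul _ _ _))

theorem flow_zero : flow B 0 = 1 := by
  have h : (0 : ℝ) • (Matrix.toEuclideanCLM (𝕜 := ℝ) B : Space N →L[ℝ] Space N) = 0 := by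
    ext x
    simp
  rw [flow_eq_exp, h, NormedSpace.exp_zero]

theorem flow_add (t r : ℝ) : flow B (t + r) = flow B t * flow B r := by
  rw [flow, add_smul, Matrix.exp_add_of_commute _ _ ((Commute.refl B).smul_left t |>.smul_right r),
    map_mul]
  rfl

theorem flow_add_apply (t r : ℝ) (x : Space N) : flow B (t + r) x = flow B t (flow B r x) := by
  rw [flow_add]
  rfl

theorem hasDerivAt_flow (t : ℝ) :
    HasDerivAt (flow B) (flow B t * Matrix.toEuclideanCLM (𝕜 := ℝ) B) t := by
  have h := hasDerivAt_exp_smul_const (𝕂 := ℝ)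
    (Matrix.toEuclideanCLM (𝕜 := ℝ) B : Space N →L[ℝ] Space N) t
  rw [flow_eq_exp]
  exact h.congr_of_eventuallyEq (Eventually.of_forall fun u => flow_eq_exp B u)

theorem hasDerivAt_flow' (t : ℝ) :
    HasDerivAt (flow B) (Matrix.toEuclideanCLM (𝕜 := ℝ) B * flow B t) t := by
  have h := hasDerivAt_exp_smul_const' (𝕂 := ℝ)
    (Matrix.toEuclideanCLM (𝕜 := ℝ) B : Space N →L[ℝ] Space N) t
  rw [flow_eq_exp]
  exact h.congr_of_eventuallyEq (Eventually.of_forall fun u => flow_eq_exp B u)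

theorem continuous_flow : Continuous (flow B) :=
  continuous_iff_continuousAt.2 fun t => (hasDerivAt_flow B t).continuousAt

theorem hasDerivAt_flow_apply (x : Space N) (t : ℝ) :
    HasDerivAt (fun r => flow B r x) (Matrix.toEuclideanCLM (𝕜 := ℝ) B (flow B t x)) t :=
  ((ContinuousLinearMap.apply ℝ (Space N) x).hasFDerivAt.comp_hasDerivAt t (hasDerivAt_flow' B t))

theorem inner_toEuclideanCLM (M : Matrix (Fin N) (Fin N) ℝ) (x y : Space N) :
    ⟪x, Matrix.toEuclideanCLM (𝕜 := ℝ) M y⟫ = x.ofLp ⬝ᵥ (M *ᵥ y.ofLp) := by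
  rw [EuclideanSpace.inner_eq_star_dotProduct, Matrix.ofLp_toEuclideanCLM, dotProduct_comm]
  simp

theorem inner_flow_transpose (t : ℝ) (x y : Space N) :
    ⟪flow Bᵀ t x, y⟫ = ⟪x, flow B t y⟫ := by
  rw [real_inner_comm, flow, flow, inner_toEuclideanCLM, inner_toEuclideanCLM,
    ← Matrix.transpose_smul, Matrix.exp_transpose, Matrix.mulVec_transpose, dotProduct_comm,
    ← Matrix.dotProduct_mulVec]

theorem det_toEuclideanCLM (M : Matrix (Fin N) (Fin N) ℝ) :
    LinearMap.det ((Matrix.toEuclideanCLM (𝕜 := ℝ) M : Space N →L[ℝ] Space N) :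
      Space N →ₗ[ℝ] Space N) = M.det := by
  have : ((Matrix.toEuclideanCLM (𝕜 := ℝ) M : Space N →L[ℝ] Space N) :
      Space N →ₗ[ℝ] Space N) = Matrix.toLin (EuclideanSpace.basisFun (Fin N) ℝ).toBasis
        (EuclideanSpace.basisFun (Fin N) ℝ).toBasis M := by
    ext x i
    simp [Matrix.toLin_apply, Matrix.mulVec, dotProduct, Pi.single_apply]
  rw [this, LinearMap.det_toLin]

theorem continuous_exp_entry (M : Matrix (Fin N) (Fin N) ℝ) :
    Continuous fun t : ℝ => NormedSpace.exp (t • M) := by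
  have h : ∀ t : ℝ, NormedSpace.exp (t • M) =
      (Matrix.toEuclideanCLM (n := Fin N) (𝕜 := ℝ)).symm (flow M t) := fun t => by
    rw [flow, StarAlgEquiv.symm_apply_apply]
  have hc : Continuous (Matrix.toEuclideanCLM (n := Fin N) (𝕜 := ℝ)).symm :=
    LinearMap.continuous_of_finiteDimensional
      ((Matrix.toEuclideanCLM (n := Fin N) (𝕜 := ℝ)).symm.toAlgEquiv.toLinearMap)
  simp_rw [h]
  exact hc.comp (continuous_flow M)

theorem hasDerivAt_exp_smul_zero (M : Matrix (Fin N) (Fin N) ℝ) (i j : Fin N) :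
    HasDerivAt (fun t : ℝ => NormedSpace.exp (t • M) i j) (M i j) 0 := by
  have h : ∀ t : ℝ, NormedSpace.exp (t • M) i j = flow M t (EuclideanSpace.single j 1) i :=
    fun t => by
      rw [ofLp_flow]
      simp [Matrix.mulVec, dotProduct]
  simp_rw [h]
  have h2 := (EuclideanSpace.proj (𝕜 := ℝ) i).hasFDerivAt.comp_hasDerivAt 0
    (hasDerivAt_flow_apply M (EuclideanSpace.single j 1) 0)
  refine h2.congr_deriv ?_
  rw [flow_zero]
  simp [Matrix.mulVec, dotProduct]

/-- The integrand of `t K(t)`. -/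
noncomputable def gramian (t : ℝ) : Matrix (Fin N) (Fin N) ℝ :=
  NormedSpace.exp (t • B) * Q * NormedSpace.exp (t • Bᵀ)

theorem continuous_gramian : Continuous (gramian Q B) :=
  ((continuous_exp_entry B).matrix_mul continuous_const).matrix_mul (continuous_exp_entry Bᵀ)

theorem continuous_gramian_entry (i j : Fin N) : Continuous fun t => gramian Q B t i j :=
  (continuous_gramian Q B).matrix_elem i j

theorem smul_covariance_apply {t : ℝ} (ht : t ≠ 0) (i j : Fin N) :
    (t • covariance Q B t) i j = ∫ r in (0 : ℝ)..t, gramian Q B r i j := by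
  simp only [Matrix.smul_apply, covariance, Matrix.of_apply, smul_eq_mul, ← mul_assoc]
  rw [mul_one_div_cancel ht, one_mul]
  rfl

/-- The quadratic form of `Q`. -/
noncomputable def form (x : Space N) : ℝ := ⟪x, Matrix.toEuclideanCLM (𝕜 := ℝ) Q x⟫

theorem form_nonneg (hQ : Q.PosSemidef) (x : Space N) : 0 ≤ form Q x := by
  rw [form, inner_toEuclideanCLM]
  simpa using hQ.dotProduct_mulVec_nonneg x.ofLp

theorem continuous_form : Continuous (form Q) := by
  unfold form
  fun_prop

theorem continuous_form_flow (x : Space N) : Continuous fun t => form Q (flow Bᵀ t x) :=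
  (continuous_form Q).comp ((continuous_flow Bᵀ).clm_apply continuous_const)

/-- The quadratic form of `t K(t)`. -/
noncomputable def energy (t : ℝ) (x : Space N) : ℝ := ∫ r in (0 : ℝ)..t, form Q (flow Bᵀ r x)

theorem dotProduct_gramian_mulVec (t : ℝ) (x : Space N) :
    x.ofLp ⬝ᵥ (gramian Q B t *ᵥ x.ofLp) = form Q (flow Bᵀ t x) := by
  rw [form, inner_flow_transpose, ← inner_toEuclideanCLM]
  congr 1
  apply (WithLp.ofLp_injective 2)
  rw [Matrix.ofLp_toEuclideanCLM, ofLp_flow, Matrix.ofLp_toEuclideanCLM, ofLp_flow, gramian]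
  simp [Matrix.mulVec_mulVec, Matrix.mul_assoc]

/-- Replaces the matrix tK(t) by the integral of a nonnegative function of time, from which
monotonicity in t and the behaviour under the flow can be read off. -/
theorem dotProduct_covariance_mulVec {t : ℝ} (ht : t ≠ 0) (x : Space N) :
    x.ofLp ⬝ᵥ ((t • covariance Q B t) *ᵥ x.ofLp) = energy Q B t x := by
  simp only [energy, ← dotProduct_gramian_mulVec, dotProduct, Matrix.mulVec,
    smul_covariance_apply Q B ht]
  rw [intervalIntegral.integral_finsetSum]
  · refine Finset.sum_congr rfl fun i _ => ?_
    rw [intervalIntegral.integral_const_mul, intervalIntegral.integral_finsetSum]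
    · simp_rw [intervalIntegral.integral_mul_const]
    · intro j _
      exact ((continuous_gramian_entry Q B i j).mul continuous_const).intervalIntegrable _ _
  · intro i _
    refine (continuous_const.mul (continuous_finsetSum _ fun j _ => ?_)).intervalIntegrable _ _
    exact (continuous_gramian_entry Q B i j).mul continuous_const

theorem hasDerivAt_energy (x : Space N) (t : ℝ) :
    HasDerivAt (fun r => energy Q B r x) (form Q (flow Bᵀ t x)) t :=
  intervalIntegral.integral_hasDerivAt_right
    ((continuous_form_flow Q B x).intervalIntegrable _ _)
    ((continuous_form_flow Q B x).stronglyMeasurableAtFilter _ _)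
    (continuous_form_flow Q B x).continuousAt

theorem energy_mono (hQ : Q.PosSemidef) (x : Space N) : Monotone fun t => energy Q B t x := by
  refine monotone_of_deriv_nonneg (fun t => (hasDerivAt_energy Q B x t).differentiableAt) fun t => ?_
  rw [(hasDerivAt_energy Q B x t).deriv]
  exact form_nonneg Q hQ _

theorem energy_nonneg (hQ : Q.PosSemidef) {t : ℝ} (ht : 0 ≤ t) (x : Space N) :
    0 ≤ energy Q B t x := by
  have := energy_mono Q B hQ x ht
  simpa [energy] using this

/-- A positive continuous function has a positive minimum on the unit sphere; homogeneity of degree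
two does the rest. The sphere is empty when N = 0. -/
theorem exists_energy_lower (hK : ∀ t : ℝ, 0 < t → (covariance Q B t).PosDef) {t : ℝ}
    (ht : 0 < t) : ∃ c : ℝ, 0 < c ∧ ∀ x : Space N, c * ‖x‖ ^ 2 ≤ energy Q B t x := by
  have hpos : ∀ x : Space N, x ≠ 0 → 0 < energy Q B t x := fun x hx => by
    rw [← dotProduct_covariance_mulVec Q B ht.ne', Matrix.smul_mulVec, dotProduct_smul, smul_eq_mul]
    refine mul_pos ht ?_
    have := (hK t ht).dotProduct_mulVec_pos (x := x.ofLp) (by simpa using hx)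
    simpa using this
  have hquad : ∀ (r : ℝ) (x : Space N), energy Q B t (r • x) = r ^ 2 * energy Q B t x := by
    intro r x
    rw [← dotProduct_covariance_mulVec Q B ht.ne', ← dotProduct_covariance_mulVec Q B ht.ne']
    simp only [WithLp.ofLp_smul, Matrix.mulVec_smul, dotProduct_smul, smul_dotProduct, smul_eq_mul]
    ring
  have hcont : Continuous (energy Q B t) := by
    have : energy Q B t = fun x : Space N =>
        ⟪x, Matrix.toEuclideanCLM (𝕜 := ℝ) (t • covariance Q B t) x⟫ := by
      funext x
      rw [inner_toEuclideanCLM, dotProduct_covariance_mulVec Q B ht.ne']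
    rw [this]
    fun_prop
  rcases (Metric.sphere (0 : Space N) 1).eq_empty_or_nonempty with he | hne
  · refine ⟨1, one_pos, fun x => ?_⟩
    have hx : x = 0 := by
      by_contra hx
      have : (‖x‖⁻¹ • x) ∈ Metric.sphere (0 : Space N) 1 := by
        simp [norm_smul, norm_ne_zero_iff.2 hx]
      rw [he] at this
      exact this
    have h0 : energy Q B t 0 = 0 := by simpa using hquad 0 0
    simp [hx, h0]
  · obtain ⟨x₀, hx₀, hmin⟩ := (isCompact_sphere (0 : Space N) 1).exists_isMinOn hne
      hcont.continuousOn
    have hx₀' : x₀ ≠ 0 := by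
      rintro rfl
      simp at hx₀
    refine ⟨energy Q B t x₀, hpos x₀ hx₀', fun x => ?_⟩
    rcases eq_or_ne x 0 with rfl | hx
    · have h0 := hquad 0 0
      simp only [smul_zero] at h0
      rw [h0]
      simp
    · have hn : 0 < ‖x‖ := norm_pos_iff.2 hx
      have h1 : energy Q B t x₀ ≤ energy Q B t (‖x‖⁻¹ • x) :=
        hmin (by simp [norm_smul, hn.ne'])
      rw [hquad] at h1
      calc _ ≤ (‖x‖⁻¹) ^ 2 * energy Q B t x * ‖x‖ ^ 2 := by gcongr
        _ = _ := by field_simp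

/-- For `t ≥ 1` the quadratic form of `t K(t)` controls `|e^{tBᵀ} x|²`. -/
theorem exists_energy_lower_flow (hQ : Q.PosSemidef)
    (hK : ∀ t : ℝ, 0 < t → (covariance Q B t).PosDef) :
    ∃ c : ℝ, 0 < c ∧ ∀ t : ℝ, 1 ≤ t → ∀ x : Space N,
      c * ‖flow Bᵀ t x‖ ^ 2 ≤ energy Q B t x := by
  obtain ⟨c, hc, hle⟩ := exists_energy_lower Q B hK one_pos
  set m := ‖flow Bᵀ 1‖ + 1 with hm
  have hm0 : 0 < m := by positivity
  refine ⟨c / m ^ 2, by positivity, fun t ht x => ?_⟩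
  set y := flow Bᵀ (t - 1) x with hy
  have h1 : ‖flow Bᵀ t x‖ ≤ m * ‖y‖ := by
    have : flow Bᵀ t x = flow Bᵀ 1 y := by
      rw [hy, ← flow_add_apply]
      congr 2
      ring
    rw [this]
    refine (ContinuousLinearMap.le_opNorm _ _).trans ?_
    gcongr
    linarith
  -- Only the last unit of time is used: by the group law, the energy gained on [t-1, t] is the
  -- time-one energy of y = e^{(t-1)Bᵀ}x, and |e^{tBᵀ}x| ≤ m|y|.
  have h2 : energy Q B 1 y = energy Q B t x - energy Q B (t - 1) x := by
    have e1 : ∀ r, form Q (flow Bᵀ r y) = form Q (flow Bᵀ (r + (t - 1)) x) := fun r => by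
      rw [hy, flow_add_apply]
    simp only [energy, e1]
    rw [intervalIntegral.integral_comp_add_right (fun r => form Q (flow Bᵀ r x)),
      intervalIntegral.integral_interval_sub_left
        ((continuous_form_flow Q B x).intervalIntegrable _ _)
        ((continuous_form_flow Q B x).intervalIntegrable _ _)]
    congr 1 <;> ring
  have h3 := energy_nonneg Q B hQ (show 0 ≤ t - 1 by linarith) x
  calc c / m ^ 2 * ‖flow Bᵀ t x‖ ^ 2 ≤ c / m ^ 2 * (m * ‖y‖) ^ 2 := by gcongr
    _ = c * ‖y‖ ^ 2 := by field_simp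
    _ ≤ energy Q B 1 y := hle y
    _ ≤ energy Q B t x := by linarith

/-- Boundedness of the integrand on [0,1]. This linear rate bounds the variance in the small-time
estimate for P_tφ - φ. -/
theorem exists_trace_bound : ∃ K : ℝ, 0 ≤ K ∧ ∀ t : ℝ, 0 < t → t ≤ 1 →
    (t • covariance Q B t).trace ≤ K * t := by
  have hc : Continuous fun t => (gramian Q B t).trace := (continuous_gramian Q B).matrix_trace
  obtain ⟨K, hK⟩ := (isCompact_Icc (a := (0 : ℝ)) (b := 1)).exists_bound_of_continuousOn
    hc.continuousOn
  refine ⟨K, (norm_nonneg _).trans (hK 0 (by simp)), fun t ht ht1 => ?_⟩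
  have h1 : (t • covariance Q B t).trace = ∫ r in (0 : ℝ)..t, (gramian Q B r).trace := by
    simp only [Matrix.trace, Matrix.diag, smul_covariance_apply Q B ht.ne']
    rw [intervalIntegral.integral_finsetSum]
    intro i _
    exact (continuous_gramian_entry Q B i i).intervalIntegrable _ _
  rw [h1]
  have h2 := intervalIntegral.norm_integral_le_of_norm_le_const (a := 0) (b := t)
    (f := fun r => (gramian Q B r).trace) (C := K) (fun r hr => by
      rw [uIoc_of_le ht.le] at hr
      exact hK r ⟨hr.1.le, hr.2.trans ht1⟩)
  rw [sub_zero, abs_of_pos ht] at h2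
  exact (Real.le_norm_self _).trans h2

theorem measurable_covariance_entry (i j : Fin N) : Measurable fun t => covariance Q B t i j := by
  simp only [covariance, Matrix.of_apply]
  refine (measurable_const.div measurable_id).mul ?_
  exact (intervalIntegral.continuous_primitive (fun a b =>
    (continuous_gramian_entry Q B i j).intervalIntegrable a b) 0).measurable

end Flow

/-! ### Determinants of e^{tB} and of tK(t) -/

section Determinants

variable {N : ℕ}

theorem differentiable_det {𝕂 : Type*} [RCLike 𝕂] :
    Differentiable 𝕂 fun M : Fin N → Fin N → 𝕂 => Matrix.det (Matrix.of M) := by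
  simp only [Matrix.det_apply, Matrix.of_apply]
  fun_prop

variable (Q B : Matrix (Fin N) (Fin N) ℝ)

/-- The curves e^{tB} and 1 + tB have the same value and velocity at 0, so their determinants have
the same derivative there; for 1 + tB it is read off from the expansion 1 + t tr B + O(t²). -/
theorem hasDerivAt_det_exp_zero :
    HasDerivAt (fun t : ℝ => (NormedSpace.exp (t • B)).det) B.trace 0 := by
  have hd := (differentiable_det (N := N) (𝕂 := ℝ) (1 : Matrix (Fin N) (Fin N) ℝ)).hasFDerivAt
  have e1 : HasDerivAt (fun t : ℝ => (fun i j => NormedSpace.exp (t • B) i j : Fin N → Fin N → ℝ))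
      (fun i j => B i j) 0 :=
    hasDerivAt_pi.2 fun i => hasDerivAt_pi.2 fun j => hasDerivAt_exp_smul_zero B i j
  have e2 : HasDerivAt (fun t : ℝ => (fun i j => (1 + t • B) i j : Fin N → Fin N → ℝ))
      (fun i j => B i j) 0 := by
    refine hasDerivAt_pi.2 fun i => hasDerivAt_pi.2 fun j => ?_
    have := ((hasDerivAt_id (0 : ℝ)).mul_const (B i j)).const_add ((1 : Matrix _ _ ℝ) i j)
    simpa using this
  have h1 := HasFDerivAt.comp_hasDerivAt_of_eq (0 : ℝ) hd e1 (by
    funext i j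
    simp)
  have h2 := HasFDerivAt.comp_hasDerivAt_of_eq (0 : ℝ) hd e2 (by
    funext i j
    simp)
  have h3 : HasDerivAt (fun t : ℝ => (1 + t • B).det) B.trace 0 := by
    rw [show (fun t : ℝ => (1 + t • B).det) = _ from funext fun t => Matrix.det_one_add_smul t B]
    have e3 : HasDerivAt (fun t : ℝ => 1 + B.trace * t) B.trace 0 := by
      simpa using ((hasDerivAt_id (0 : ℝ)).const_mul B.trace).const_add 1
    have e4 := (Polynomial.hasDerivAt
      (1 + (Polynomial.X : Polynomial ℝ) • B.map Polynomial.C).det.divX.divX 0).mul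
        (hasDerivAt_pow 2 (0 : ℝ))
    refine (e3.add e4).congr_deriv ?_
    simp
  have h4 := h2.unique h3
  rw [h4] at h1
  exact h1

theorem det_exp_add (t r : ℝ) : (NormedSpace.exp ((t + r) • B)).det =
    (NormedSpace.exp (t • B)).det * (NormedSpace.exp (r • B)).det := by
  rw [add_smul, Matrix.exp_add_of_commute _ _ ((Commute.refl B).smul_left t |>.smul_right r),
    Matrix.det_mul]

theorem det_exp_zero : (NormedSpace.exp ((0 : ℝ) • B)).det = 1 := by
  have h : (Matrix.toEuclideanCLM (n := Fin N) (𝕜 := ℝ)) (NormedSpace.exp ((0 : ℝ) • B)) = 1 :=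
    flow_zero B
  rw [show NormedSpace.exp ((0 : ℝ) • B) = 1 from
    (Matrix.toEuclideanCLM (n := Fin N) (𝕜 := ℝ)).injective (h.trans (map_one _).symm),
    Matrix.det_one]

/-- Nonzero because e^{-tB} is the inverse, nonnegative because it is the square of det e^{(t/2)B}.
-/
theorem det_exp_pos (t : ℝ) : 0 < (NormedSpace.exp (t • B)).det := by
  have h1 : (NormedSpace.exp (t • B)).det ≠ 0 := by
    intro h
    have := det_exp_add B t (-t)
    rw [add_neg_cancel, det_exp_zero, h, zero_mul] at this
    exact one_ne_zero this
  have h2 := det_exp_add B (t / 2) (t / 2)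
  rw [add_halves] at h2
  refine lt_of_le_of_ne ?_ h1.symm
  rw [h2]
  exact mul_self_nonneg _

/-- The group law moves the derivative at 0 to any time, so d/dt det e^{tB} = tr B · det e^{tB} ≥ 0.
-/
theorem one_le_det_exp (hB : 0 ≤ B.trace) {t : ℝ} (ht : 0 ≤ t) :
    1 ≤ (NormedSpace.exp (t • B)).det := by
  have hd : ∀ t : ℝ, HasDerivAt (fun r : ℝ => (NormedSpace.exp (r • B)).det)
      ((NormedSpace.exp (t • B)).det * B.trace) t := by
    intro t
    have h1 : HasDerivAt (fun r : ℝ => (NormedSpace.exp ((r - t) • B)).det) B.trace t := by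
      have h0 : HasDerivAt (fun r : ℝ => (NormedSpace.exp (r • B)).det) B.trace (t - t) := by
        rw [sub_self]
        exact hasDerivAt_det_exp_zero B
      exact h0.comp_sub_const t t
    refine (h1.const_mul (NormedSpace.exp (t • B)).det).congr_of_eventuallyEq
      (Eventually.of_forall fun r => ?_)
    simp only
    rw [← det_exp_add, add_sub_cancel]
  have hm : Monotone fun r : ℝ => (NormedSpace.exp (r • B)).det := by
    refine monotone_of_deriv_nonneg (fun t => (hd t).differentiableAt) fun t => ?_
    rw [(hd t).deriv]
    exact mul_nonneg (det_exp_pos B t).le hB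
  rw [← det_exp_zero B]
  exact hm ht

theorem toEuclideanCLM_exp_complex (M : Matrix (Fin N) (Fin N) ℂ) :
    Matrix.toEuclideanCLM (𝕜 := ℂ) (NormedSpace.exp M) =
      NormedSpace.exp (Matrix.toEuclideanCLM (𝕜 := ℂ) M) := by
  let _ : NormedRing (Matrix (Fin N) (Fin N) ℂ) := Matrix.linftyOpNormedRing
  let _ : NormedAlgebra ℂ (Matrix (Fin N) (Fin N) ℂ) := Matrix.linftyOpNormedAlgebra
  let _ : NormedAlgebra ℚ (Matrix (Fin N) (Fin N) ℂ) := NormedAlgebra.restrictScalars ℚ ℂ _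
  have hc : Continuous (Matrix.toEuclideanCLM (n := Fin N) (𝕜 := ℂ)) :=
    LinearMap.continuous_of_finiteDimensional
      ((Matrix.toEuclideanCLM (n := Fin N) (𝕜 := ℂ)).toAlgEquiv.toLinearMap)
  exact NormedSpace.map_exp (Matrix.toEuclideanCLM (n := Fin N) (𝕜 := ℂ)) hc M

theorem exp_map_ofReal (M : Matrix (Fin N) (Fin N) ℝ) :
    NormedSpace.exp (M.map Complex.ofReal) = (NormedSpace.exp M).map Complex.ofReal := by
  let _ : NormedRing (Matrix (Fin N) (Fin N) ℂ) := Matrix.linftyOpNormedRing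
  let _ : NormedAlgebra ℂ (Matrix (Fin N) (Fin N) ℂ) := Matrix.linftyOpNormedAlgebra
  let _ : NormedAlgebra ℚ (Matrix (Fin N) (Fin N) ℂ) := NormedAlgebra.restrictScalars ℚ ℂ _
  let _ : NormedRing (Matrix (Fin N) (Fin N) ℝ) := Matrix.linftyOpNormedRing
  let _ : NormedAlgebra ℝ (Matrix (Fin N) (Fin N) ℝ) := Matrix.linftyOpNormedAlgebra
  let _ : NormedAlgebra ℚ (Matrix (Fin N) (Fin N) ℝ) := NormedAlgebra.restrictScalars ℚ ℝ _
  have hc : Continuous fun M : Matrix (Fin N) (Fin N) ℝ => M.map Complex.ofReal :=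
    Continuous.matrix_map continuous_id Complex.continuous_ofReal
  exact (NormedSpace.map_exp (Complex.ofRealHom.mapMatrix (m := Fin N)) hc M).symm

theorem differentiable_exp_smul_entry (M : Matrix (Fin N) (Fin N) ℂ) (i j : Fin N) :
    Differentiable ℂ fun z : ℂ => NormedSpace.exp (z • M) i j := by
  have h : ∀ z : ℂ, NormedSpace.exp (z • M) i j =
      (NormedSpace.exp (z • (Matrix.toEuclideanCLM (𝕜 := ℂ) M :
        EuclideanSpace ℂ (Fin N) →L[ℂ] EuclideanSpace ℂ (Fin N)))) (EuclideanSpace.single j 1) i := by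
    intro z
    have e : z • (Matrix.toEuclideanCLM (𝕜 := ℂ) M :
        EuclideanSpace ℂ (Fin N) →L[ℂ] EuclideanSpace ℂ (Fin N)) =
        Matrix.toEuclideanCLM (𝕜 := ℂ) (z • M) := (map_smul _ _ _).symm
    rw [e, ← toEuclideanCLM_exp_complex, Matrix.ofLp_toEuclideanCLM]
    simp [Matrix.mulVec, dotProduct]
  simp_rw [h]
  intro z
  have h1 := (hasDerivAt_exp_smul_const (𝕂 := ℂ) (Matrix.toEuclideanCLM (𝕜 := ℂ) M :
    EuclideanSpace ℂ (Fin N) →L[ℂ] EuclideanSpace ℂ (Fin N)) z).differentiableAt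
  have h2 := h1.clm_apply (differentiableAt_const (EuclideanSpace.single j (1 : ℂ)))
  exact (EuclideanSpace.proj (𝕜 := ℂ) i).differentiableAt.comp z h2

/-- The entries of `t K(t)` extend to entire functions. -/
theorem exists_entire_covariance (i j : Fin N) : ∃ f : ℂ → ℂ, Differentiable ℂ f ∧
    ∀ t : ℝ, 0 < t → f t = ((t • covariance Q B t) i j : ℝ) := by
  let G : ℂ → ℂ := fun z => (NormedSpace.exp (z • B.map Complex.ofReal) * Q.map Complex.ofReal *
    NormedSpace.exp (z • Bᵀ.map Complex.ofReal)) i j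
  have hG : Differentiable ℂ G := by
    have h1 := fun k => differentiable_exp_smul_entry (B.map Complex.ofReal) i k
    have h2 := fun k => differentiable_exp_smul_entry (Bᵀ.map Complex.ofReal) k j
    have e : G = fun z => ∑ k, (∑ m, NormedSpace.exp (z • B.map Complex.ofReal) i m *
        (Q.map Complex.ofReal) m k) * NormedSpace.exp (z • Bᵀ.map Complex.ofReal) k j := by
      funext z
      simp only [G, Matrix.mul_apply]
    rw [e]
    exact Differentiable.fun_sum fun k _ =>
      (Differentiable.fun_sum fun m _ => (h1 m).mul_const _).mul (h2 k)
  have hGr : ∀ t : ℝ, G t = (gramian Q B t i j : ℝ) := fun t => by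
    have e : ∀ M : Matrix (Fin N) (Fin N) ℝ, (t : ℂ) • M.map Complex.ofReal =
        (t • M).map Complex.ofReal := fun M => by
      ext
      simp
    simp only [G, e, exp_map_ofReal, gramian]
    have h3 : Complex.ofRealHom.mapMatrix
        (NormedSpace.exp (t • B) * Q * NormedSpace.exp (t • Bᵀ)) = _ :=
      (map_mul _ _ _).trans (congrArg (· * _) (map_mul _ _ _))
    exact (congrFun (congrFun h3 i) j).symm
  -- The extension is the primitive of the entire integrand that vanishes at 0.
  obtain ⟨f, hf0, hf⟩ := hG.isExactOn_univ.with_val_at 0 0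
  refine ⟨f, fun z => (hf z (mem_univ z)).differentiableAt, fun t ht => ?_⟩
  have h1 : ∫ r in (0 : ℝ)..t, G r = f t - f (0 : ℝ) :=
    intervalIntegral.integral_eq_sub_of_hasDerivAt
      (fun r _ => (hf r (mem_univ _)).comp_ofReal)
      ((hG.continuous.comp Complex.continuous_ofReal).intervalIntegrable _ _)
  simp_rw [hGr] at h1
  rw [intervalIntegral.integral_ofReal, Complex.ofReal_zero, hf0, sub_zero] at h1
  rw [smul_covariance_apply Q B ht.ne', h1]

/-- `det (t K(t))` vanishes at most to finite order at `t = 0`. -/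
theorem exists_det_lower (hK : ∀ t : ℝ, 0 < t → (covariance Q B t).PosDef) :
    ∃ (n : ℕ) (c δ : ℝ), 0 < c ∧ 0 < δ ∧ ∀ t : ℝ, 0 < t → t ≤ δ →
      c * t ^ n ≤ (t • covariance Q B t).det := by
  choose f hf hfr using exists_entire_covariance Q B
  let D : ℂ → ℂ := fun z => (Matrix.of fun i j => f i j z).det
  have hD : Differentiable ℂ D :=
    (differentiable_det (𝕂 := ℂ)).comp (differentiable_pi.2 fun i => differentiable_pi.2 fun j =>
      hf i j)
  have hDr : ∀ t : ℝ, 0 < t → D t = ((t • covariance Q B t).det : ℝ) := fun t ht => by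
    have e : (Matrix.of fun i j => f i j t) = Complex.ofRealHom.mapMatrix (t • covariance Q B t) := by
      ext i j
      exact hfr i j t ht
    simp only [D, e]
    exact (RingHom.map_det Complex.ofRealHom _).symm
  have hpos : ∀ t : ℝ, 0 < t → 0 < (t • covariance Q B t).det := fun t ht => by
    rw [Matrix.det_smul]
    exact mul_pos (by positivity) (hK t ht).det_pos
  -- D is positive on the positive reals, so its zero at 0, if any, has finite order n: D(z) = zⁿ
  -- g(z) with g(0) ≠ 0, and |g| > |g(0)|/2 near 0.
  have hne : ¬ ∀ᶠ z in 𝓝 (0 : ℂ), D z = 0 := by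
    intro h
    have h1 : Tendsto (fun t : ℝ => (t : ℂ)) (𝓝[>] 0) (𝓝 0) := by
      have := Complex.continuous_ofReal.tendsto 0
      rw [Complex.ofReal_zero] at this
      exact this.mono_left nhdsWithin_le_nhds
    obtain ⟨t, ht1, ht2⟩ := ((h1.eventually h).and self_mem_nhdsWithin).exists
    rw [hDr t ht2, Complex.ofReal_eq_zero] at ht1
    exact (hpos t ht2).ne' ht1
  obtain ⟨n, g, hg, hg0, hev⟩ :=
    (hD.analyticAt 0).exists_eventuallyEq_pow_smul_nonzero_iff.2 hne
  have hg2 : ∀ᶠ z in 𝓝 (0 : ℂ), ‖g 0‖ / 2 < ‖g z‖ :=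
    hg.continuousAt.norm.eventually (lt_mem_nhds (half_lt_self (norm_pos_iff.2 hg0)))
  obtain ⟨ε, hε, hball⟩ := Metric.eventually_nhds_iff.1 (hev.and hg2)
  refine ⟨n, ‖g 0‖ / 2, ε / 2, half_pos (norm_pos_iff.2 hg0), half_pos hε, fun t ht htδ => ?_⟩
  obtain ⟨h1, h2⟩ := hball (y := (t : ℂ)) (by
    rw [dist_zero_right, Complex.norm_real, Real.norm_of_nonneg ht.le]
    linarith)
  rw [hDr t ht, sub_zero] at h1
  have h3 : (t • covariance Q B t).det = t ^ n * ‖g t‖ := by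
    have := congrArg norm h1
    rwa [Complex.norm_real, Real.norm_of_nonneg (hpos t ht).le, norm_smul, norm_pow,
      Complex.norm_real, Real.norm_of_nonneg ht.le] at this
  rw [h3, mul_comm]
  gcongr

end Determinants

/-! ### Gaussian representation of the semigroup -/

section Gaussian

open scoped RealInnerProductSpace

variable {N : ℕ}

theorem measurableEmbedding_add_linear (L : Space N →L[ℝ] Space N)
    (hL : LinearMap.det (L : Space N →ₗ[ℝ] Space N) ≠ 0) (m : Space N) :
    MeasurableEmbedding fun y => m + L y :=
  (measurableEmbedding_addLeft m).comp
    (L.toContinuousLinearEquivOfDetNeZero hL).toHomeomorph.measurableEmbedding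

theorem map_add_linear_volume (L : Space N →L[ℝ] Space N)
    (hL : LinearMap.det (L : Space N →ₗ[ℝ] Space N) ≠ 0) (m : Space N) :
    Measure.map (fun y => m + L y) volume =
      ENNReal.ofReal |(LinearMap.det (L : Space N →ₗ[ℝ] Space N))⁻¹| • (volume : Measure (Space N)) := by
  have h1 := Measure.map_linearMap_addHaar_eq_smul_addHaar (volume : Measure (Space N)) hL
  have h2 : Measure.map (fun y => m + L y) (volume : Measure (Space N)) =
      Measure.map (fun y => m + y) (Measure.map L volume) :=
    (Measure.map_map (measurable_const_add m) L.continuous.measurable).symm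
  rw [h2]
  change Measure.map (fun y => m + y) (Measure.map (L : Space N →ₗ[ℝ] Space N) volume) = _
  rw [h1, Measure.map_smul, map_add_left_eq_self]

/-- The density of the centred Gaussian with covariance `2 I`. -/
noncomputable def gaussDensity (y : Space N) : ℝ :=
  (4 * Real.pi) ^ (-(N : ℝ) / 2) * Real.exp (-‖y‖ ^ 2 / 4)

/-- The centred Gaussian measure with covariance `2 I`. -/
noncomputable def gauss (N : ℕ) : Measure (Space N) :=
  volume.withDensity fun y => ENNReal.ofReal (gaussDensity y)

theorem gaussDensity_nonneg (y : Space N) : 0 ≤ gaussDensity y := by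
  unfold gaussDensity
  positivity

theorem continuous_gaussDensity : Continuous (gaussDensity (N := N)) := by
  unfold gaussDensity
  fun_prop

theorem integral_exp_neg_quarter :
    ∫ y : Space N, Real.exp (-‖y‖ ^ 2 / 4) = (4 * Real.pi) ^ ((N : ℝ) / 2) := by
  have := GaussianFourier.integral_rexp_neg_mul_sq_norm (V := Space N) (b := 1 / 4) (by norm_num)
  rw [finrank_euclideanSpace_fin] at this
  rw [show 4 * Real.pi = Real.pi / (1 / 4) by ring, ← this]
  congr 1
  ext y
  congr 1
  ring

theorem integrable_exp_neg_quarter :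
    Integrable fun y : Space N => Real.exp (-‖y‖ ^ 2 / 4) := by
  -- A non-integrable function has integral 0 by convention, whereas the computed value is positive.
  by_contra h
  have := integral_exp_neg_quarter (N := N)
  rw [integral_undef h] at this
  have h2 : 0 < (4 * Real.pi) ^ ((N : ℝ) / 2) := by positivity
  linarith

theorem integral_gaussDensity : ∫ y : Space N, gaussDensity y = 1 := by
  unfold gaussDensity
  rw [integral_const_mul, integral_exp_neg_quarter, ← Real.rpow_add (by positivity)]
  rw [show -(N : ℝ) / 2 + N / 2 = 0 by ring, Real.rpow_zero]

theorem integrable_gaussDensity : Integrable (gaussDensity (N := N)) :=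
  integrable_exp_neg_quarter.const_mul _

instance : IsProbabilityMeasure (gauss N) := by
  refine ⟨?_⟩
  rw [gauss, withDensity_apply _ MeasurableSet.univ, Measure.restrict_univ,
    ← ofReal_integral_eq_lintegral_ofReal integrable_gaussDensity
    (Eventually.of_forall gaussDensity_nonneg), integral_gaussDensity, ENNReal.ofReal_one]

section

variable {F : Type*} [NormedAddCommGroup F] [NormedSpace ℝ F]

theorem integral_gauss (f : Space N → F) :
    ∫ y, f y ∂gauss N = ∫ y, gaussDensity y • f y := by
  rw [gauss, integral_withDensity_eq_integral_toReal_smul (by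
    exact continuous_gaussDensity.measurable.ennreal_ofReal) (by simp)]
  simp only [ENNReal.toReal_ofReal (gaussDensity_nonneg _)]

theorem integrable_gauss_iff (f : Space N → F) :
    Integrable f (gauss N) ↔ Integrable fun y => gaussDensity y • f y := by
  rw [gauss, integrable_withDensity_iff_integrable_smul' (by
    exact continuous_gaussDensity.measurable.ennreal_ofReal) (by simp)]
  simp only [ENNReal.toReal_ofReal (gaussDensity_nonneg _)]

theorem integral_comp_neg_gauss (f : Space N → F) :
    ∫ y, f (-y) ∂gauss N = ∫ y, f y ∂gauss N := by
  rw [integral_gauss, integral_gauss, ← integral_neg_eq_self]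
  simp [gaussDensity]

end

theorem integrable_norm_sq_gauss : Integrable (fun y : Space N => ‖y‖ ^ 2) (gauss N) := by
  rw [integrable_gauss_iff]
  have h := (GaussianFourier.integral_rexp_neg_mul_sq_norm (V := Space N) (b := 1 / 8) (by norm_num))
  have hi : Integrable fun y : Space N => Real.exp (-(1 / 8) * ‖y‖ ^ 2) := by
    by_contra hn
    rw [integral_undef hn] at h
    have h2 : 0 < (Real.pi / (1 / 8)) ^ ((Module.finrank ℝ (Space N) : ℝ) / 2) := by positivity
    linarith
  refine (hi.const_mul ((4 * Real.pi) ^ (-(N : ℝ) / 2) * 8)).mono'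
    (by
      have := continuous_gaussDensity (N := N)
      fun_prop) (Eventually.of_forall fun y => ?_)
  rw [smul_eq_mul, norm_mul, Real.norm_of_nonneg (gaussDensity_nonneg y),
    Real.norm_of_nonneg (by positivity), gaussDensity, mul_assoc, mul_assoc]
  refine mul_le_mul_of_nonneg_left ?_ (by positivity)
  -- Half of the Gaussian exponent 1/4 is spent on the polynomial factor, the other half keeps the
  -- integral finite.
  have h1 : ‖y‖ ^ 2 ≤ 8 * Real.exp (‖y‖ ^ 2 / 8) := by
    have := Real.add_one_le_exp (‖y‖ ^ 2 / 8)
    linarith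
  calc Real.exp (-‖y‖ ^ 2 / 4) * ‖y‖ ^ 2
      ≤ Real.exp (-‖y‖ ^ 2 / 4) * (8 * Real.exp (‖y‖ ^ 2 / 8)) := by gcongr
    _ = 8 * (Real.exp (-‖y‖ ^ 2 / 4) * Real.exp (‖y‖ ^ 2 / 8)) := by ring
    _ = 8 * Real.exp (-(1 / 8) * ‖y‖ ^ 2) := by
      rw [← Real.exp_add]
      congr 2
      ring

variable {Q B : Matrix (Fin N) (Fin N) ℝ}

theorem det_smul_covariance_pos (hK : ∀ t : ℝ, 0 < t → (covariance Q B t).PosDef) {t : ℝ}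
    (ht : 0 < t) : 0 < (t • covariance Q B t).det := by
  rw [Matrix.det_smul]
  exact mul_pos (by positivity) (hK t ht).det_pos

/-- A square root of the matrix `t K(t)`. -/
theorem exists_root (hK : ∀ t : ℝ, 0 < t → (covariance Q B t).PosDef) {t : ℝ} (ht : 0 < t) :
    ∃ R : Matrix (Fin N) (Fin N) ℝ, R * Rᵀ = t • covariance Q B t := by
  have h := (hK t ht).posSemidef.smul ht.le
  -- A nonnegative element of the C⋆-algebra of matrices has the form `star A * A`; the root is R =
  -- Aᵀ.
  open scoped MatrixOrder Matrix.Norms.L2Operator in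
  obtain ⟨A, hA⟩ := CStarAlgebra.nonneg_iff_eq_star_mul_self.mp h.nonneg
  exact ⟨Aᵀ, by simpa [Matrix.star_eq_conjTranspose] using hA.symm⟩

theorem abs_det_root {C R : Matrix (Fin N) (Fin N) ℝ} (h : R * Rᵀ = C) :
    C.det ^ (-(1 / 2) : ℝ) = |R.det|⁻¹ := by
  have : C.det = R.det ^ 2 := by
    rw [← h, Matrix.det_mul, Matrix.det_transpose, sq]
  rw [this, Real.rpow_neg (sq_nonneg _), ← Real.sqrt_eq_rpow, Real.sqrt_sq_eq_abs]

/-- In the coordinates Y = e^{tB}X + Ry the quadratic form t⁻¹⟨K(t)⁻¹·,·⟩ becomes |y|², and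
det(tK(t))^{-1/2} is the reciprocal Jacobian of y ↦ Ry. -/
theorem transitionKernel_add_root {t : ℝ} (ht : 0 < t)
    {R : Matrix (Fin N) (Fin N) ℝ} (h : R * Rᵀ = t • covariance Q B t) (hR : R.det ≠ 0)
    (X y : Space N) :
    transitionKernel Q B X (flow B t X + Matrix.toEuclideanCLM (𝕜 := ℝ) R y) t =
      |R.det|⁻¹ * gaussDensity y := by
  have hu : IsUnit R.det := isUnit_iff_ne_zero.2 hR
  have huT : IsUnit Rᵀ.det := by rwa [Matrix.det_transpose]
  have hinv : (covariance Q B t)⁻¹ = t • (Rᵀ⁻¹ * R⁻¹) := by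
    refine Matrix.inv_eq_left_inv ?_
    rw [Matrix.smul_mul, ← Matrix.mul_smul, ← h, Matrix.mul_assoc, ← Matrix.mul_assoc R⁻¹,
      Matrix.nonsing_inv_mul _ hu, Matrix.one_mul, Matrix.nonsing_inv_mul _ huT]
  have hv : (flow B t X + Matrix.toEuclideanCLM (𝕜 := ℝ) R y).ofLp -
      NormedSpace.exp (t • B) *ᵥ X.ofLp = R *ᵥ y.ofLp := by
    rw [WithLp.ofLp_add, ofLp_flow, Matrix.ofLp_toEuclideanCLM, add_sub_cancel_left]
  have hq : ((covariance Q B t)⁻¹ *ᵥ (R *ᵥ y.ofLp)) ⬝ᵥ (R *ᵥ y.ofLp) = t * ‖y‖ ^ 2 := by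
    have e1 : (covariance Q B t)⁻¹ *ᵥ (R *ᵥ y.ofLp) = t • (Rᵀ⁻¹ *ᵥ y.ofLp) := by
      rw [hinv, Matrix.smul_mulVec, Matrix.mulVec_mulVec, Matrix.mul_assoc,
        Matrix.nonsing_inv_mul _ hu, Matrix.mul_one]
    rw [e1, smul_dotProduct, smul_eq_mul, Matrix.dotProduct_mulVec, ← Matrix.mulVec_transpose,
      Matrix.mulVec_mulVec, Matrix.mul_nonsing_inv _ huT, Matrix.one_mulVec,
      EuclideanSpace.real_norm_sq_eq]
    simp [dotProduct, sq]
  rw [transitionKernel, hv, hq, abs_det_root h, gaussDensity]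
  have : -(t * ‖y‖ ^ 2) / (4 * t) = -‖y‖ ^ 2 / 4 := by
    field_simp
  rw [this]
  ring

variable {F : Type*} [NormedAddCommGroup F] [NormedSpace ℝ F]

/-- The transition kernel is the density of the Gaussian law of `e^{tB} X + R y`, `R Rᵀ = t K(t)`. -/
theorem exists_gauss_representation (hK : ∀ t : ℝ, 0 < t → (covariance Q B t).PosDef) {t : ℝ}
    (ht : 0 < t) : ∃ R : Space N →L[ℝ] Space N,
      (∀ x, ⟪x, Matrix.toEuclideanCLM (𝕜 := ℝ) (t • covariance Q B t) x⟫ = ‖R.adjoint x‖ ^ 2) ∧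
      (∀ y, ‖R y‖ ^ 2 ≤ (t • covariance Q B t).trace * ‖y‖ ^ 2) ∧
      (∀ (X : Space N) (f : Space N → F), Integrable (fun Y => transitionKernel Q B X Y t • f Y) ↔
        Integrable (fun y => f (flow B t X + R y)) (gauss N)) ∧
      (∀ (X : Space N) (f : Space N → F),
        semigroup Q B t f X = ∫ y, f (flow B t X + R y) ∂gauss N) := by
  obtain ⟨R, hR⟩ := exists_root hK ht
  have hdet : R.det ≠ 0 := by
    intro h0
    have := det_smul_covariance_pos hK ht
    rw [← hR, Matrix.det_mul, h0, zero_mul] at this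
    exact lt_irrefl _ this
  set L : Space N →L[ℝ] Space N := Matrix.toEuclideanCLM (𝕜 := ℝ) R with hL
  have hLdet : LinearMap.det (L : Space N →ₗ[ℝ] Space N) = R.det := det_toEuclideanCLM R
  have hadj : L.adjoint = Matrix.toEuclideanCLM (𝕜 := ℝ) Rᵀ := by
    rw [← ContinuousLinearMap.star_eq_adjoint, hL, ← map_star]
    simp [Matrix.star_eq_conjTranspose]
  have hmap := fun X : Space N => map_add_linear_volume L (by rwa [hLdet]) (flow B t X)
  have hemb := fun X : Space N => measurableEmbedding_add_linear L (by rwa [hLdet]) (flow B t X)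
  refine ⟨L, fun x => ?_, fun y => ?_, fun X f => ?_, fun X f => ?_⟩
  · rw [← hR, map_mul, hadj, ← real_inner_self_eq_norm_sq, ← hadj,
      ContinuousLinearMap.adjoint_inner_left, hadj]
    rfl
  -- The trace of R Rᵀ is the squared Hilbert–Schmidt norm of R, which dominates the operator norm
  -- by Cauchy–Schwarz on each row.
  · have htr : (t • covariance Q B t).trace = ∑ i, ∑ j, R i j ^ 2 := by
      rw [← hR]
      simp [Matrix.trace, Matrix.mul_apply, sq]
    rw [htr, EuclideanSpace.real_norm_sq_eq, EuclideanSpace.real_norm_sq_eq, Finset.sum_mul]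
    refine Finset.sum_le_sum fun i _ => ?_
    rw [hL, Matrix.ofLp_toEuclideanCLM]
    exact Finset.sum_mul_sq_le_sq_mul_sq Finset.univ (fun j => R i j) (fun j => y j)
  · rw [integrable_gauss_iff]
    have h1 : Integrable (fun Y => transitionKernel Q B X Y t • f Y)
        (Measure.map (fun y => flow B t X + L y) volume) ↔ Integrable (fun Y => transitionKernel Q B X Y t • f Y) := by
      rw [hmap X, integrable_smul_measure (by simpa [hLdet] using hdet) (by simp)]
    rw [← h1, (hemb X).integrable_map_iff]
    have h2 : ((fun Y => transitionKernel Q B X Y t • f Y) ∘ fun y => flow B t X + L y) =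
        fun y => |R.det|⁻¹ • (gaussDensity y • f (flow B t X + L y)) := by
      funext y
      simp only [Function.comp_apply, hL]
      rw [transitionKernel_add_root ht hR hdet, mul_smul]
    rw [h2]
    exact integrable_smul_iff (by simpa using hdet) _
  · rw [integral_gauss, semigroup]
    have h1 : ∫ Y, transitionKernel Q B X Y t • f Y
        ∂(Measure.map (fun y => flow B t X + L y) volume) =
        |R.det|⁻¹ • ∫ Y, transitionKernel Q B X Y t • f Y := by
      rw [hmap X, integral_smul_measure, hLdet, ENNReal.toReal_ofReal (abs_nonneg _), abs_inv]
    rw [(hemb X).integral_map] at h1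
    have h2 : ∀ y, transitionKernel Q B X (flow B t X + L y) t • f (flow B t X + L y) =
        |R.det|⁻¹ • (gaussDensity y • f (flow B t X + L y)) := fun y => by
      simp only [hL]
      rw [transitionKernel_add_root ht hR hdet, mul_smul]
    simp_rw [h2] at h1
    rw [integral_smul] at h1
    exact (smul_right_injective F (by simpa using hdet : |R.det|⁻¹ ≠ 0) h1).symm

end Gaussian

/-! ### Bounds, measurability and mass of the kernels; the formula U = ∫ w P_tφ dt -/

section KernelBounds

open scoped RealInnerProductSpace

variable {N : ℕ} {Q B : Matrix (Fin N) (Fin N) ℝ}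

/-- Since the energy is |Rᵀx|², this is a linear change of variables in a Gaussian integral. It
expresses the determinant through the energy, whose monotonicity in t is known. -/
theorem integral_exp_neg_energy (hK : ∀ t : ℝ, 0 < t → (covariance Q B t).PosDef) {t : ℝ}
    (ht : 0 < t) : Integrable (fun x => Real.exp (-energy Q B t x / 4)) ∧
      ∫ x, Real.exp (-energy Q B t x / 4) =
      (t • covariance Q B t).det ^ (-(1 / 2) : ℝ) * (4 * Real.pi) ^ ((N : ℝ) / 2) := by
  obtain ⟨R, hR⟩ := exists_root hK ht
  have hdet : R.det ≠ 0 := by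
    intro h0
    have := det_smul_covariance_pos hK ht
    rw [← hR, Matrix.det_mul, h0, zero_mul] at this
    exact lt_irrefl _ this
  set L : Space N →L[ℝ] Space N := Matrix.toEuclideanCLM (𝕜 := ℝ) Rᵀ with hL
  have hLdet : LinearMap.det (L : Space N →ₗ[ℝ] Space N) = R.det := by
    rw [hL, det_toEuclideanCLM, Matrix.det_transpose]
  have hmap := map_add_linear_volume L (by rwa [hLdet]) 0
  have hemb := measurableEmbedding_add_linear L (by rwa [hLdet]) 0
  have he : ∀ x, energy Q B t x = ‖(0 : Space N) + L x‖ ^ 2 := fun x => by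
    rw [← dotProduct_covariance_mulVec Q B ht.ne', ← hR, zero_add, EuclideanSpace.real_norm_sq_eq,
      hL, Matrix.ofLp_toEuclideanCLM, ← Matrix.mulVec_mulVec, Matrix.dotProduct_mulVec,
      ← Matrix.mulVec_transpose]
    simp [dotProduct, sq]
  simp only [he]
  have hi := integrable_exp_neg_quarter (N := N)
  have hv := integral_exp_neg_quarter (N := N)
  constructor
  · have h1 : Integrable (fun y : Space N => Real.exp (-‖y‖ ^ 2 / 4))
        (Measure.map (fun y => 0 + L y) volume) := by
      rw [hmap]
      exact hi.smul_measure (by simp)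
    exact (hemb.integrable_map_iff).1 h1
  · have h1 : ∫ y : Space N, Real.exp (-‖y‖ ^ 2 / 4) ∂(Measure.map (fun y => 0 + L y) volume)
        = |R.det|⁻¹ • (4 * Real.pi) ^ ((N : ℝ) / 2) := by
      rw [hmap, integral_smul_measure, hLdet, ENNReal.toReal_ofReal (abs_nonneg _), abs_inv, hv]
    rw [hemb.integral_map] at h1
    rw [h1, abs_det_root hR, smul_eq_mul]

theorem det_rpow_antitone (hQ : Q.PosSemidef)
    (hK : ∀ t : ℝ, 0 < t → (covariance Q B t).PosDef) {t r : ℝ} (ht : 0 < t) (htr : t ≤ r) :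
    (r • covariance Q B r).det ^ (-(1 / 2) : ℝ) ≤ (t • covariance Q B t).det ^ (-(1 / 2) : ℝ) := by
  obtain ⟨h1, h2⟩ := integral_exp_neg_energy hK ht
  obtain ⟨h3, h4⟩ := integral_exp_neg_energy hK (ht.trans_le htr)
  have h5 : ∫ x, Real.exp (-energy Q B r x / 4) ≤ ∫ x, Real.exp (-energy Q B t x / 4) := by
    refine integral_mono h3 h1 fun x => ?_
    have := energy_mono Q B hQ x htr
    simp only at this ⊢
    gcongr
  rw [h2, h4] at h5
  exact le_of_mul_le_mul_right h5 (by positivity)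

/-- Up to δ the finite order of vanishing at 0 gives a power of t; beyond δ the left-hand side is
nonincreasing. -/
theorem exists_det_rpow_bound (hQ : Q.PosSemidef)
    (hK : ∀ t : ℝ, 0 < t → (covariance Q B t).PosDef) : ∃ (r K : ℝ), 0 ≤ r ∧ 0 ≤ K ∧
      ∀ t : ℝ, 0 < t → (t • covariance Q B t).det ^ (-(1 / 2) : ℝ) ≤ K * (1 + t ^ (-r)) := by
  obtain ⟨n, c, δ, hc, hδ, hle⟩ := exists_det_lower Q B hK
  set K₁ := (δ • covariance Q B δ).det ^ (-(1 / 2) : ℝ)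
  have hK₁ : 0 ≤ K₁ := Real.rpow_nonneg (det_smul_covariance_pos hK hδ).le _
  set K₂ := c ^ (-(1 / 2) : ℝ)
  have hK₂ : 0 ≤ K₂ := Real.rpow_nonneg hc.le _
  refine ⟨n / 2, K₁ + K₂, by positivity, by positivity, fun t ht => ?_⟩
  have ht2 : 0 ≤ t ^ (-(n / 2 : ℝ)) := Real.rpow_nonneg ht.le _
  rcases le_total t δ with h | h
  · calc (t • covariance Q B t).det ^ (-(1 / 2) : ℝ) ≤ (c * t ^ n) ^ (-(1 / 2) : ℝ) :=
        Real.rpow_le_rpow_of_nonpos (by positivity) (hle t ht h) (by norm_num)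
      _ = K₂ * t ^ (-(n / 2 : ℝ)) := by
        rw [Real.mul_rpow hc.le (by positivity), ← Real.rpow_natCast, ← Real.rpow_mul ht.le]
        congr 2
        ring
      _ ≤ _ := by nlinarith [mul_nonneg hK₁ ht2]
  · calc _ ≤ K₁ := det_rpow_antitone hQ hK hδ h
      _ ≤ _ := by nlinarith [mul_nonneg hK₁ ht2, mul_nonneg hK₂ ht2]

theorem transitionKernel_nonneg (hK : ∀ t : ℝ, 0 < t → (covariance Q B t).PosDef)
    (X Y : Space N) {t : ℝ} (ht : 0 < t) : 0 ≤ transitionKernel Q B X Y t := by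
  have := det_smul_covariance_pos hK ht
  unfold transitionKernel
  positivity

theorem transitionKernel_le (hK : ∀ t : ℝ, 0 < t → (covariance Q B t).PosDef)
    (X Y : Space N) {t : ℝ} (ht : 0 < t) : transitionKernel Q B X Y t ≤
      (4 * Real.pi) ^ (-(N : ℝ) / 2) * (t • covariance Q B t).det ^ (-(1 / 2) : ℝ) := by
  have hd := det_smul_covariance_pos hK ht
  unfold transitionKernel
  refine mul_le_of_le_one_right (by positivity) ?_
  rw [Real.exp_le_one_iff]
  refine div_nonpos_of_nonpos_of_nonneg ?_ (by positivity)
  rw [neg_nonpos, dotProduct_comm]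
  simpa using (hK t ht).inv.posSemidef.dotProduct_mulVec_nonneg
    (Y.ofLp - NormedSpace.exp (t • B) *ᵥ X.ofLp)

/-- Joint measurability is checked on matrix entries; the inverse is the adjugate divided by the
determinant, hence measurable without any invertibility assumption. -/
theorem measurable_transitionKernel :
    Measurable fun q : ℝ × Space N × Space N => transitionKernel Q B q.2.1 q.2.2 q.1 := by
  have hcov : Measurable fun t => (fun i j => covariance Q B t i j : Fin N → Fin N → ℝ) :=
    measurable_pi_iff.2 fun i => measurable_pi_iff.2 fun j => measurable_covariance_entry Q B i j
  have hdetc : Continuous fun M : Fin N → Fin N → ℝ => (Matrix.of M).det :=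
    Continuous.matrix_det (A := fun M : Fin N → Fin N → ℝ => (Matrix.of M)) continuous_id
  have hdet : Measurable fun t => (covariance Q B t).det := hdetc.measurable.comp hcov
  have hadj : ∀ i j, Measurable fun t => (covariance Q B t).adjugate i j := fun i j => by
    have hc : Continuous fun M : Fin N → Fin N → ℝ => (Matrix.of M).adjugate i j :=
      (Continuous.matrix_adjugate (A := fun M : Fin N → Fin N → ℝ => (Matrix.of M))
        continuous_id).matrix_elem i j
    exact hc.measurable.comp hcov
  have hinv : ∀ i j, Measurable fun t => (covariance Q B t)⁻¹ i j := fun i j => by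
    simp only [Matrix.inv_def, Ring.inverse_eq_inv', Matrix.smul_apply, smul_eq_mul]
    exact hdet.inv.mul (hadj i j)
  have hexp : ∀ i j, Measurable fun t : ℝ => NormedSpace.exp (t • B) i j := fun i j =>
    ((continuous_exp_entry B).matrix_elem i j).measurable
  have hv : ∀ i, Measurable fun q : ℝ × Space N × Space N =>
      (q.2.2.ofLp - NormedSpace.exp (q.1 • B) *ᵥ q.2.1.ofLp) i := fun i => by
    simp only [Pi.sub_apply, Matrix.mulVec, dotProduct]
    refine Measurable.sub (by fun_prop) (Finset.measurable_sum _ fun j _ => ?_)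
    exact ((hexp i j).comp measurable_fst).mul (by fun_prop)
  have hq : Measurable fun q : ℝ × Space N × Space N =>
      (((covariance Q B q.1)⁻¹ *ᵥ (q.2.2.ofLp - NormedSpace.exp (q.1 • B) *ᵥ q.2.1.ofLp)) ⬝ᵥ
      (q.2.2.ofLp - NormedSpace.exp (q.1 • B) *ᵥ q.2.1.ofLp)) := by
    simp only [dotProduct, Matrix.mulVec]
    refine Finset.measurable_sum _ fun i _ => Measurable.mul
      (Finset.measurable_sum _ fun j _ => ?_) (hv i)
    exact ((hinv i j).comp measurable_fst).mul (hv j)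
  unfold transitionKernel
  simp only [Matrix.det_smul]
  have h1 : Measurable fun q : ℝ × Space N × Space N => (covariance Q B q.1).det :=
    hdet.comp measurable_fst
  fun_prop

section

variable {F : Type*} [NormedAddCommGroup F] [NormedSpace ℝ F]

theorem stronglyMeasurable_semigroup {f : Space N → F} (hf : StronglyMeasurable f) :
    StronglyMeasurable fun q : ℝ × Space N => semigroup Q B q.1 f q.2 := by
  unfold semigroup
  refine StronglyMeasurable.integral_prod_right (f := fun (q : ℝ × Space N) Y =>
    transitionKernel Q B q.2 Y q.1 • f Y) ?_
  have hm : Measurable fun q : (ℝ × Space N) × Space N =>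
      transitionKernel Q B q.1.2 q.2 q.1.1 :=
    measurable_transitionKernel.comp (g := fun q : ℝ × Space N × Space N =>
      transitionKernel Q B q.2.1 q.2.2 q.1) (f := fun q : (ℝ × Space N) × Space N => (q.1.1, q.1.2, q.2))
      (by fun_prop)
  exact hm.stronglyMeasurable.smul (hf.comp_measurable measurable_snd)

end

/-- The Gaussian representation applied to the constant function 1. -/
theorem integrable_transitionKernel (hK : ∀ t : ℝ, 0 < t → (covariance Q B t).PosDef)
    (X : Space N) {t : ℝ} (ht : 0 < t) :
    Integrable (fun Y => transitionKernel Q B X Y t) ∧ ∫ Y, transitionKernel Q B X Y t = 1 := by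
  obtain ⟨R, -, -, h1, h2⟩ := exists_gauss_representation (F := ℝ) hK ht
  have h3 := (h1 X fun _ => 1).2 (integrable_const _)
  have h4 := h2 X fun _ => 1
  simp only [semigroup, smul_eq_mul, mul_one] at h3 h4
  exact ⟨h3, by simpa using h4⟩

theorem poissonKernelTime_eq {s a : ℝ} (ha : a = 1 - 2 * s) (X Y : Space N) (z t : ℝ) :
    poissonKernelTime Q B a X Y z t = weight s z t * transitionKernel Q B X Y t := by
  rw [poissonKernelTime, weight, ha, show 1 - (1 - 2 * s) = 2 * s by ring,
    show 2 * s / 2 = s by ring, show (3 - (1 - 2 * s)) / 2 = 1 + s by ring]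

/-- At t = 0 the kernel p may blow up like a power of t, which the factor e^{-z²/(4t)} of the weight
absorbs; for large t it is bounded. -/
theorem integrableOn_weight_mul_transitionKernel (hQ : Q.PosSemidef)
    (hK : ∀ t : ℝ, 0 < t → (covariance Q B t).PosDef) {s z : ℝ} (hs : 0 < s) (hz : 0 < z)
    (X Y : Space N) : IntegrableOn (fun t => weight s z t * transitionKernel Q B X Y t) (Ioi 0) := by
  obtain ⟨r, K, hr, hK0, hle⟩ := exists_det_rpow_bound hQ hK
  set c := (4 * Real.pi) ^ (-(N : ℝ) / 2)
  have h1 : IntegrableOn (fun t => c * K * (weight s z t + 1 / (2 ^ (2 * s) * Real.Gamma s) *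
      z ^ (2 * s) * (t ^ (-(1 + s + r)) * Real.exp (-(z ^ 2 / 4) / t)))) (Ioi 0) :=
    ((integrableOn_weight hs hz).add ((integrableOn_rpow_neg_mul_exp_neg_div
      (by linarith) (by positivity)).const_mul _)).const_mul _
  have hm : Measurable fun t => transitionKernel Q B X Y t :=
    measurable_transitionKernel.comp (f := fun t : ℝ => (t, X, Y)) (by fun_prop)
  refine h1.mono' ((measurable_weight s z).mul hm).aestronglyMeasurable
    ((ae_restrict_iff' measurableSet_Ioi).2 (Eventually.of_forall fun t ht => ?_))
  have ht0 : 0 < t := ht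
  have hw := weight_nonneg hs hz ht0
  rw [Real.norm_of_nonneg (mul_nonneg hw (transitionKernel_nonneg hK X Y ht0))]
  calc weight s z t * transitionKernel Q B X Y t ≤ weight s z t * (c * (K * (1 + t ^ (-r)))) := by
        gcongr
        refine (transitionKernel_le hK X Y ht0).trans ?_
        gcongr
        exact hle t ht0
    _ = c * K * (weight s z t + weight s z t * t ^ (-r)) := by ring
    _ = _ := by
        congr 2
        rw [weight_eq ht0, show -(1 + s + r) = -(1 + s) + -r by ring, Real.rpow_add ht0]
        ring

section

variable {F : Type*} [NormedAddCommGroup F] [NormedSpace ℝ F]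

theorem integrable_transitionKernel_smul (hK : ∀ t : ℝ, 0 < t → (covariance Q B t).PosDef)
    (X : Space N) {t : ℝ} (ht : 0 < t) {f : Space N → F} (hf : StronglyMeasurable f) {K : ℝ}
    (hb : ∀ Y, ‖f Y‖ ≤ K) : Integrable (fun Y => transitionKernel Q B X Y t • f Y) :=
  (integrable_transitionKernel hK X ht).1.smul_bdd K hf.aestronglyMeasurable
    (Eventually.of_forall hb)

theorem norm_semigroup_le (hK : ∀ t : ℝ, 0 < t → (covariance Q B t).PosDef)
    (X : Space N) {t : ℝ} (ht : 0 < t) {f : Space N → F} {K : ℝ}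
    (hb : ∀ Y, ‖f Y‖ ≤ K) : ‖semigroup Q B t f X‖ ≤ K := by
  obtain ⟨h1, h2⟩ := integrable_transitionKernel hK X ht
  calc ‖semigroup Q B t f X‖ ≤ ∫ Y, transitionKernel Q B X Y t * K := by
        refine norm_integral_le_of_norm_le (h1.mul_const K) (Eventually.of_forall fun Y => ?_)
        rw [norm_smul, Real.norm_of_nonneg (transitionKernel_nonneg hK X Y ht)]
        exact mul_le_mul_of_nonneg_left (hb Y) (transitionKernel_nonneg hK X Y ht)
    _ = K := by rw [integral_mul_const, h2, one_mul]

/-- `U(X,z) = ∫₀^∞ w(z,t) P_t f(X) dt`. -/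
theorem extension_eq [CompleteSpace F]
    (hK : ∀ t : ℝ, 0 < t → (covariance Q B t).PosDef) {s a z : ℝ} (hs : 0 < s)
    (ha : a = 1 - 2 * s) (hz : 0 < z) {f : Space N → F} (hf : StronglyMeasurable f) {K : ℝ}
    (hb : ∀ Y, ‖f Y‖ ≤ K) (X : Space N) :
    Integrable (fun Y => subordinatedKernel Q B a X Y z • f Y) ∧
    extension Q B a f X z = ∫ t in Ioi (0 : ℝ), weight s z t • semigroup Q B t f X := by
  have hm : Measurable fun q : ℝ × Space N => transitionKernel Q B X q.2 q.1 :=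
    measurable_transitionKernel.comp (f := fun q : ℝ × Space N => (q.1, X, q.2)) (by fun_prop)
  have hG : AEStronglyMeasurable (fun q : ℝ × Space N =>
      (weight s z q.1 * transitionKernel Q B X q.2 q.1) • f q.2)
      ((volume.restrict (Ioi 0)).prod volume) :=
    (((measurable_weight s z).comp measurable_fst).mul hm).aestronglyMeasurable.smul
      (hf.comp_measurable measurable_snd).aestronglyMeasurable
  have hint : Integrable (fun q : ℝ × Space N =>
      (weight s z q.1 * transitionKernel Q B X q.2 q.1) • f q.2)
      ((volume.restrict (Ioi 0)).prod volume) := by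
    rw [integrable_prod_iff hG]
    constructor
    · refine (ae_restrict_iff' measurableSet_Ioi).2 (Eventually.of_forall fun t ht => ?_)
      simp only [mul_smul]
      have h := integrable_transitionKernel_smul hK X ht hf hb
      exact h.smul (weight s z t)
    · refine ((integrableOn_weight hs hz).mul_const K).mono' hG.norm.integral_prod_right'
        ((ae_restrict_iff' measurableSet_Ioi).2 (Eventually.of_forall fun t ht => ?_))
      have hw := weight_nonneg hs hz ht
      rw [Real.norm_of_nonneg (integral_nonneg fun _ => norm_nonneg _)]
      obtain ⟨h1, h2⟩ := integrable_transitionKernel hK X ht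
      calc ∫ Y, ‖(weight s z t * transitionKernel Q B X Y t) • f Y‖
          ≤ ∫ Y, weight s z t * (transitionKernel Q B X Y t * K) := by
            refine integral_mono_of_nonneg (Eventually.of_forall fun _ => norm_nonneg _)
              ((h1.mul_const K).const_mul _) (Eventually.of_forall fun Y => ?_)
            have hp := transitionKernel_nonneg hK X Y ht
            simp only
            rw [norm_smul, Real.norm_of_nonneg (mul_nonneg hw hp), mul_assoc]
            gcongr
            exact hb Y
        _ = weight s z t * K := by rw [integral_const_mul, integral_mul_const, h2, one_mul]
  have hker : ∀ Y, subordinatedKernel Q B a X Y z • f Y =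
      ∫ t in Ioi (0 : ℝ), (weight s z t * transitionKernel Q B X Y t) • f Y := fun Y => by
    rw [subordinatedKernel]
    simp only [poissonKernelTime_eq ha]
    rw [integral_smul_const]
  constructor
  · simp only [hker]
    exact hint.swap.integral_prod_left
  · rw [extension]
    simp only [hker]
    rw [← integral_integral_swap (f := fun t Y =>
      (weight s z t * transitionKernel Q B X Y t) • f Y) hint]
    refine integral_congr_ae (Eventually.of_forall fun t => ?_)
    simp only [mul_smul]
    rw [integral_smul]
    rfl

end

end KernelBounds

/-! ### Contractivity of the flow and of the semigroup on L^p -/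

section LpBounds

open scoped SchwartzMap

variable {N : ℕ} {Q B : Matrix (Fin N) (Fin N) ℝ}
variable {F : Type*} [NormedAddCommGroup F]

theorem eLpNorm_comp_add_right (v : Space N) {f : Space N → F} (hf : Continuous f) (p : ℝ≥0∞) :
    eLpNorm (fun x => f (x + v)) p volume = eLpNorm f p volume :=
  eLpNorm_comp_measurePreserving hf.aestronglyMeasurable
    (measurePreserving_add_right volume v)

/-- The flow does not increase the `L^p` norm if `tr B ≥ 0` or `p = ∞`. -/
theorem eLpNorm_comp_flow_le {p : ℝ≥0∞} (hp : p = ⊤ ∨ 0 ≤ B.trace) {t : ℝ} (ht : 0 ≤ t)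
    {f : Space N → F} (hf : StronglyMeasurable f) (v : Space N) :
    eLpNorm (fun x => f (flow B t x + v)) p volume ≤ eLpNorm f p volume := by
  have hdet : LinearMap.det (flow B t : Space N →ₗ[ℝ] Space N) = (NormedSpace.exp (t • B)).det :=
    det_toEuclideanCLM _
  have hpos := det_exp_pos B t
  have hmap := map_add_linear_volume (flow B t) (by rw [hdet]; exact hpos.ne') v
  have h1 : eLpNorm (fun x => f (flow B t x + v)) p volume =
      eLpNorm f p (Measure.map (fun y => v + flow B t y) volume) := by
    rw [eLpNorm_map_measure hf.aestronglyMeasurable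
      (by
        have := (flow B t).continuous.measurable
        fun_prop)]
    simp only [Function.comp_def, add_comm]
  rw [h1, hmap]
  rcases hp with rfl | hB
  -- The essential supremum sees only null sets, so the Jacobian is irrelevant; for finite p it must
  -- be at least 1.
  · simp only [eLpNorm_exponent_top]
    exact eLpNormEssSup_mono_measure f Measure.smul_absolutelyContinuous
  · refine eLpNorm_mono_measure f ?_
    rw [hdet, abs_of_pos (inv_pos.2 hpos)]
    refine Measure.le_iff.2 fun s _ => ?_
    rw [Measure.smul_apply, smul_eq_mul]
    refine mul_le_of_le_one_left' ?_
    rw [ENNReal.ofReal_le_one]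
    exact inv_le_one_of_one_le₀ (one_le_det_exp B hB ht)

variable [NormedSpace ℝ F]

/-- The semigroup is contractive on `L^p`. -/
theorem eLpNorm_semigroup_le (hK : ∀ t : ℝ, 0 < t → (covariance Q B t).PosDef)
    {p : ℝ≥0∞} (hp1 : 1 ≤ p) (hp : p = ⊤ ∨ 0 ≤ B.trace) {t : ℝ} (ht : 0 < t)
    {f : Space N → F} (hf : StronglyMeasurable f) {M : ℝ≥0∞} (hM0 : M ≠ 0) (hMt : M ≠ ⊤)
    (hfM : eLpNorm f p volume ≤ M) : eLpNorm (semigroup Q B t f) p volume ≤ M := by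
  obtain ⟨R, -, -, -, hrep⟩ := exists_gauss_representation (F := F) hK ht
  have h1 : semigroup Q B t f = fun X => ∫ y, f (flow B t X + R y) ∂gauss N :=
    funext fun X => hrep X f
  rw [h1]
  have h2 : StronglyMeasurable (Function.uncurry fun (y X : Space N) => f (flow B t X + R y)) :=
    hf.comp_measurable (by fun_prop)
  refine (eLpNorm_integral_le (m := fun _ => M) h2.aestronglyMeasurable hp1 aemeasurable_const
    (by simp [hM0]) (by simp [hMt]) (Eventually.of_forall fun y => ?_)).trans (by simp)
  exact (eLpNorm_comp_flow_le hp ht.le hf (R y)).trans hfM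

/-- The fundamental theorem of calculus along the segment from x to x + v, then Minkowski and
translation invariance of the norm. -/
theorem eLpNorm_translate_sub_le [CompleteSpace F] {p : ℝ≥0∞} (hp1 : 1 ≤ p) {h : Space N → F}
    (hh : ContDiff ℝ 1 h) (v : Space N) {M : ℝ≥0∞} (hM0 : M ≠ 0) (hMt : M ≠ ⊤)
    (hle : eLpNorm (fun x => fderiv ℝ h x v) p volume ≤ M) :
    eLpNorm (fun x => h (x + v) - h x) p volume ≤ M := by
  have hc : Continuous fun x => fderiv ℝ h x v :=
    (hh.continuous_fderiv one_ne_zero).clm_apply continuous_const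
  have h1 : ∀ x, h (x + v) - h x = ∫ r in Ioc (0 : ℝ) 1, fderiv ℝ h (x + r • v) v := fun x => by
    rw [← intervalIntegral.integral_of_le zero_le_one]
    have hd : ∀ r ∈ uIcc (0 : ℝ) 1, HasDerivAt (fun r : ℝ => h (x + r • v))
        (fderiv ℝ h (x + r • v) v) r := fun r _ => by
      have e1 : HasDerivAt (fun r : ℝ => x + r • v) v r := by
        simpa using ((hasDerivAt_id r).smul_const v).const_add x
      exact ((hh.differentiable one_ne_zero _).hasFDerivAt).comp_hasDerivAt r e1
    rw [intervalIntegral.integral_eq_sub_of_hasDerivAt hd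
      ((hc.comp (by fun_prop)).intervalIntegrable _ _)]
    simp
  simp_rw [h1]
  have h2 : Continuous (Function.uncurry fun (r : ℝ) (x : Space N) => fderiv ℝ h (x + r • v) v) :=
    hc.comp (by fun_prop)
  refine (eLpNorm_integral_le (m := fun _ => M) h2.aestronglyMeasurable hp1 aemeasurable_const
    (by simp [hM0]) (by simp [hMt]) (Eventually.of_forall fun r => ?_)).trans (by simp)
  rw [eLpNorm_comp_add_right (r • v) hc p]
  exact hle

end LpBounds

/-! ### The estimate ‖P_tφ - φ‖_p ≤ C min(t,1) for Schwartz functions -/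

section LpBounds

open scoped SchwartzMap

variable {N : ℕ} {Q B : Matrix (Fin N) (Fin N) ℝ}
variable {F : Type*} [NormedAddCommGroup F] [NormedSpace ℝ F]

theorem eLpNorm_schwartz_ne_top (f : 𝓢(Space N, F)) (p : ℝ≥0∞) :
    eLpNorm f p volume ≠ ⊤ :=
  ne_of_lt (f.eLpNorm_lt_top p volume)

theorem eLpNorm_apply_apply_le (D : Space N → Space N →L[ℝ] Space N →L[ℝ] F) (v : Space N)
    (p : ℝ≥0∞) :
    eLpNorm (fun x => D x v v) p volume ≤ ENNReal.ofReal (‖v‖ ^ 2) * eLpNorm D p volume := by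
  have hpt : ∀ x, ‖D x v v‖ ≤ ‖v‖ ^ 2 * ‖D x‖ := fun x =>
    ((D x).le_opNorm₂ v v).trans_eq (by ring)
  rw [← eLpNorm_norm D]
  refine eLpNorm_le_mul_eLpNorm_of_ae_le_mul (G := ℝ) (Eventually.of_forall fun x => ?_) p
  rw [norm_norm]
  exact hpt x

/-- The symmetric second difference is of second order in `L^p`. -/
theorem eLpNorm_second_difference_le [CompleteSpace F] {p : ℝ≥0∞} (hp1 : 1 ≤ p) (φ : 𝓢(Space N, F)) :
    ∃ M : ℝ≥0∞, M ≠ ⊤ ∧ ∀ v : Space N,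
      eLpNorm (fun x => φ (x + v) + φ (x - v) - (2 : ℝ) • φ x) p volume ≤
        M * ENNReal.ofReal (‖v‖ ^ 2) := by
  have hφ2 : ContDiff ℝ 2 φ := φ.smooth 2
  have hφ1 : ContDiff ℝ 1 φ := φ.smooth 1
  obtain ⟨D, hD⟩ : ∃ D : 𝓢(Space N, Space N →L[ℝ] F), ∀ x, D x = fderiv ℝ φ x :=
    ⟨SchwartzMap.fderivCLM ℝ (Space N) F φ, SchwartzMap.fderivCLM_apply ℝ φ⟩
  obtain ⟨D2, hD2⟩ : ∃ D2 : 𝓢(Space N, Space N →L[ℝ] Space N →L[ℝ] F),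
      ∀ x, D2 x = fderiv ℝ D x :=
    ⟨SchwartzMap.fderivCLM ℝ (Space N) (Space N →L[ℝ] F) D, SchwartzMap.fderivCLM_apply ℝ D⟩
  have hD2p : eLpNorm D2 p volume ≠ ⊤ := eLpNorm_schwartz_ne_top D2 p
  refine ⟨eLpNorm D2 p volume + 1, ENNReal.add_ne_top.2
    ⟨hD2p, ENNReal.one_ne_top⟩, fun v => ?_⟩
  -- For v = 0 the intended majorant is zero, which the Minkowski inequality above excludes.
  rcases eq_or_ne v 0 with rfl | hv
  · simp [two_smul]
  set M := (eLpNorm D2 p volume + 1) * ENNReal.ofReal (‖v‖ ^ 2) with hM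
  have hvpos : 0 < ‖v‖ ^ 2 := by positivity
  have hM0 : M ≠ 0 := mul_ne_zero (by simp) (by simpa using hv)
  have hMt : M ≠ ⊤ := ENNReal.mul_ne_top (ENNReal.add_ne_top.2
    ⟨hD2p, ENNReal.one_ne_top⟩) ENNReal.ofReal_ne_top
  let k : Space N → F := fun x => D x v
  have hDs : ContDiff ℝ 1 D := D.smooth 1
  have hk : ContDiff ℝ 1 k := hDs.clm_apply contDiff_const
  have hkd : ∀ x, fderiv ℝ k x v = D2 x v v := fun x => by
    have := ((hDs.differentiable one_ne_zero x).hasFDerivAt.clm_apply (hasFDerivAt_const v x)).fderiv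
    simp only [k]
    rw [this]
    simp [hD2]
  have h1 : eLpNorm (fun x => fderiv ℝ k x v) p volume ≤ M := by
    simp_rw [hkd]
    calc eLpNorm (fun x => D2 x v v) p volume
        ≤ ENNReal.ofReal (‖v‖ ^ 2) * eLpNorm D2 p volume := by
          exact eLpNorm_apply_apply_le D2 v p
      _ ≤ M := by
        rw [hM, mul_comm]
        gcongr
        exact le_self_add
  have h2 := eLpNorm_translate_sub_le hp1 hk v hM0 hMt h1
  -- The symmetric second difference is the first difference h(x + v) - h(x), and the derivative of
  -- h along v is in turn a first difference of k = ∂_vφ.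
  let h : Space N → F := fun x => φ x - φ (x - v)
  have hh : ContDiff ℝ 1 h := hφ1.sub (hφ1.comp (contDiff_id.sub contDiff_const))
  have hhd : ∀ x, fderiv ℝ h x v = k (x + -v + v) - k (x + -v) := fun x => by
    have e1 := (hφ1.differentiable one_ne_zero x).hasFDerivAt
    have e2 : HasFDerivAt (fun x => φ (x - v)) (fderiv ℝ φ (x - v)) x :=
      ((hφ1.differentiable one_ne_zero (x - v)).hasFDerivAt).comp x
        ((hasFDerivAt_id x).sub_const v)
    simp only [h]
    rw [(e1.fun_sub e2).fderiv]
    simp [k, hD, sub_eq_add_neg]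
  have h3 : eLpNorm (fun x => fderiv ℝ h x v) p volume ≤ M := by
    simp_rw [hhd]
    have hc : Continuous fun x => k (x + v) - k x := by
      have := hk.continuous
      fun_prop
    have := eLpNorm_comp_add_right (-v) hc p
    rw [this]
    exact h2
  have h4 := eLpNorm_translate_sub_le hp1 hh v hM0 hMt h3
  refine le_trans (le_of_eq ?_) h4
  congr 1
  funext x
  simp only [h, add_sub_cancel_right, two_smul]
  abel

/-- Along an orbit of the flow the derivative of φ is G(e^{rB}x) with G(x) = Dφ(x)[Bx]. The drift
grows linearly, but G is still a Schwartz function, so its L^p norm is finite. -/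
theorem eLpNorm_flow_sub_le [CompleteSpace F] {p : ℝ≥0∞} (hp1 : 1 ≤ p) (hp : p = ⊤ ∨ 0 ≤ B.trace)
    (φ : 𝓢(Space N, F)) :
    ∃ M : ℝ≥0∞, M ≠ ⊤ ∧ ∀ t : ℝ, 0 ≤ t →
      eLpNorm (fun x => φ (flow B t x) - φ x) p volume ≤ M * ENNReal.ofReal t := by
  have hφ1 : ContDiff ℝ 1 φ := φ.smooth 1
  obtain ⟨G, hG⟩ : ∃ G : 𝓢(Space N, F), ∀ x,
      G x = fderiv ℝ φ x (Matrix.toEuclideanCLM (𝕜 := ℝ) B x) :=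
    ⟨SchwartzMap.bilinLeftCLM (ContinuousLinearMap.id ℝ (Space N →L[ℝ] F))
      (Matrix.toEuclideanCLM (𝕜 := ℝ) B : Space N →L[ℝ] Space N).hasTemperateGrowth
      (SchwartzMap.fderivCLM ℝ (Space N) F φ), fun x => rfl⟩
  set M := eLpNorm G p volume + 1 with hM
  have hMt : M ≠ ⊤ := ENNReal.add_ne_top.2 ⟨eLpNorm_schwartz_ne_top G p, ENNReal.one_ne_top⟩
  have hM0 : M ≠ 0 := by simp [hM]
  refine ⟨M, hMt, fun t ht => ?_⟩
  have hGc : Continuous G := G.continuous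
  have h1 : ∀ x, φ (flow B t x) - φ x = ∫ r in Ioc (0 : ℝ) t, G (flow B r x) := fun x => by
    rw [← intervalIntegral.integral_of_le ht]
    have hd : ∀ r ∈ uIcc (0 : ℝ) t, HasDerivAt (fun r : ℝ => φ (flow B r x))
        (G (flow B r x)) r := fun r _ => by
      rw [hG]
      exact ((hφ1.differentiable one_ne_zero _).hasFDerivAt).comp_hasDerivAt r
        (hasDerivAt_flow_apply B x r)
    rw [intervalIntegral.integral_eq_sub_of_hasDerivAt hd
      ((hGc.comp ((continuous_flow B).clm_apply continuous_const)).intervalIntegrable _ _)]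
    simp [flow_zero]
  simp_rw [h1]
  have h2 : Continuous (Function.uncurry fun (r : ℝ) (x : Space N) => G (flow B r x)) :=
    hGc.comp (((continuous_flow B).comp continuous_fst).clm_apply continuous_snd)
  refine (eLpNorm_integral_le (m := fun _ => M) h2.aestronglyMeasurable hp1 aemeasurable_const
    (by simp [hM0]) (by simp [hMt])
    ((ae_restrict_iff' measurableSet_Ioc).2 (Eventually.of_forall fun r hr => ?_))).trans (by simp)
  have := eLpNorm_comp_flow_le hp hr.1.le hGc.stronglyMeasurable 0 (p := p)
  simp only [add_zero] at this
  exact this.trans le_self_add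

/-- `‖P_t φ - φ‖_p ≤ C min(t, 1)`. -/
theorem eLpNorm_semigroup_sub_le [CompleteSpace F]
    (hK : ∀ t : ℝ, 0 < t → (covariance Q B t).PosDef)
    {p : ℝ≥0∞} (hp1 : 1 ≤ p) (hp : p = ⊤ ∨ 0 ≤ B.trace) (φ : 𝓢(Space N, F)) :
    ∃ C : ℝ≥0∞, C ≠ 0 ∧ C ≠ ⊤ ∧ ∀ t : ℝ, 0 < t →
      eLpNorm (fun x => semigroup Q B t φ x - φ x) p volume ≤ C * ENNReal.ofReal (min t 1) := by
  obtain ⟨M₁, hM₁, h1⟩ := eLpNorm_second_difference_le hp1 φ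
  obtain ⟨M₂, hM₂, h2⟩ := eLpNorm_flow_sub_le hp1 hp φ
  obtain ⟨K, hK0, hKtr⟩ := exists_trace_bound Q B
  have hφm : StronglyMeasurable φ := φ.continuous.stronglyMeasurable
  have hJi : Integrable (fun y : Space N => ‖y‖ ^ 2 + 1) (gauss N) :=
    integrable_norm_sq_gauss.add (integrable_const _)
  set J := ∫ y, (‖y‖ ^ 2 + 1) ∂gauss N with hJ
  set M₀ := eLpNorm φ p volume + 1 with hM₀
  have hM₀t : M₀ ≠ ⊤ := ENNReal.add_ne_top.2 ⟨eLpNorm_schwartz_ne_top φ p, ENNReal.one_ne_top⟩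
  have hsm : ∀ t : ℝ, StronglyMeasurable (semigroup Q B t φ) := fun t =>
    (stronglyMeasurable_semigroup hφm).comp_measurable (g := fun X : Space N => (t, X))
      (by fun_prop)
  set C₁ := (M₁ + 1) * ENNReal.ofReal ((K + 1) * J) + M₂ with hC₁
  have hC₁t : C₁ ≠ ⊤ := by finiteness
  refine ⟨C₁ + (M₀ + M₀), ?_, by finiteness, fun t ht => ?_⟩
  · simp [hM₀]
  rcases le_total t 1 with ht1 | ht1
  · obtain ⟨R, -, hR, hint, hrep⟩ := exists_gauss_representation (F := F) hK ht
    -- The Gaussian is even, so averaging over y and -y removes the first-order term, which would be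
    -- of size √t only.
    have hdecomp : ∀ X, semigroup Q B t φ X - φ X =
        (∫ y, (1 / 2 : ℝ) • (φ (flow B t X + R y) + φ (flow B t X - R y) -
          (2 : ℝ) • φ (flow B t X)) ∂gauss N) + (φ (flow B t X) - φ X) := fun X => by
      have i1 : Integrable (fun y => φ (flow B t X + R y)) (gauss N) := by
        obtain ⟨b, hb⟩ : ∃ b, ∀ Y, ‖φ Y‖ ≤ b :=
          ⟨_, fun Y => SchwartzMap.norm_le_seminorm ℝ φ Y⟩
        exact (hint X φ).1 (integrable_transitionKernel_smul hK X ht hφm hb)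
      have i2 : Integrable (fun y => φ (flow B t X - R y)) (gauss N) := by
        obtain ⟨b, hb⟩ : ∃ b, ∀ Y, ‖φ Y‖ ≤ b :=
          ⟨_, fun Y => SchwartzMap.norm_le_seminorm ℝ φ Y⟩
        refine (integrable_const b).mono' ?_ (Eventually.of_forall fun y => hb _)
        have := φ.continuous
        exact Continuous.aestronglyMeasurable (by fun_prop)
      have e2 : ∫ y, φ (flow B t X - R y) ∂gauss N = ∫ y, φ (flow B t X + R y) ∂gauss N := by
        rw [← integral_comp_neg_gauss]
        simp [sub_eq_add_neg]
      rw [integral_smul, integral_sub (f := fun y => φ (flow B t X + R y) + φ (flow B t X - R y))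
          (i1.add i2) (integrable_const _), integral_add i1 i2, e2,
        ← hrep X φ, integral_const]
      simp only [probReal_univ, smul_sub, smul_add, smul_smul]
      norm_num
      rw [← add_smul]
      norm_num
    simp_rw [hdecomp]
    have hcont : Continuous (Function.uncurry fun (y X : Space N) => (1 / 2 : ℝ) •
        (φ (flow B t X + R y) + φ (flow B t X - R y) - (2 : ℝ) • φ (flow B t X))) := by
      have := φ.continuous
      unfold Function.uncurry
      fun_prop
    have hA : eLpNorm (fun X => ∫ y, (1 / 2 : ℝ) • (φ (flow B t X + R y) + φ (flow B t X - R y) -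
          (2 : ℝ) • φ (flow B t X)) ∂gauss N) p volume ≤
          (M₁ + 1) * ENNReal.ofReal ((K + 1) * J) * ENNReal.ofReal t := by
      -- The summands 1 keep the majorant nonzero even at y = 0.
      refine (eLpNorm_integral_le (m := fun y =>
        (M₁ + 1) * ENNReal.ofReal ((K + 1) * t * (‖y‖ ^ 2 + 1))) hcont.aestronglyMeasurable hp1
        (by fun_prop) (Eventually.of_forall fun y => ?_) (Eventually.of_forall fun y => ?_)
        (Eventually.of_forall fun y => ?_)).trans (le_of_eq ?_)
      · refine mul_ne_zero (by simp) ?_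
        have : 0 < (K + 1) * t * (‖y‖ ^ 2 + 1) := by positivity
        simpa using this
      · finiteness
      · have hc2 : Continuous fun x => φ (x + R y) + φ (x - R y) - (2 : ℝ) • φ x := by
          have := φ.continuous
          fun_prop
        have s1 := eLpNorm_comp_flow_le hp ht.le hc2.stronglyMeasurable 0 (p := p)
        simp only [add_zero] at s1
        calc eLpNorm (fun X => (1 / 2 : ℝ) • (φ (flow B t X + R y) + φ (flow B t X - R y) -
              (2 : ℝ) • φ (flow B t X))) p volume
            ≤ eLpNorm (fun X => φ (flow B t X + R y) + φ (flow B t X - R y) -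
              (2 : ℝ) • φ (flow B t X)) p volume := by
              refine eLpNorm_mono fun x => ?_
              rw [norm_smul]
              refine mul_le_of_le_one_left (norm_nonneg _) ?_
              norm_num
          _ ≤ M₁ * ENNReal.ofReal (‖R y‖ ^ 2) := s1.trans (h1 (R y))
          _ ≤ _ := by
            gcongr
            · exact le_self_add
            · calc ‖R y‖ ^ 2 ≤ (t • covariance Q B t).trace * ‖y‖ ^ 2 := hR y
                _ ≤ (K * t) * ‖y‖ ^ 2 := by
                  gcongr
                  exact hKtr t ht ht1
                _ ≤ (K + 1) * t * (‖y‖ ^ 2 + 1) := by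
                  gcongr <;> linarith
      · rw [lintegral_const_mul _ (by fun_prop), ← ofReal_integral_eq_lintegral_ofReal
          ((hJi).const_mul _)
          (Eventually.of_forall fun y => by positivity), integral_const_mul, mul_assoc (M₁ + 1),
          ← ENNReal.ofReal_mul (mul_nonneg (by positivity)
            (integral_nonneg fun y => by positivity))]
        congr 2
        ring
    have hB : StronglyMeasurable fun X => ∫ y, (1 / 2 : ℝ) • (φ (flow B t X + R y) +
        φ (flow B t X - R y) - (2 : ℝ) • φ (flow B t X)) ∂gauss N :=
      StronglyMeasurable.integral_prod_left hcont.stronglyMeasurable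
    have hC : Continuous fun X => φ (flow B t X) - φ X := by
      have := φ.continuous
      fun_prop
    calc _ ≤ _ := eLpNorm_add_le hB.aestronglyMeasurable hC.aestronglyMeasurable hp1
      _ ≤ (M₁ + 1) * ENNReal.ofReal ((K + 1) * J) * ENNReal.ofReal t + M₂ * ENNReal.ofReal t :=
        add_le_add hA (h2 t ht.le)
      _ = C₁ * ENNReal.ofReal (min t 1) := by rw [min_eq_left ht1, hC₁, ← add_mul]
      _ ≤ _ := by
        gcongr
        exact le_self_add
  -- For t ≥ 1 contractivity and the triangle inequality suffice.
  · rw [min_eq_right ht1, ENNReal.ofReal_one, mul_one]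
    have hφM : eLpNorm φ p volume ≤ M₀ := le_self_add
    calc _ ≤ eLpNorm (semigroup Q B t φ) p volume + eLpNorm φ p volume :=
        eLpNorm_sub_le (hsm t).aestronglyMeasurable hφm.aestronglyMeasurable hp1
      _ ≤ M₀ + M₀ := add_le_add (eLpNorm_semigroup_le hK hp1 hp ht hφm (by simp [hM₀]) hM₀t hφM) hφM
      _ ≤ _ := le_add_self

end LpBounds

/-! ### Boundary convergence of U and of its weighted Neumann derivative -/

section Convergence

open scoped SchwartzMap

variable {N : ℕ} {Q B : Matrix (Fin N) (Fin N) ℝ}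
variable {F : Type*} [NormedAddCommGroup F] [NormedSpace ℝ F]

/-- The condition β < 1 gives convergence at 0, the condition β > 0 at infinity. -/
theorem integrableOn_rpow_mul_min {β : ℝ} (h0 : 0 < β) (h1 : β < 1) :
    IntegrableOn (fun t : ℝ => t ^ (-1 - β) * min t 1) (Ioi 0) := by
  rw [← Ioc_union_Ioi_eq_Ioi zero_le_one]
  refine IntegrableOn.union ?_ ?_
  · have h : IntegrableOn (fun t : ℝ => t ^ (-β)) (Ioc 0 1) := by
      have := intervalIntegral.intervalIntegrable_rpow' (a := 0) (b := 1) (r := -β) (by linarith)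
      rwa [intervalIntegrable_iff_integrableOn_Ioc_of_le zero_le_one] at this
    refine h.congr_fun (fun t ht => ?_) measurableSet_Ioc
    simp only
    rw [min_eq_left ht.2, ← Real.rpow_add_one ht.1.ne']
    congr 1
    ring
  · have h := integrableOn_Ioi_rpow_of_lt (a := -1 - β) (by linarith) one_pos
    refine h.congr_fun (fun t ht => ?_) measurableSet_Ioi
    simp only
    rw [min_eq_right (le_of_lt ht), mul_one]

theorem continuous_semigroup (hK : ∀ t : ℝ, 0 < t → (covariance Q B t).PosDef) {t : ℝ}
    (ht : 0 < t) (φ : 𝓢(Space N, F)) : Continuous (semigroup Q B t φ) := by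
  obtain ⟨R, -, -, -, hrep⟩ := exists_gauss_representation (F := F) hK ht
  have h1 : semigroup Q B t φ = fun X => ∫ y, φ (flow B t X + R y) ∂gauss N :=
    funext fun X => hrep X φ
  have hc := φ.continuous
  rw [h1]
  refine continuous_of_dominated (bound := fun _ => (SchwartzMap.seminorm ℝ 0 0) φ)
    (fun X => Continuous.aestronglyMeasurable (by fun_prop))
    (fun X => Eventually.of_forall fun y => SchwartzMap.norm_le_seminorm ℝ φ _)
    (integrable_const _) (Eventually.of_forall fun y => by fun_prop)

/-- For continuous f the set where the bound fails is open, and a nonempty open set is not null.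
This turns the L^∞ estimate into one valid at every point, as absolute convergence for every X
requires. -/
theorem norm_le_of_eLpNorm_top_le {G : Type*} [NormedAddCommGroup G] {f : Space N → G}
    (hf : Continuous f) {C : ℝ≥0∞} (hC : C ≠ ⊤) (h : eLpNorm f ⊤ volume ≤ C) (x : Space N) : ‖f x‖ ≤ C.toReal := by
  by_contra hx
  have ho : IsOpen {y | C.toReal < ‖f y‖} := isOpen_lt continuous_const hf.norm
  have h2 : ∀ᵐ y ∂(volume : Measure (Space N)), ‖f y‖ₑ ≤ C := by
    rw [eLpNorm_exponent_top] at h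
    filter_upwards [ae_le_eLpNormEssSup (f := f) (μ := volume)] with y hy using hy.trans h
  have h3 : volume {y | C.toReal < ‖f y‖} = 0 := by
    refine measure_mono_null (fun y hy => ?_) (ae_iff.1 h2)
    simp only [mem_ofPred_eq, not_le] at hy ⊢
    rw [← ofReal_norm]
    exact (ENNReal.lt_ofReal_iff_toReal_lt hC).2 hy
  exact (ho.measure_pos volume ⟨x, not_le.1 hx⟩).ne' h3

theorem stronglyMeasurable_semigroup_sub (φ : 𝓢(Space N, F)) {k : ℝ → ℝ} (hk : Measurable k) :
    StronglyMeasurable fun q : ℝ × Space N => k q.1 • (semigroup Q B q.1 φ q.2 - φ q.2) :=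
  (hk.comp measurable_fst).stronglyMeasurable.smul
    ((stronglyMeasurable_semigroup φ.continuous.stronglyMeasurable).sub
      (φ.continuous.stronglyMeasurable.comp_measurable measurable_snd))

theorem exists_norm_le (φ : 𝓢(Space N, F)) : ∃ b, ∀ Y, ‖φ Y‖ ≤ b :=
  ⟨_, fun Y => SchwartzMap.norm_le_seminorm ℝ φ Y⟩

theorem aestronglyMeasurable_semigroup_time (φ : 𝓢(Space N, F)) (X : Space N) :
    AEStronglyMeasurable (fun t => semigroup Q B t φ X) (volume.restrict (Ioi 0)) :=
  ((stronglyMeasurable_semigroup φ.continuous.stronglyMeasurable).comp_measurable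
    (g := fun t : ℝ => (t, X)) (by fun_prop)).aestronglyMeasurable

variable [CompleteSpace F]

theorem exists_norm_semigroup_sub_le (hK : ∀ t : ℝ, 0 < t → (covariance Q B t).PosDef)
    (φ : 𝓢(Space N, F)) : ∃ C : ℝ, 0 ≤ C ∧ ∀ t : ℝ, 0 < t → ∀ X,
      ‖semigroup Q B t φ X - φ X‖ ≤ C * min t 1 := by
  obtain ⟨C, -, hCt, hC⟩ := eLpNorm_semigroup_sub_le hK le_top (Or.inl rfl) φ
  refine ⟨C.toReal, ENNReal.toReal_nonneg, fun t ht X => ?_⟩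
  have h := norm_le_of_eLpNorm_top_le ((continuous_semigroup hK ht φ).sub φ.continuous)
    (ENNReal.mul_ne_top hCt ENNReal.ofReal_ne_top) (hC t ht) X
  rwa [ENNReal.toReal_mul, ENNReal.toReal_ofReal (le_min ht.le zero_le_one)] at h

theorem integrableOn_smul_semigroup_sub (hK : ∀ t : ℝ, 0 < t → (covariance Q B t).PosDef)
    (φ : 𝓢(Space N, F)) {k : ℝ → ℝ} (hk : Measurable k) {A β : ℝ} (h0 : 0 < β) (h1 : β < 1)
    (hle : ∀ t : ℝ, 0 < t → |k t| ≤ A * t ^ (-1 - β)) (X : Space N) :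
    IntegrableOn (fun t => k t • (semigroup Q B t φ X - φ X)) (Ioi 0) := by
  obtain ⟨C, hC0, hC⟩ := exists_norm_semigroup_sub_le hK φ
  refine ((integrableOn_rpow_mul_min h0 h1).const_mul (A * C)).mono'
    ((stronglyMeasurable_semigroup_sub φ hk).comp_measurable
      (g := fun t : ℝ => (t, X)) (by fun_prop)).aestronglyMeasurable
    ((ae_restrict_iff' measurableSet_Ioi).2 (Eventually.of_forall fun t ht => ?_))
  rw [norm_smul, Real.norm_eq_abs]
  calc |k t| * ‖semigroup Q B t φ X - φ X‖ ≤ (A * t ^ (-1 - β)) * (C * min t 1) :=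
        mul_le_mul (hle t ht) (hC t ht X) (norm_nonneg _) ((abs_nonneg _).trans (hle t ht))
    _ = _ := by ring

/-- Minkowski combined with the min(t,1) estimate. The constant C is independent of k, so for a
family of kernels k_z the rate of convergence is that of A(z). -/
theorem exists_eLpNorm_integral_le (hK : ∀ t : ℝ, 0 < t → (covariance Q B t).PosDef)
    {p : ℝ≥0∞} (hp1 : 1 ≤ p) (hp : p = ⊤ ∨ 0 ≤ B.trace) (φ : 𝓢(Space N, F)) {β : ℝ}
    (h0 : 0 < β) (h1 : β < 1) :
    ∃ C : ℝ≥0∞, C ≠ ⊤ ∧ ∀ (k : ℝ → ℝ) (A : ℝ), Measurable k → 0 < A →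
      (∀ t : ℝ, 0 < t → |k t| ≤ A * t ^ (-1 - β)) →
      MemLp (fun X => ∫ t in Ioi (0 : ℝ), k t • (semigroup Q B t φ X - φ X)) p volume ∧
      eLpNorm (fun X => ∫ t in Ioi (0 : ℝ), k t • (semigroup Q B t φ X - φ X)) p volume ≤
        C * ENNReal.ofReal A := by
  obtain ⟨C, hC0, hCt, hC⟩ := eLpNorm_semigroup_sub_le hK hp1 hp φ
  have hJ := integrableOn_rpow_mul_min h0 h1
  set J := ∫ t in Ioi (0 : ℝ), t ^ (-1 - β) * min t 1
  refine ⟨C * ENNReal.ofReal J, ENNReal.mul_ne_top hCt ENNReal.ofReal_ne_top,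
    fun k A hk hA hle => ?_⟩
  have hm := stronglyMeasurable_semigroup_sub (Q := Q) (B := B) φ hk
  have hbound : eLpNorm (fun X => ∫ t in Ioi (0 : ℝ), k t • (semigroup Q B t φ X - φ X)) p volume ≤
      C * ENNReal.ofReal J * ENNReal.ofReal A := by
    refine (eLpNorm_integral_le (h := fun t X => k t • (semigroup Q B t φ X - φ X))
      (m := fun t => C * ENNReal.ofReal (A * (t ^ (-1 - β) * min t 1)))
      hm.aestronglyMeasurable hp1 (by fun_prop)
      ((ae_restrict_iff' measurableSet_Ioi).2 (Eventually.of_forall fun t ht => ?_))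
      (Eventually.of_forall fun t => ENNReal.mul_ne_top hCt ENNReal.ofReal_ne_top)
      ((ae_restrict_iff' measurableSet_Ioi).2 (Eventually.of_forall fun t ht => ?_))).trans
      (le_of_eq ?_)
    · have ht0 : (0 : ℝ) < t := ht
      have : 0 < A * (t ^ (-1 - β) * min t 1) := by positivity
      exact mul_ne_zero hC0 (by simpa using this)
    · have ht0 : (0 : ℝ) < t := ht
      have e1 : ∀ X, ‖k t • (semigroup Q B t φ X - φ X)‖ ≤
          A * t ^ (-1 - β) * ‖semigroup Q B t φ X - φ X‖ := fun X => by
        rw [norm_smul, Real.norm_eq_abs]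
        exact mul_le_mul_of_nonneg_right (hle t ht) (norm_nonneg _)
      calc eLpNorm (fun X => k t • (semigroup Q B t φ X - φ X)) p volume
          ≤ ENNReal.ofReal (A * t ^ (-1 - β)) *
            eLpNorm (fun X => semigroup Q B t φ X - φ X) p volume :=
            eLpNorm_le_mul_eLpNorm_of_ae_le_mul (Eventually.of_forall e1) p
        _ ≤ ENNReal.ofReal (A * t ^ (-1 - β)) * (C * ENNReal.ofReal (min t 1)) := by
            gcongr
            exact hC t ht
        _ = C * (ENNReal.ofReal (A * t ^ (-1 - β)) * ENNReal.ofReal (min t 1)) := by ring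
        _ = _ := by rw [← ENNReal.ofReal_mul (by positivity), mul_assoc]
    · rw [lintegral_const_mul' _ _ hCt, ← ofReal_integral_eq_lintegral_ofReal (hJ.const_mul A)
        ((ae_restrict_iff' measurableSet_Ioi).2 (Eventually.of_forall fun t ht => ?_)),
        integral_const_mul, mul_comm A, ENNReal.ofReal_mul' hA.le, mul_assoc]
      have ht0 : (0 : ℝ) < t := ht
      simp only [Pi.zero_apply]
      positivity
  refine ⟨⟨?_, hbound.trans_lt (by finiteness)⟩, hbound⟩
  exact (StronglyMeasurable.integral_prod_left (f := fun t X =>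
    k t • (semigroup Q B t φ X - φ X)) hm).aestronglyMeasurable

variable {s a : ℝ}

theorem extension_sub_eq (hK : ∀ t : ℝ, 0 < t → (covariance Q B t).PosDef) (hs : 0 < s)
    (ha : a = 1 - 2 * s) (φ : 𝓢(Space N, F)) {z : ℝ} (hz : 0 < z) (X : Space N) :
    extension Q B a φ X z - φ X =
      ∫ t in Ioi (0 : ℝ), weight s z t • (semigroup Q B t φ X - φ X) := by
  obtain ⟨b, hb⟩ := exists_norm_le φ
  rw [(extension_eq hK hs ha hz φ.continuous.stronglyMeasurable hb X).2]
  simp only [smul_sub]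
  rw [integral_sub (integrableOn_weight_smul hs hz (aestronglyMeasurable_semigroup_time φ X)
    (fun t ht => norm_semigroup_le hK X ht hb)) ((integrableOn_weight hs hz).smul_const _),
    integral_smul_const, integral_weight hs hz, one_smul]

/-- The term φ X may be subtracted because the differentiated weight has mass zero; the gain of
min(t,1) near t = 0 is what survives the limit z → 0. -/
theorem hasDerivAt_extension (hK : ∀ t : ℝ, 0 < t → (covariance Q B t).PosDef) (hs : 0 < s)
    (ha : a = 1 - 2 * s) (φ : 𝓢(Space N, F)) {z : ℝ} (hz : 0 < z) (X : Space N) :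
    HasDerivAt (fun ζ => extension Q B a φ X ζ)
      (∫ t in Ioi (0 : ℝ), weightDeriv s z t • (semigroup Q B t φ X - φ X)) z := by
  obtain ⟨b, hb⟩ := exists_norm_le φ
  obtain ⟨h1, h2⟩ := hasDerivAt_integral_weight_smul hs hz
    (aestronglyMeasurable_semigroup_time (Q := Q) (B := B) φ X)
    (fun t ht => norm_semigroup_le hK X ht hb)
  have h3 : ∫ t in Ioi (0 : ℝ), weightDeriv s z t • (semigroup Q B t φ X - φ X) =
      ∫ t in Ioi (0 : ℝ), weightDeriv s z t • semigroup Q B t φ X := by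
    simp only [smul_sub]
    rw [integral_sub h1 ((integrableOn_weightDeriv hs hz).smul_const _), integral_smul_const,
      integral_weightDeriv hs hz, zero_smul, sub_zero]
  rw [h3]
  refine h2.congr_of_eventuallyEq ?_
  filter_upwards [lt_mem_nhds hz] with ζ hζ
  exact (extension_eq hK hs ha hζ φ.continuous.stronglyMeasurable hb X).2

theorem tendsto_mul_ofReal_rpow {C : ℝ≥0∞} (hC : C ≠ ⊤) (A : ℝ) {α : ℝ} (hα : 0 < α) :
    Tendsto (fun z : ℝ => C * ENNReal.ofReal (A * z ^ α)) (𝓝[>] 0) (𝓝 0) := by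
  have h1 : Tendsto (fun z : ℝ => A * z ^ α) (𝓝[>] 0) (𝓝 (A * 0 ^ α)) :=
    ((Real.continuousAt_rpow_const 0 α (Or.inr hα.le)).tendsto.mono_left
      nhdsWithin_le_nhds).const_mul A
  rw [Real.zero_rpow hα.ne', mul_zero] at h1
  have h2 := ENNReal.Tendsto.const_mul (a := C) (ENNReal.tendsto_ofReal h1) (Or.inr hC)
  simpa using h2

/-- `U(·,z) → φ` in `L^p`. -/
theorem tendstoInLp_extension (hK : ∀ t : ℝ, 0 < t → (covariance Q B t).PosDef) (hs : 0 < s)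
    (hs1 : s < 1) (ha : a = 1 - 2 * s) {p : ℝ≥0∞} (hp1 : 1 ≤ p) (hp : p = ⊤ ∨ 0 ≤ B.trace)
    (φ : 𝓢(Space N, F)) : TendstoInLp p (extension Q B a φ) φ := by
  obtain ⟨C, hCt, hC⟩ := exists_eLpNorm_integral_le hK hp1 hp φ hs hs1
  have hΓ := Real.Gamma_pos_of_pos hs
  set A := 1 / (2 ^ (2 * s) * Real.Gamma s) with hA
  have hA0 : 0 < A := by positivity
  have key := fun (z : ℝ) (hz : 0 < z) =>
    hC (weight s z) (A * z ^ (2 * s)) (measurable_weight s z) (by positivity) (fun t ht => by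
      rw [abs_of_nonneg (weight_nonneg hs hz ht), weight_eq ht, ← hA,
        show -(1 + s) = -1 - s by ring]
      gcongr
      refine mul_le_of_le_one_right (by positivity) ?_
      rw [Real.exp_le_one_iff, neg_div]
      have : 0 < z ^ 2 / 4 / t := by positivity
      linarith)
  have hφ : MemLp φ p volume := φ.memLp p volume
  refine ⟨fun z hz => ?_, hφ, ?_⟩
  · have h1 := (key z hz).1.add hφ
    refine h1.ae_eq (Eventually.of_forall fun X => ?_)
    simp only [Pi.add_apply]
    rw [← extension_sub_eq hK hs ha φ hz, sub_add_cancel]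
  · refine tendsto_of_tendsto_of_tendsto_of_le_of_le' tendsto_const_nhds
      (tendsto_mul_ofReal_rpow hCt A (show 0 < 2 * s by linarith))
      (Eventually.of_forall fun _ => zero_le) ?_
    filter_upwards [self_mem_nhdsWithin] with z hz
    simp_rw [extension_sub_eq hK hs ha φ hz]
    exact (key z hz).2

/-- The kernel of the weighted Neumann derivative of the extension. -/
noncomputable def neumannKernel (s a z t : ℝ) : ℝ :=
  -(2 ^ (-a) * Real.Gamma ((1 - a) / 2) / Real.Gamma ((1 + a) / 2) * (z ^ a * weightDeriv s z t))

/-- All powers of z cancel outside the combination r = z²/(4t). As r → 0 the kernel tends to -s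
t^{-1-s}/Γ(1-s), the kernel of the fractional power. -/
theorem neumannKernel_eq (hs : 0 < s) (hs1 : s < 1) (ha : a = 1 - 2 * s) {z t : ℝ} (hz : 0 < z)
    (ht : 0 < t) : neumannKernel s a z t =
      -(1 / Real.Gamma (1 - s)) * t ^ (-1 - s) * (Real.exp (-(z ^ 2 / (4 * t))) *
        (s - z ^ 2 / (4 * t))) := by
  have h1 := (Real.Gamma_pos_of_pos hs).ne'
  have h2 := (Real.Gamma_pos_of_pos (show 0 < 1 - s by linarith)).ne'
  have e1 : (2 : ℝ) ^ (-a) = 2 ^ (2 * s) / 2 := by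
    rw [ha, show -(1 - 2 * s) = 2 * s - 1 by ring, Real.rpow_sub two_pos, Real.rpow_one]
  have e2 : z ^ a = z / z ^ (2 * s) := by rw [ha, Real.rpow_sub hz, Real.rpow_one]
  have h3 : (0 : ℝ) < z ^ (2 * s) := Real.rpow_pos_of_pos hz _
  have h4 : (0 : ℝ) < 2 ^ (2 * s) := Real.rpow_pos_of_pos two_pos _
  rw [neumannKernel, weightDeriv, weight_eq ht, e1, e2, show (1 - a) / 2 = s by rw [ha]; ring,
    show (1 + a) / 2 = 1 - s by rw [ha]; ring, show -(1 + s) = -1 - s by ring,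
    show -(z ^ 2 / 4) / t = -(z ^ 2 / (4 * t)) by field_simp]
  field_simp
  ring

/-- The quantity is s(1 - e^{-r}) + r e^{-r}; both 1 - e^{-r} and r e^{-r} are at most min(1,r) ≤
r^θ. -/
theorem abs_exp_mul_sub_le (hs : 0 < s) (hs1 : s < 1) {r θ : ℝ} (hr : 0 < r) (hθ : 0 < θ)
    (hθ1 : θ ≤ 1) : |s - Real.exp (-r) * (s - r)| ≤ 2 * r ^ θ := by
  have h1 : min 1 r ≤ r ^ θ := by
    rcases le_total r 1 with h | h
    · rw [min_eq_right h]
      calc r = r ^ (1 : ℝ) := (Real.rpow_one r).symm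
        _ ≤ r ^ θ := Real.rpow_le_rpow_of_exponent_ge hr h hθ1
    · rw [min_eq_left h]
      exact Real.one_le_rpow h hθ.le
  have h2 : 1 - Real.exp (-r) ≤ min 1 r := by
    refine le_min ?_ ?_
    · linarith [Real.exp_pos (-r)]
    · linarith [Real.add_one_le_exp (-r)]
  have h3 : r * Real.exp (-r) ≤ min 1 r := by
    refine le_min ?_ ?_
    · rw [Real.exp_neg, ← div_eq_mul_inv, div_le_one (Real.exp_pos _)]
      linarith [Real.add_one_le_exp r]
    · refine mul_le_of_le_one_right hr.le ?_
      rw [Real.exp_le_one_iff]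
      linarith
  have h4 : Real.exp (-r) ≤ 1 := by
    rw [Real.exp_le_one_iff]
    linarith
  have h5 := Real.exp_pos (-r)
  rw [abs_of_nonneg (by nlinarith)]
  nlinarith

/-- The weighted Neumann derivative of `U` converges to the fractional power in `L^p`. -/
theorem tendstoInLp_neumann (hK : ∀ t : ℝ, 0 < t → (covariance Q B t).PosDef) (hs : 0 < s)
    (hs1 : s < 1) (ha : a = 1 - 2 * s) {p : ℝ≥0∞} (hp1 : 1 ≤ p) (hp : p = ⊤ ∨ 0 ≤ B.trace)
    (φ : 𝓢(Space N, F)) :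
    TendstoInLp p
      (fun X z => -((2 ^ (-a) * Real.Gamma ((1 - a) / 2) / Real.Gamma ((1 + a) / 2)) •
        (z ^ a • deriv (fun ζ => extension Q B a φ X ζ) z)))
      (fractionalPower Q B s φ) := by
  have hΓ := Real.Gamma_pos_of_pos (show 0 < 1 - s by linarith)
  set g := 1 / Real.Gamma (1 - s) with hg
  have hg0 : 0 < g := by positivity
  -- Half the gap between s and 1: s + θ < 1 keeps the singularity at t = 0 admissible, while θ > 0
  -- leaves a factor z^{2θ} that tends to 0.
  set θ := (1 - s) / 2 with hθ
  have hθ0 : 0 < θ := by rw [hθ]; linarith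
  obtain ⟨C₁, -, hC₁⟩ := exists_eLpNorm_integral_le hK hp1 hp φ hs hs1
  obtain ⟨C₂, hC₂t, hC₂⟩ := exists_eLpNorm_integral_le hK hp1 hp φ
    (show 0 < s + θ by linarith) (show s + θ < 1 by rw [hθ]; linarith)
  have hk0m : Measurable fun t : ℝ => -(s * g) * t ^ (-s - 1) := by fun_prop
  have hkm : ∀ z, Measurable (neumannKernel s a z) := fun z => by
    have := measurable_weightDeriv s z
    unfold neumannKernel
    fun_prop
  have hkdm : ∀ z, Measurable fun t : ℝ => neumannKernel s a z t - -(s * g) * t ^ (-s - 1) :=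
    fun z => (hkm z).sub hk0m
  have hk0le : ∀ t : ℝ, 0 < t → |-(s * g) * t ^ (-s - 1)| ≤ s * g * t ^ (-1 - s) := fun t ht => by
    rw [abs_mul, abs_neg, abs_of_pos (by positivity : 0 < s * g),
      abs_of_pos (Real.rpow_pos_of_pos ht _), show -s - 1 = -1 - s by ring]
  have hfrac : ∀ X, fractionalPower Q B s φ X =
      ∫ t in Ioi (0 : ℝ), (-(s * g) * t ^ (-s - 1)) • (semigroup Q B t φ X - φ X) := fun X => by
    rw [fractionalPower, ← integral_smul]
    simp only [smul_smul]
    rw [show s / Real.Gamma (1 - s) = s * g by rw [hg]; ring]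
  have hneu : ∀ z : ℝ, 0 < z → ∀ X,
      -((2 ^ (-a) * Real.Gamma ((1 - a) / 2) / Real.Gamma ((1 + a) / 2)) •
        (z ^ a • deriv (fun ζ => extension Q B a φ X ζ) z)) =
      ∫ t in Ioi (0 : ℝ), neumannKernel s a z t • (semigroup Q B t φ X - φ X) := fun z hz X => by
    rw [(hasDerivAt_extension hK hs ha φ hz X).deriv, ← integral_smul, ← integral_smul,
      ← integral_neg]
    simp only [neumannKernel, smul_smul, neg_smul]
  have hdiffle : ∀ z : ℝ, 0 < z → ∀ t : ℝ, 0 < t →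
      |neumannKernel s a z t - -(s * g) * t ^ (-s - 1)| ≤
        (2 * g * (1 / 4) ^ θ) * z ^ (2 * θ) * t ^ (-1 - (s + θ)) := fun z hz t ht => by
    have hr : 0 < z ^ 2 / (4 * t) := by positivity
    have e1 : neumannKernel s a z t - -(s * g) * t ^ (-s - 1) = g * t ^ (-1 - s) *
        (s - Real.exp (-(z ^ 2 / (4 * t))) * (s - z ^ 2 / (4 * t))) := by
      rw [neumannKernel_eq hs hs1 ha hz ht, ← hg, show -s - 1 = -1 - s by ring]
      ring
    have e2 : (z ^ 2 / (4 * t)) ^ θ = (1 / 4) ^ θ * z ^ (2 * θ) * t ^ (-θ) := by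
      rw [show z ^ 2 / (4 * t) = 1 / 4 * z ^ (2 : ℝ) * t⁻¹ by
        rw [Real.rpow_two]; field_simp, Real.mul_rpow (by positivity) (by positivity),
        Real.mul_rpow (by positivity) (by positivity), ← Real.rpow_mul hz.le,
        Real.inv_rpow ht.le, Real.rpow_neg ht.le]
    have e3 : t ^ (-1 - (s + θ)) = t ^ (-1 - s) * t ^ (-θ) := by
      rw [← Real.rpow_add ht]
      congr 1
      ring
    rw [e1, abs_mul, abs_of_pos (by positivity : 0 < g * t ^ (-1 - s))]
    calc _ ≤ g * t ^ (-1 - s) * (2 * (z ^ 2 / (4 * t)) ^ θ) := by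
          gcongr
          exact abs_exp_mul_sub_le hs hs1 hr hθ0 (by rw [hθ]; linarith)
      _ = _ := by
          rw [e2, e3]
          ring
  have hfracLp : MemLp (fractionalPower Q B s φ) p volume := by
    rw [funext hfrac]
    exact (hC₁ _ (s * g) hk0m (by positivity) hk0le).1
  have hdiff : ∀ z : ℝ, 0 < z → ∀ X,
      -((2 ^ (-a) * Real.Gamma ((1 - a) / 2) / Real.Gamma ((1 + a) / 2)) •
        (z ^ a • deriv (fun ζ => extension Q B a φ X ζ) z)) - fractionalPower Q B s φ X =
      ∫ t in Ioi (0 : ℝ), (neumannKernel s a z t - -(s * g) * t ^ (-s - 1)) •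
        (semigroup Q B t φ X - φ X) := fun z hz X => by
    have i2 := integrableOn_smul_semigroup_sub hK φ hk0m hs hs1 hk0le X
    have i3 := integrableOn_smul_semigroup_sub hK φ (hkdm z)
      (show 0 < s + θ by linarith) (show s + θ < 1 by rw [hθ]; linarith) (hdiffle z hz) X
    rw [hneu z hz X, hfrac X, sub_eq_iff_eq_add, ← integral_add i3 i2]
    refine integral_congr_ae (Eventually.of_forall fun t => ?_)
    beta_reduce
    rw [← add_smul, sub_add_cancel]
  have key := fun (z : ℝ) (hz : 0 < z) => hC₂ _ ((2 * g * (1 / 4) ^ θ) * z ^ (2 * θ))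
    (hkdm z) (by positivity) (hdiffle z hz)
  refine ⟨fun z hz => ?_, hfracLp, ?_⟩
  · refine ((key z hz).1.add hfracLp).ae_eq (Eventually.of_forall fun X => ?_)
    simp only [Pi.add_apply]
    rw [← hdiff z hz X, sub_add_cancel]
  · refine tendsto_of_tendsto_of_tendsto_of_le_of_le' tendsto_const_nhds
      (tendsto_mul_ofReal_rpow hC₂t (2 * g * (1 / 4) ^ θ) (show 0 < 2 * θ by linarith))
      (Eventually.of_forall fun _ => zero_le) ?_
    filter_upwards [self_mem_nhdsWithin] with z hz
    simp_rw [hdiff z hz]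
    exact (key z hz).2

end Convergence

/-! ### Fourier representation of the semigroup and majorants for the extension -/

section FourierRepresentation

open scoped SchwartzMap RealInnerProductSpace FourierTransform

variable {N : ℕ} {Q B : Matrix (Fin N) (Fin N) ℝ}

theorem schwartz_eq_integral_fourier (φ : 𝓢(Space N, ℂ)) (Y : Space N) :
    φ Y = ∫ ξ, Complex.exp ((2 * Real.pi * ⟪ξ, Y⟫ : ℝ) * Complex.I) * 𝓕 φ ξ := by
  conv_lhs => rw [← FourierTransform.fourierInv_fourier_eq (F := 𝓢(Space N, ℂ)) φ]
  rw [SchwartzMap.fourierInv_coe, Real.fourierInv_eq']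
  simp only [smul_eq_mul]

theorem integral_cexp_inner_gauss (w : Space N) :
    ∫ y, Complex.exp ((2 * Real.pi * ⟪w, y⟫ : ℝ) * Complex.I) ∂gauss N =
      Complex.exp ((-(4 * Real.pi ^ 2) * ‖w‖ ^ 2 : ℝ)) := by
  have h := GaussianFourier.integral_cexp_neg_mul_sq_norm_add (V := Space N) (b := 1 / 4)
    (by norm_num) (2 * Real.pi * Complex.I) w
  rw [finrank_euclideanSpace_fin] at h
  rw [integral_gauss]
  have e : ∀ y : Space N, gaussDensity y • Complex.exp ((2 * Real.pi * ⟪w, y⟫ : ℝ) * Complex.I) =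
      ((4 * Real.pi) ^ (-(N : ℝ) / 2) : ℝ) *
        Complex.exp (-(1 / 4) * ‖y‖ ^ 2 + 2 * Real.pi * Complex.I * ⟪w, y⟫) := fun y => by
    rw [gaussDensity, Complex.real_smul, Complex.ofReal_mul, mul_assoc, Complex.ofReal_exp,
      ← Complex.exp_add]
    congr 2
    push_cast
    ring
  simp only [e]
  rw [integral_const_mul, h, ← mul_assoc]
  have e2 : (((4 * Real.pi) ^ (-(N : ℝ) / 2) : ℝ) : ℂ) * (Real.pi / (1 / 4)) ^ (N / 2 : ℂ) = 1 := by
    have : (Real.pi / (1 / 4) : ℂ) ^ (N / 2 : ℂ) = (((4 * Real.pi) ^ ((N : ℝ) / 2) : ℝ) : ℂ) := by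
      rw [Complex.ofReal_cpow (by positivity)]
      push_cast
      congr 1
      ring
    rw [this, ← Complex.ofReal_mul, ← Real.rpow_add (by positivity)]
    rw [show -(N : ℝ) / 2 + N / 2 = 0 by ring, Real.rpow_zero, Complex.ofReal_one]
  rw [e2, one_mul]
  congr 1
  push_cast
  rw [mul_pow, mul_pow, Complex.I_sq]
  ring

/-- The phase of the Fourier representation of the semigroup. -/
noncomputable def fourierPhase (Q B : Matrix (Fin N) (Fin N) ℝ) (X ξ : Space N) (t : ℝ) : ℂ :=
  (2 * Real.pi * ⟪flow Bᵀ t ξ, X⟫ : ℝ) * Complex.I - (4 * Real.pi ^ 2 * energy Q B t ξ : ℝ)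

/-- Fourier inversion is inserted into the Gaussian mean; after Fubini the y-integral is the
characteristic function of the Gaussian at R⋆ξ, and |R⋆ξ|² is the energy of ξ. -/
theorem semigroup_eq_integral_fourier (hK : ∀ t : ℝ, 0 < t → (covariance Q B t).PosDef) {t : ℝ}
    (ht : 0 < t) (φ : 𝓢(Space N, ℂ)) (X : Space N) :
    semigroup Q B t φ X = ∫ ξ, Complex.exp (fourierPhase Q B X ξ t) * 𝓕 φ ξ := by
  obtain ⟨R, hR, -, -, hsem⟩ := exists_gauss_representation (F := ℂ) hK ht
  rw [hsem]
  simp_rw [schwartz_eq_integral_fourier φ]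
  rw [integral_integral_swap]
  · refine integral_congr_ae (Eventually.of_forall fun ξ => ?_)
    have e : ∀ y, Complex.exp ((2 * Real.pi * ⟪ξ, flow B t X + R y⟫ : ℝ) * Complex.I) * 𝓕 φ ξ =
        (Complex.exp ((2 * Real.pi * ⟪ξ, flow B t X⟫ : ℝ) * Complex.I) * 𝓕 φ ξ) *
        Complex.exp ((2 * Real.pi * ⟪R.adjoint ξ, y⟫ : ℝ) * Complex.I) := fun y => by
      rw [mul_right_comm (Complex.exp _) (𝓕 φ ξ), ← Complex.exp_add, inner_add_right, R.adjoint_inner_left]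
      congr 2
      push_cast
      ring
    simp only [e]
    rw [integral_const_mul, integral_cexp_inner_gauss, mul_right_comm, ← Complex.exp_add]
    congr 2
    rw [fourierPhase, inner_flow_transpose, ← hR, inner_toEuclideanCLM,
      dotProduct_covariance_mulVec Q B ht.ne']
    push_cast
    ring
  · have hψ : Integrable (fun q : Space N × Space N => 𝓕 φ q.2) ((gauss N).prod volume) :=
      (𝓕 φ).integrable.comp_snd _
    refine hψ.mono (AEStronglyMeasurable.mul ?_ hψ.aestronglyMeasurable)
      (Eventually.of_forall fun q => ?_)
    · refine Continuous.aestronglyMeasurable ?_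
      fun_prop
    · simp only [Function.uncurry, norm_mul, Complex.norm_exp_ofReal_mul_I, one_mul, le_refl]

/-- The linear form whose exponential is integrated in the Fourier representation of the
extension. -/
noncomputable def phaseForm (η : Space N) (r : ℝ) : Space N × ℝ →L[ℝ] ℂ :=
  (2 * Real.pi * Complex.I) • (Complex.ofRealCLM.comp ((innerSL ℝ η).comp
    (ContinuousLinearMap.fst ℝ (Space N) ℝ))) -
    r • (Complex.ofRealCLM.comp (ContinuousLinearMap.snd ℝ (Space N) ℝ))

theorem phaseForm_apply (η : Space N) (r : ℝ) (x : Space N × ℝ) :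
    phaseForm η r x = (2 * Real.pi * ⟪η, x.1⟫ : ℝ) * Complex.I - (r * x.2 : ℝ) := by
  simp [phaseForm]
  ring

theorem re_phaseForm (η : Space N) (r : ℝ) (x : Space N × ℝ) :
    (phaseForm η r x).re = -(r * x.2) := by
  rw [phaseForm_apply, Complex.sub_re, Complex.re_ofReal_mul, Complex.I_re, Complex.ofReal_re]
  ring

theorem continuous_phaseForm : Continuous fun q : Space N × ℝ => phaseForm q.1 q.2 := by
  unfold phaseForm
  fun_prop

theorem norm_phaseForm_le (η : Space N) {r : ℝ} (hr : 0 ≤ r) :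
    ‖phaseForm η r‖ ≤ 2 * Real.pi * ‖η‖ + r := by
  refine ContinuousLinearMap.opNorm_le_bound _ (by positivity) fun x => ?_
  rw [phaseForm_apply]
  refine (norm_sub_le _ _).trans ?_
  rw [norm_mul, Complex.norm_I, mul_one, Complex.norm_real, Complex.norm_real, norm_mul (2 * Real.pi),
    norm_mul r, Real.norm_of_nonneg (by positivity : 0 ≤ 2 * Real.pi), Real.norm_of_nonneg hr, add_mul, mul_assoc,
    mul_assoc, mul_assoc]
  gcongr
  · calc ‖⟪η, x.1⟫‖ ≤ ‖η‖ * ‖x.1‖ := norm_inner_le_norm _ _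
      _ ≤ _ := by
        gcongr
        exact norm_fst_le x
  · exact norm_snd_le x

/-- From 1 + r ≤ e^r; the maximum of kr - br² is k²/(4b). -/
theorem one_add_pow_mul_exp_neg_le {b r : ℝ} (hb : 0 < b) (hr : 0 ≤ r) (k : ℕ) :
    (1 + r) ^ k * Real.exp (-(b * r ^ 2)) ≤ Real.exp (k ^ 2 / (4 * b)) := by
  calc (1 + r) ^ k * Real.exp (-(b * r ^ 2)) ≤ Real.exp r ^ k * Real.exp (-(b * r ^ 2)) := by
        gcongr
        linarith [Real.add_one_le_exp r]
    _ = Real.exp (k * r - b * r ^ 2) := by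
        rw [← Real.exp_nat_mul, ← Real.exp_add]
        congr 1
    _ ≤ _ := by
        gcongr
        rw [le_div_iff₀ (by positivity)]
        nlinarith [sq_nonneg (2 * b * r - k)]

/-- Each space derivative produces a factor e^{tBᵀ}ξ, possibly exponentially large in t. For t ≥ 1
the energy dominates c|e^{tBᵀ}ξ|² and the Gaussian factor wins; for t ≤ 1 the flow is bounded and
the loss is a power of |ξ|. -/
theorem exists_flow_pow_mul_exp_le (hQ : Q.PosSemidef)
    (hK : ∀ t : ℝ, 0 < t → (covariance Q B t).PosDef) (k : ℕ) :
    ∃ C > 0, ∀ t : ℝ, 0 < t → ∀ ξ : Space N, (1 + ‖flow Bᵀ t ξ‖) ^ k *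
      Real.exp (-(4 * Real.pi ^ 2 * energy Q B t ξ)) ≤ C * (1 + ‖ξ‖) ^ k := by
  obtain ⟨c, hc, hlow⟩ := exists_energy_lower_flow Q B hQ hK
  obtain ⟨L, hL⟩ := (isCompact_Icc (a := (0 : ℝ)) (b := 1)).exists_bound_of_continuousOn
    (continuous_flow Bᵀ).continuousOn
  refine ⟨Real.exp (k ^ 2 / (4 * (4 * Real.pi ^ 2 * c))) + (1 + |L|) ^ k, by positivity,
    fun t ht ξ => ?_⟩
  have hξ : 1 ≤ (1 + ‖ξ‖) ^ k := one_le_pow₀ (by linarith [norm_nonneg ξ])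
  rw [add_mul]
  rcases le_total 1 t with h | h
  · have h1 : (1 + ‖flow Bᵀ t ξ‖) ^ k * Real.exp (-(4 * Real.pi ^ 2 * energy Q B t ξ)) ≤
        Real.exp (k ^ 2 / (4 * (4 * Real.pi ^ 2 * c))) := by
      refine le_trans ?_ (one_add_pow_mul_exp_neg_le (b := 4 * Real.pi ^ 2 * c)
        (by positivity) (norm_nonneg (flow Bᵀ t ξ)) k)
      refine mul_le_mul_of_nonneg_left (Real.exp_le_exp.2 (neg_le_neg ?_)) (by positivity)
      rw [mul_assoc]
      exact mul_le_mul_of_nonneg_left (hlow t h ξ) (by positivity)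
    calc _ ≤ Real.exp (k ^ 2 / (4 * (4 * Real.pi ^ 2 * c))) := h1
      _ ≤ Real.exp (k ^ 2 / (4 * (4 * Real.pi ^ 2 * c))) * (1 + ‖ξ‖) ^ k :=
        le_mul_of_one_le_right (Real.exp_pos _).le hξ
      _ ≤ _ := le_add_of_nonneg_right (by positivity)
  · have h1 : 1 + ‖flow Bᵀ t ξ‖ ≤ (1 + |L|) * (1 + ‖ξ‖) := by
      have := (flow Bᵀ t).le_of_opNorm_le ((hL t ⟨ht.le, h⟩).trans (le_abs_self L)) ξ
      nlinarith [norm_nonneg ξ, abs_nonneg L]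
    have h2 : Real.exp (-(4 * Real.pi ^ 2 * energy Q B t ξ)) ≤ 1 := by
      rw [Real.exp_le_one_iff]
      have := energy_nonneg Q B hQ ht.le ξ
      have : 0 ≤ 4 * Real.pi ^ 2 * energy Q B t ξ := by positivity
      linarith
    calc _ ≤ ((1 + |L|) * (1 + ‖ξ‖)) ^ k * 1 := by gcongr
      _ = (1 + |L|) ^ k * (1 + ‖ξ‖) ^ k := by rw [mul_one, mul_pow]
      _ ≤ _ := le_add_of_nonneg_left (by positivity)

theorem integrableOn_one_add_inv_pow_mul {r b : ℝ} (hr : 1 < r) (hb : 0 < b) (k : ℕ) :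
    IntegrableOn (fun t : ℝ => (1 + t⁻¹) ^ k * (t ^ (-r) * Real.exp (-b / t))) (Ioi 0) := by
  have h := ((integrableOn_rpow_neg_mul_exp_neg_div hr hb).add
    (integrableOn_rpow_neg_mul_exp_neg_div (r := r + k) (by have := Nat.cast_nonneg (α := ℝ) k; linarith) hb)).const_mul
      (2 ^ (k - 1))
  refine h.mono' (by fun_prop) ?_
  filter_upwards [ae_restrict_mem measurableSet_Ioi] with t (ht : 0 < t)
  rw [Real.norm_of_nonneg (by positivity)]
  calc (1 + t⁻¹) ^ k * (t ^ (-r) * Real.exp (-b / t))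
      ≤ (2 ^ (k - 1) * (1 ^ k + t⁻¹ ^ k)) * (t ^ (-r) * Real.exp (-b / t)) := by
        gcongr
        exact add_pow_le zero_le_one (by positivity) k
    _ = _ := by
        simp only [Pi.add_apply]
        rw [show -(r + k) = -r + -k by ring, Real.rpow_add ht, Real.rpow_neg ht.le k,
          Real.rpow_natCast, inv_pow]
        ring

theorem integrable_one_add_norm_pow_mul (ψ : 𝓢(Space N, ℂ)) (k : ℕ) :
    Integrable fun ξ => (1 + ‖ξ‖) ^ k * ‖ψ ξ‖ := by
  have h := ((ψ.integrable_pow_mul volume 0).add (ψ.integrable_pow_mul volume k)).const_mul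
    (2 ^ (k - 1))
  refine h.mono' ((Continuous.aestronglyMeasurable (by fun_prop))) (Eventually.of_forall fun ξ => ?_)
  rw [Real.norm_of_nonneg (by positivity)]
  calc (1 + ‖ξ‖) ^ k * ‖ψ ξ‖ ≤ (2 ^ (k - 1) * (1 ^ k + ‖ξ‖ ^ k)) * ‖ψ ξ‖ := by
        gcongr
        exact add_pow_le zero_le_one (norm_nonneg _) k
    _ = _ := by
        simp only [Pi.add_apply]
        ring

/-- The amplitude in the Fourier representation of the extension. -/
noncomputable def amplitude (Q B : Matrix (Fin N) (Fin N) ℝ) (s : ℝ) (ψ : 𝓢(Space N, ℂ))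
    (τ : ℝ × Space N) : ℂ :=
  (τ.1 ^ (-(1 + s)) * Real.exp (-(4 * Real.pi ^ 2 * energy Q B τ.1 τ.2)) : ℝ) * ψ τ.2

/-- The linear forms in the Fourier representation of the extension. -/
noncomputable def extensionForm (B : Matrix (Fin N) (Fin N) ℝ) (τ : ℝ × Space N) :
    Space N × ℝ →L[ℝ] ℂ :=
  phaseForm (flow Bᵀ τ.1 τ.2) (4 * τ.1)⁻¹

/-- The measure in the Fourier representation of the extension. -/
noncomputable def extensionMeasure (N : ℕ) : Measure (ℝ × Space N) :=
  (volume.restrict (Ioi 0)).prod volume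

theorem aestronglyMeasurable_extensionForm :
    AEStronglyMeasurable (extensionForm B) (extensionMeasure N) := by
  have hf : Continuous fun τ : ℝ × Space N => flow Bᵀ τ.1 τ.2 :=
    ((continuous_flow Bᵀ).comp continuous_fst).clm_apply continuous_snd
  have hm : Measurable fun τ : ℝ × Space N => (flow Bᵀ τ.1 τ.2, (4 * τ.1)⁻¹) :=
    hf.measurable.prodMk (by fun_prop)
  exact (continuous_phaseForm.comp_stronglyMeasurable hm.stronglyMeasurable).aestronglyMeasurable

theorem continuous_energy : Continuous fun τ : ℝ × Space N => energy Q B τ.1 τ.2 := by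
  refine intervalIntegral.continuous_parametric_intervalIntegral_of_continuous (f := fun
    (τ : ℝ × Space N) r => form Q (flow Bᵀ r τ.2)) ?_ continuous_fst
  have hf : Continuous fun q : (ℝ × Space N) × ℝ => flow Bᵀ q.2 q.1.2 :=
    ((continuous_flow Bᵀ).comp continuous_snd).clm_apply (by fun_prop)
  exact (continuous_form Q).comp hf

theorem ae_extensionMeasure_pos : ∀ᵐ τ ∂extensionMeasure N, 0 < τ.1 := by
  have h : ∀ᵐ t : ℝ ∂volume.restrict (Ioi 0), 0 < t := ae_restrict_mem measurableSet_Ioi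
  exact Measure.quasiMeasurePreserving_fst.ae h

/-- On the neighbourhood y > x.2/2 the factor e^{-y/(4t)} is at most e^{-x.2/(8t)}, which controls
all powers of 1/t at t = 0. The bound uniform in t on the flow factor then splits the majorant into
a product of a function of t and a function of ξ. -/
theorem expMajorized_amplitude (hQ : Q.PosSemidef)
    (hK : ∀ t : ℝ, 0 < t → (covariance Q B t).PosDef) {s : ℝ} (hs : 0 < s) (ψ : 𝓢(Space N, ℂ)) :
    ExpMajorized (extensionMeasure N) (extensionForm B) (univ ×ˢ Ioi 0) (amplitude Q B s ψ) where
  aestronglyMeasurable := by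
    refine AEStronglyMeasurable.mul ?_ (ψ.continuous.comp continuous_snd).aestronglyMeasurable
    refine Measurable.aestronglyMeasurable ?_
    have := (continuous_energy (Q := Q) (B := B)).measurable
    fun_prop
  exists_majorant x hx := by
    have hx2 : 0 < x.2 := hx.2
    refine ⟨univ ×ˢ Ioi (x.2 / 2), prod_mem_nhds univ_mem (Ioi_mem_nhds (by linarith)),
      fun τ => -(x.2 / 8) / τ.1, ?_, fun k => ?_⟩
    · filter_upwards [ae_extensionMeasure_pos] with τ hτ y hy
      have hy2 : x.2 / 2 < y.2 := hy.2
      rw [extensionForm, re_phaseForm, neg_div, neg_le_neg_iff, div_eq_inv_mul, mul_inv]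
      have : 0 < τ.1⁻¹ := by positivity
      nlinarith
    · obtain ⟨C, hC, hle⟩ := exists_flow_pow_mul_exp_le hQ hK k
      refine ⟨fun τ => ((2 * Real.pi) ^ k * C) *
        (((1 + τ.1⁻¹) ^ k * (τ.1 ^ (-(1 + s)) * Real.exp (-(x.2 / 8) / τ.1))) *
          ((1 + ‖τ.2‖) ^ k * ‖ψ τ.2‖)), ?_, ?_⟩
      · exact ((integrableOn_one_add_inv_pow_mul (by linarith) (by linarith) k).mul_prod
          (integrable_one_add_norm_pow_mul ψ k)).const_mul _
      · filter_upwards [ae_extensionMeasure_pos] with τ hτ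
        have hl : ‖extensionForm B τ‖ ≤
            2 * Real.pi * ((1 + ‖flow Bᵀ τ.1 τ.2‖) * (1 + τ.1⁻¹)) := by
          refine (norm_phaseForm_le _ (by positivity)).trans ?_
          rw [mul_inv]
          have h1 : 0 < τ.1⁻¹ := by positivity
          have h2 := norm_nonneg (flow Bᵀ τ.1 τ.2)
          have h3 := Real.pi_gt_three
          have h4 := mul_nonneg h2 h1.le
          nlinarith [mul_pos (Real.pi_pos) h1, mul_nonneg Real.pi_pos.le h4]
        rw [amplitude, norm_mul, Complex.norm_real, Real.norm_of_nonneg (by positivity)]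
        calc _ ≤ Real.exp (-(x.2 / 8) / τ.1) *
              (2 * Real.pi * ((1 + ‖flow Bᵀ τ.1 τ.2‖) * (1 + τ.1⁻¹))) ^ k *
              (τ.1 ^ (-(1 + s)) * Real.exp (-(4 * Real.pi ^ 2 * energy Q B τ.1 τ.2)) *
                ‖ψ τ.2‖) := by gcongr
          _ = (2 * Real.pi) ^ k * ((1 + τ.1⁻¹) ^ k *
              (τ.1 ^ (-(1 + s)) * Real.exp (-(x.2 / 8) / τ.1))) * ‖ψ τ.2‖ *
              ((1 + ‖flow Bᵀ τ.1 τ.2‖) ^ k *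
                Real.exp (-(4 * Real.pi ^ 2 * energy Q B τ.1 τ.2))) := by
            rw [mul_pow (2 * Real.pi), mul_pow (1 + _)]
            ring
          _ ≤ (2 * Real.pi) ^ k * ((1 + τ.1⁻¹) ^ k *
              (τ.1 ^ (-(1 + s)) * Real.exp (-(x.2 / 8) / τ.1))) * ‖ψ τ.2‖ *
              (C * (1 + ‖τ.2‖) ^ k) := by
            exact mul_le_mul_of_nonneg_left (hle τ.1 hτ τ.2) (by positivity)
          _ = _ := by ring

end FourierRepresentation

/-! ### The extension equation and smoothness for complex data -/

section Equation

open scoped SchwartzMap RealInnerProductSpace FourierTransform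

variable {N : ℕ} {Q B : Matrix (Fin N) (Fin N) ℝ}

/-- The Bessel operator applied to `z ^ (2 s) v(z ^ 2)`. -/
theorem besselOperator_eq {F : Type*} [NormedAddCommGroup F] [NormedSpace ℝ F] {s a : ℝ}
    (ha : a = 1 - 2 * s) {u v₀ v₁ v₂ : ℝ → F} (hu : ∀ ζ, 0 < ζ → u ζ = ζ ^ (2 * s) • v₀ ζ)
    (h₀ : ∀ ζ, 0 < ζ → HasDerivAt v₀ ((2 * ζ) • v₁ ζ) ζ)
    (h₁ : ∀ ζ, 0 < ζ → HasDerivAt v₁ ((2 * ζ) • v₂ ζ) ζ) {z : ℝ} (hz : 0 < z) :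
    besselOperator a u z = z ^ (2 * s) • ((4 * s + 4) • v₁ z + (4 * z ^ 2) • v₂ z) := by
  have hpow : ∀ ζ : ℝ, 0 < ζ → HasDerivAt (fun ζ : ℝ => ζ ^ (2 * s)) (ζ ^ (2 * s) * (2 * s / ζ)) ζ :=
    fun ζ hζ => by
      refine (Real.hasDerivAt_rpow_const (Or.inl hζ.ne')).congr_deriv ?_
      rw [Real.rpow_sub hζ, Real.rpow_one]
      ring
  have hd : ∀ ζ, 0 < ζ →
      deriv u ζ = ζ ^ (2 * s) • ((2 * s / ζ) • v₀ ζ + (2 * ζ) • v₁ ζ) := fun ζ hζ => by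
    have e : u =ᶠ[𝓝 ζ] fun ζ => ζ ^ (2 * s) • v₀ ζ := by
      filter_upwards [lt_mem_nhds hζ] with r hr using hu r hr
    rw [e.deriv_eq, ((hpow ζ hζ).fun_smul (h₀ ζ hζ)).deriv]
    module
  have e : deriv u =ᶠ[𝓝 z]
      fun ζ => ζ ^ (2 * s) • ((2 * s / ζ) • v₀ ζ + (2 * ζ) • v₁ ζ) := by
    filter_upwards [lt_mem_nhds hz] with r hr using hd r hr
  have hdiv : HasDerivAt (fun ζ : ℝ => 2 * s / ζ) (-(2 * s) / z ^ 2) z := by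
    refine ((hasDerivAt_inv hz.ne').const_mul (2 * s)).congr_deriv ?_
    ring
  have h2 : HasDerivAt (fun ζ : ℝ => 2 * ζ) 2 z := by
    simpa using (hasDerivAt_id z).const_mul (2 : ℝ)
  rw [besselOperator, e.deriv_eq, hd z hz,
    ((hpow z hz).fun_smul ((hdiv.fun_smul (h₀ z hz)).fun_add (h2.fun_smul (h₁ z hz)))).deriv, ha]
  -- Here v₁ and v₂ are derivatives in the variable z². The coefficient of v₀ is 2s(2s - 1 + a)/z² =
  -- 0, so the singular terms disappear.
  match_scalars <;> field_simp <;> ring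

/-- The integrals in the Fourier representation of the extension. -/
noncomputable def fourierExtension (B : Matrix (Fin N) (Fin N) ℝ) (g : ℝ × Space N → ℂ)
    (x : Space N × ℝ) : ℂ :=
  ∫ τ, Complex.exp (extensionForm B τ x) * g τ ∂extensionMeasure N

theorem extensionForm_space (τ : ℝ × Space N) (v : Space N) :
    extensionForm B τ (v, 0) = (2 * Real.pi * ⟪flow Bᵀ τ.1 τ.2, v⟫ : ℝ) * Complex.I := by
  simp [extensionForm, phaseForm_apply]

theorem extensionForm_time (τ : ℝ × Space N) :
    extensionForm B τ (0, 1) = ((-(4 * τ.1)⁻¹ : ℝ) : ℂ) := by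
  simp [extensionForm, phaseForm_apply]

variable {g : ℝ × Space N → ℂ}

theorem partialDeriv_fourierExtension
    (hg : ExpMajorized (extensionMeasure N) (extensionForm B) (univ ×ˢ Ioi 0) g) (C : ℝ) (i : Fin N)
    (X : Space N) {y : ℝ} (hy : 0 < y) :
    partialDeriv i (fun X' => C • fourierExtension B g (X', y)) X =
      C • fourierExtension B
        (fun τ => extensionForm B τ (EuclideanSpace.single i 1, 0) * g τ) (X, y) := by
  obtain ⟨D, hD, hv⟩ := hg.hasFDerivAt aestronglyMeasurable_extensionForm
    (x := (X, y)) ⟨mem_univ _, hy⟩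
  have h1 : HasFDerivAt (fun X' : Space N => (X', y)) (ContinuousLinearMap.inl ℝ (Space N) ℝ) X :=
    hasFDerivAt_prodMk_left X y
  have h2 := (hD.comp X h1).const_smul C
  rw [partialDeriv]
  erw [h2.fderiv]
  simp only [smul_apply, ContinuousLinearMap.comp_apply,
    ContinuousLinearMap.inl_apply, hv]
  rfl

theorem hasDerivAt_fourierExtension
    (hg : ExpMajorized (extensionMeasure N) (extensionForm B) (univ ×ˢ Ioi 0) g)
    (X : Space N) {z : ℝ} (hz : 0 < z) :
    HasDerivAt (fun ζ : ℝ => fourierExtension B g (X, ζ ^ 2))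
      ((2 * z) • fourierExtension B (fun τ => extensionForm B τ (0, 1) * g τ) (X, z ^ 2)) z := by
  obtain ⟨D, hD, hv⟩ := hg.hasFDerivAt aestronglyMeasurable_extensionForm
    (x := (X, z ^ 2)) ⟨mem_univ _, show 0 < z ^ 2 by positivity⟩
  have h1 : HasDerivAt (fun ζ : ℝ => (X, ζ ^ 2)) ((0 : Space N), 2 * z) z := by
    refine (hasDerivAt_const z X).prodMk ?_
    simpa using hasDerivAt_pow 2 z
  have h2 := hD.comp_hasDerivAt z h1
  have e : ((0 : Space N), 2 * z) = (2 * z) • ((0 : Space N), (1 : ℝ)) := by simp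
  rw [e, map_smul, hv] at h2
  exact h2

/-- The second variable is y = z², because -z²/(4t) is then linear in it, like the phase in X. -/
theorem extension_eq_fourierExtension (hQ : Q.PosSemidef)
    (hK : ∀ t : ℝ, 0 < t → (covariance Q B t).PosDef) {s a : ℝ} (hs : 0 < s)
    (ha : a = 1 - 2 * s) (φ : 𝓢(Space N, ℂ)) (X : Space N) {z : ℝ} (hz : 0 < z) :
    extension Q B a φ X z = (1 / (2 ^ (2 * s) * Real.Gamma s) * z ^ (2 * s)) •
      fourierExtension B (amplitude Q B s (𝓕 φ)) (X, z ^ 2) := by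
  obtain ⟨K, hb⟩ := exists_norm_le φ
  rw [(extension_eq hK hs ha hz φ.continuous.stronglyMeasurable hb X).2, fourierExtension,
    extensionMeasure, integral_prod _ ((expMajorized_amplitude hQ hK hs (𝓕 φ)).integrable
      aestronglyMeasurable_extensionForm (x := (X, z ^ 2)) ⟨mem_univ _, show 0 < z ^ 2 by positivity⟩),
    ← integral_smul]
  refine setIntegral_congr_fun measurableSet_Ioi fun t (ht : 0 < t) => ?_
  rw [semigroup_eq_integral_fourier hK ht, weight_eq ht, mul_smul, ← integral_smul]
  congr 1
  refine integral_congr_ae (Eventually.of_forall fun ξ => ?_)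
  simp only [amplitude, extensionForm, phaseForm_apply, fourierPhase]
  rw [Complex.real_smul]
  push_cast
  rw [sub_eq_add_neg, Complex.exp_add, sub_eq_add_neg, Complex.exp_add,
    show (-((4 * (t : ℂ))⁻¹ * (z : ℂ) ^ 2)) = -((z : ℂ) ^ 2 / 4) / t by field_simp]
  ring

theorem hasDerivAt_fourierPhase (X ξ : Space N) (t : ℝ) :
    HasDerivAt (fourierPhase Q B X ξ)
      ((2 * Real.pi * ⟪flow Bᵀ t ξ, Matrix.toEuclideanCLM (𝕜 := ℝ) B X⟫ : ℝ) * Complex.I -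
        (4 * Real.pi ^ 2 * form Q (flow Bᵀ t ξ) : ℝ)) t := by
  have h1 := ((hasDerivAt_flow_apply Bᵀ ξ t).inner ℝ (hasDerivAt_const t X)).const_mul
    (2 * Real.pi)
  have e : ⟪flow Bᵀ t ξ, (0 : Space N)⟫ + ⟪Matrix.toEuclideanCLM (𝕜 := ℝ) Bᵀ (flow Bᵀ t ξ), X⟫ =
      ⟪flow Bᵀ t ξ, Matrix.toEuclideanCLM (𝕜 := ℝ) B X⟫ := by
    rw [inner_zero_right, zero_add, real_inner_comm, inner_toEuclideanCLM, inner_toEuclideanCLM,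
      Matrix.mulVec_transpose, dotProduct_comm, ← Matrix.dotProduct_mulVec]
  rw [e] at h1
  exact (h1.ofReal_comp.mul_const Complex.I).sub
    (((hasDerivAt_energy Q B ξ t).const_mul (4 * Real.pi ^ 2)).ofReal_comp)

theorem norm_exp_fourierPhase_le (hQ : Q.PosSemidef) (X ξ : Space N) {t : ℝ} (ht : 0 ≤ t) :
    ‖Complex.exp (fourierPhase Q B X ξ t)‖ ≤ 1 := by
  rw [Complex.norm_exp, Real.exp_le_one_iff, fourierPhase, Complex.sub_re, Complex.re_ofReal_mul,
    Complex.I_re, Complex.ofReal_re, mul_zero, zero_sub, neg_nonpos]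
  have := energy_nonneg Q B hQ ht ξ
  positivity

/-- The symbol of the extension operator in the Fourier representation. -/
noncomputable def extensionSymbol (Q B : Matrix (Fin N) (Fin N) ℝ) (s z : ℝ) (X : Space N)
    (τ : ℝ × Space N) : ℂ :=
  (2 * Real.pi * ⟪flow Bᵀ τ.1 τ.2, Matrix.toEuclideanCLM (𝕜 := ℝ) B X⟫ : ℝ) * Complex.I -
    (4 * Real.pi ^ 2 * form Q (flow Bᵀ τ.1 τ.2) : ℝ) +
      (-(1 + s) / τ.1 + z ^ 2 / 4 / τ.1 ^ 2 : ℝ)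

/-- On each frequency the equation says that the integrand is a total derivative in time. -/
theorem integral_time_extensionSymbol (hQ : Q.PosSemidef) {s z : ℝ} (hs : 0 < s) (hz : 0 < z)
    (X ξ : Space N) :
    ∫ t in Ioi (0 : ℝ), ((t ^ (-(1 + s)) * Real.exp (-(z ^ 2 / 4) / t) : ℝ) *
      Complex.exp (fourierPhase Q B X ξ t)) * extensionSymbol Q B s z X (t, ξ) = 0 := by
  set f : ℝ → ℂ := fun t => (t ^ (-(1 + s)) * Real.exp (-(z ^ 2 / 4) / t) : ℝ) *
    Complex.exp (fourierPhase Q B X ξ t) with hf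
  -- If the integrand is not integrable, its integral is 0 by convention and nothing remains to be
  -- shown.
  by_cases hint : IntegrableOn (fun t => f t * extensionSymbol Q B s z X (t, ξ)) (Ioi 0)
  swap
  · exact integral_undef hint
  have hz2 : 0 < z ^ 2 / 4 := by positivity
  -- The real power 0^{-(1+s)} is 0 by convention, which agrees with the limit of f at 0⁺ and makes
  -- f continuous there from the right.
  have hf0 : f 0 = 0 := by
    simp only [hf]
    rw [Real.zero_rpow (by linarith), zero_mul, Complex.ofReal_zero, zero_mul]
  have hle : ∀ t : ℝ, 0 < t → ‖f t‖ ≤ t ^ (-(1 + s)) * Real.exp (-(z ^ 2 / 4) / t) :=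
    fun t ht => by
      rw [hf, norm_mul, Complex.norm_real, Real.norm_of_nonneg (by positivity)]
      exact mul_le_of_le_one_right (by positivity) (norm_exp_fourierPhase_le hQ X ξ ht.le)
  have htop : Tendsto f atTop (𝓝 0) := by
    refine squeeze_zero_norm' ?_ (tendsto_rpow_neg_mul_exp_neg_div_atTop (r := 1 + s)
      (b := z ^ 2 / 4) (by linarith))
    filter_upwards [eventually_gt_atTop 0] with t ht using hle t ht
  have hzero : Tendsto f (𝓝[>] 0) (𝓝 0) := by
    refine squeeze_zero_norm' ?_ (tendsto_rpow_neg_mul_exp_neg_div_nhdsGT (r := 1 + s) hz2)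
    filter_upwards [self_mem_nhdsWithin] with t ht using hle t ht
  have hcont : ContinuousWithinAt f (Ici 0) 0 := by
    rw [← continuousWithinAt_Ioi_iff_Ici, ContinuousWithinAt, hf0]
    exact hzero
  have hder : ∀ t ∈ Ioi (0 : ℝ), HasDerivAt f (f t * extensionSymbol Q B s z X (t, ξ)) t := by
    intro t (ht : 0 < t)
    have h1 : HasDerivAt (fun t : ℝ => t ^ (-(1 + s)) * Real.exp (-(z ^ 2 / 4) / t))
        ((t ^ (-(1 + s)) * Real.exp (-(z ^ 2 / 4) / t)) *
          (-(1 + s) / t + z ^ 2 / 4 / t ^ 2)) t := by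
      have h2 : HasDerivAt (fun t : ℝ => -(z ^ 2 / 4) / t) (z ^ 2 / 4 / t ^ 2) t := by
        refine ((hasDerivAt_inv ht.ne').const_mul (-(z ^ 2 / 4))).congr_deriv ?_
        ring
      refine ((Real.hasDerivAt_rpow_const (p := -(1 + s)) (Or.inl ht.ne')).fun_mul
        h2.exp).congr_deriv ?_
      rw [Real.rpow_sub ht, Real.rpow_one]
      ring
    refine (h1.ofReal_comp.fun_mul (hasDerivAt_fourierPhase X ξ t).cexp).congr_deriv ?_
    simp only [hf, extensionSymbol]
    push_cast
    ring
  rw [integral_Ioi_of_hasDerivAt_of_tendsto hcont hder hint htop, hf0, sub_zero]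

/-- Fubini with the time integral inside, which vanishes for each frequency ξ. -/
theorem fourierExtension_extensionSymbol (hQ : Q.PosSemidef) {s z : ℝ} (hs : 0 < s) (hz : 0 < z)
    (X : Space N) (ψ : 𝓢(Space N, ℂ))
    (hint : Integrable (fun τ => Complex.exp (extensionForm B τ (X, z ^ 2)) *
      (extensionSymbol Q B s z X τ * amplitude Q B s ψ τ)) (extensionMeasure N)) :
    fourierExtension B (fun τ => extensionSymbol Q B s z X τ * amplitude Q B s ψ τ) (X, z ^ 2) =
      0 := by
  rw [fourierExtension, extensionMeasure, integral_prod_symm _ hint]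
  refine integral_eq_zero_of_ae (Eventually.of_forall fun ξ => ?_)
  have e : ∀ t ∈ Ioi (0 : ℝ), Complex.exp (extensionForm B (t, ξ) (X, z ^ 2)) *
      (extensionSymbol Q B s z X (t, ξ) * amplitude Q B s ψ (t, ξ)) =
      ψ ξ * (((t ^ (-(1 + s)) * Real.exp (-(z ^ 2 / 4) / t) : ℝ) *
      Complex.exp (fourierPhase Q B X ξ t)) * extensionSymbol Q B s z X (t, ξ)) := by
    intro t (ht : 0 < t)
    simp only [amplitude, extensionForm, phaseForm_apply, fourierPhase]
    push_cast
    rw [sub_eq_add_neg, Complex.exp_add, sub_eq_add_neg, Complex.exp_add,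
      show (-((4 * (t : ℂ))⁻¹ * (z : ℂ) ^ 2)) = -((z : ℂ) ^ 2 / 4) / t by field_simp]
    ring
  beta_reduce
  rw [Pi.zero_apply, setIntegral_congr_fun measurableSet_Ioi e, integral_const_mul,
    integral_time_extensionSymbol hQ hs hz, mul_zero]

theorem extensionForm_single (τ : ℝ × Space N) (i : Fin N) :
    extensionForm B τ (EuclideanSpace.single i 1, 0) =
      (2 * Real.pi * (flow Bᵀ τ.1 τ.2) i : ℝ) * Complex.I := by
  rw [extensionForm_space, EuclideanSpace.inner_single_right]
  simp

/-- Matches the logarithmic time derivative with the differential operator: space derivatives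
contribute 2πi e^{tBᵀ}ξ, and with ∂_y ↔ -1/(4t) the Bessel part gives -(1+s)/t + z²/(4t²). -/
theorem extensionSymbol_eq (s z : ℝ) (X : Space N) (τ : ℝ × Space N) :
    extensionSymbol Q B s z X τ =
      ((∑ i, ∑ j, Q i j • (extensionForm B τ (EuclideanSpace.single j 1, 0) *
        extensionForm B τ (EuclideanSpace.single i 1, 0))) +
      ∑ i, (B *ᵥ X.ofLp) i • extensionForm B τ (EuclideanSpace.single i 1, 0)) +
      ((4 * s + 4) • extensionForm B τ (0, 1) +
        (4 * z ^ 2) • (extensionForm B τ (0, 1) * extensionForm B τ (0, 1))) := by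
  simp only [extensionForm_single, extensionForm_time, Complex.real_smul]
  rw [extensionSymbol]
  congr 1
  · rw [inner_toEuclideanCLM, form, inner_toEuclideanCLM]
    simp only [dotProduct, Matrix.mulVec, Finset.mul_sum, Finset.sum_mul, Complex.ofReal_sum]
    rw [sub_eq_add_neg, add_comm, ← Finset.sum_neg_distrib]
    congr 1
    · refine Finset.sum_congr rfl fun i _ => ?_
      rw [← Finset.sum_neg_distrib]
      refine Finset.sum_congr rfl fun j _ => ?_
      push_cast
      linear_combination (-4 * Real.pi ^ 2 * (flow Bᵀ τ.1 τ.2) i * Q i j * (flow Bᵀ τ.1 τ.2) j : ℂ)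
        * Complex.I_sq
    · refine Finset.sum_congr rfl fun i _ => ?_
      refine Finset.sum_congr rfl fun j _ => ?_
      push_cast
      ring
  · push_cast
    rw [mul_inv, div_eq_mul_inv, div_eq_mul_inv _ ((τ.1 : ℂ) ^ 2)]
    ring

theorem sum_fourierExtension {s z : ℝ} (hz : 0 < z) (X : Space N)
    (hg : ExpMajorized (extensionMeasure N) (extensionForm B) (univ ×ˢ Ioi 0) g) :
    Integrable (fun τ => Complex.exp (extensionForm B τ (X, z ^ 2)) *
      (extensionSymbol Q B s z X τ * g τ)) (extensionMeasure N) ∧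
    ((∑ i, ∑ j, Q i j • fourierExtension B (fun τ =>
        extensionForm B τ (EuclideanSpace.single j 1, 0) *
          (extensionForm B τ (EuclideanSpace.single i 1, 0) * g τ)) (X, z ^ 2)) +
      ∑ i, (B *ᵥ X.ofLp) i • fourierExtension B (fun τ =>
        extensionForm B τ (EuclideanSpace.single i 1, 0) * g τ) (X, z ^ 2)) +
      ((4 * s + 4) • fourierExtension B (fun τ => extensionForm B τ (0, 1) * g τ) (X, z ^ 2) +
        (4 * z ^ 2) • fourierExtension B (fun τ => extensionForm B τ (0, 1) *
          (extensionForm B τ (0, 1) * g τ)) (X, z ^ 2)) =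
    fourierExtension B (fun τ => extensionSymbol Q B s z X τ * g τ) (X, z ^ 2) := by
  have hl := aestronglyMeasurable_extensionForm (B := B)
  have hx : ((X, z ^ 2) : Space N × ℝ) ∈ (univ : Set (Space N)) ×ˢ Ioi (0 : ℝ) :=
    ⟨mem_univ _, show 0 < z ^ 2 by positivity⟩
  have h1 : ∀ v, Integrable (fun τ => Complex.exp (extensionForm B τ (X, z ^ 2)) *
      (extensionForm B τ v * g τ)) (extensionMeasure N) := fun v =>
    (hg.apply_mul hl v).integrable hl hx
  have h2 : ∀ v w, Integrable (fun τ => Complex.exp (extensionForm B τ (X, z ^ 2)) *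
      (extensionForm B τ w * (extensionForm B τ v * g τ))) (extensionMeasure N) := fun v w =>
    ((hg.apply_mul hl v).apply_mul hl w).integrable hl hx
  have iA := integrable_finsetSum (Finset.univ : Finset (Fin N)) fun i _ =>
    integrable_finsetSum (Finset.univ : Finset (Fin N)) fun j _ =>
      (h2 (EuclideanSpace.single i 1, 0) (EuclideanSpace.single j 1, 0)).smul (Q i j)
  have iB := integrable_finsetSum (Finset.univ : Finset (Fin N)) fun i _ =>
    (h1 (EuclideanSpace.single i 1, 0)).smul ((B *ᵥ X.ofLp) i)
  have iC := (h1 (0, 1)).smul (4 * s + 4)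
  have iD := (h2 (0, 1) (0, 1)).smul (4 * z ^ 2)
  have e : (fun τ => Complex.exp (extensionForm B τ (X, z ^ 2)) *
      (extensionSymbol Q B s z X τ * g τ)) = fun τ =>
      ((∑ i, ∑ j, Q i j • (Complex.exp (extensionForm B τ (X, z ^ 2)) *
        (extensionForm B τ (EuclideanSpace.single j 1, 0) *
          (extensionForm B τ (EuclideanSpace.single i 1, 0) * g τ)))) +
      ∑ i, (B *ᵥ X.ofLp) i • (Complex.exp (extensionForm B τ (X, z ^ 2)) *
        (extensionForm B τ (EuclideanSpace.single i 1, 0) * g τ))) +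
      ((4 * s + 4) • (Complex.exp (extensionForm B τ (X, z ^ 2)) *
        (extensionForm B τ (0, 1) * g τ)) +
        (4 * z ^ 2) • (Complex.exp (extensionForm B τ (X, z ^ 2)) *
        (extensionForm B τ (0, 1) * (extensionForm B τ (0, 1) * g τ)))) := by
    funext τ
    rw [extensionSymbol_eq]
    simp only [add_mul, mul_add, Finset.sum_mul, Finset.mul_sum, Complex.real_smul]
    congr 1
    · congr 1
      · refine Finset.sum_congr rfl fun i _ => Finset.sum_congr rfl fun j _ => ?_
        ring
      · refine Finset.sum_congr rfl fun i _ => ?_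
        ring
    · ring
  refine ⟨?_, ?_⟩
  · rw [e]
    exact (iA.add iB).add (iC.add iD)
  · simp only [fourierExtension]
    rw [e]
    erw [integral_add (iA.add iB) (iC.add iD), integral_add iA iB, integral_add iC iD]
    rw [integral_finsetSum _ fun i _ => integrable_finsetSum _ fun j _ =>
      (h2 (EuclideanSpace.single i 1, 0) (EuclideanSpace.single j 1, 0)).smul (Q i j),
      integral_finsetSum _ fun i _ => (h1 (EuclideanSpace.single i 1, 0)).smul ((B *ᵥ X.ofLp) i)]
    simp only [← integral_smul]
    congr 2
    refine Finset.sum_congr rfl fun i _ => ?_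
    rw [integral_finsetSum _ fun j _ =>
      (h2 (EuclideanSpace.single i 1, 0) (EuclideanSpace.single j 1, 0)).smul (Q i j)]
    rfl

/-- The extension solves the equation. -/
theorem extensionOperator_extension_complex (hQ : Q.PosSemidef)
    (hK : ∀ t : ℝ, 0 < t → (covariance Q B t).PosDef) {s a : ℝ} (hs : 0 < s)
    (ha : a = 1 - 2 * s) (φ : 𝓢(Space N, ℂ)) (X : Space N) {z : ℝ} (hz : 0 < z) :
    extensionOperator Q B a (extension Q B a φ) X z = 0 := by
  have hl := aestronglyMeasurable_extensionForm (B := B)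
  have hg := expMajorized_amplitude hQ hK hs (𝓕 φ)
  set g := amplitude Q B s (𝓕 φ)
  set c := 1 / (2 ^ (2 * s) * Real.Gamma s) with hc
  have hz2 : 0 < z ^ 2 := by positivity
  have hU : (fun X' => extension Q B a φ X' z) =
      fun X' => (c * z ^ (2 * s)) • fourierExtension B g (X', z ^ 2) :=
    funext fun X' => extension_eq_fourierExtension hQ hK hs ha φ X' hz
  have h1 : ∀ i, partialDeriv i (fun X' => extension Q B a φ X' z) = fun X' =>
      (c * z ^ (2 * s)) • fourierExtension B (fun τ =>
        extensionForm B τ (EuclideanSpace.single i 1, 0) * g τ) (X', z ^ 2) := fun i => by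
    rw [hU]
    exact funext fun X' => partialDeriv_fourierExtension hg _ i X' hz2
  have h2 : ∀ i j, partialDeriv j (partialDeriv i fun X' => extension Q B a φ X' z) X =
      (c * z ^ (2 * s)) • fourierExtension B (fun τ =>
        extensionForm B τ (EuclideanSpace.single j 1, 0) *
          (extensionForm B τ (EuclideanSpace.single i 1, 0) * g τ)) (X, z ^ 2) := fun i j => by
    rw [h1]
    exact partialDeriv_fourierExtension (hg.apply_mul hl _) _ j X hz2
  have hb := besselOperator_eq ha (u := extension Q B a φ X)
    (v₀ := fun ζ => c • fourierExtension B g (X, ζ ^ 2))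
    (v₁ := fun ζ => c • fourierExtension B (fun τ => extensionForm B τ (0, 1) * g τ) (X, ζ ^ 2))
    (v₂ := fun ζ => c • fourierExtension B (fun τ => extensionForm B τ (0, 1) *
      (extensionForm B τ (0, 1) * g τ)) (X, ζ ^ 2))
    (fun ζ hζ => by
      rw [extension_eq_fourierExtension hQ hK hs ha φ X hζ, smul_smul, mul_comm])
    (fun ζ hζ => by
      rw [smul_comm]
      exact (hasDerivAt_fourierExtension hg X hζ).const_smul c)
    (fun ζ hζ => by
      rw [smul_comm]
      exact (hasDerivAt_fourierExtension (hg.apply_mul hl _) X hζ).const_smul c) hz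
  obtain ⟨hint, hsum⟩ := sum_fourierExtension (Q := Q) (s := s) hz X hg
  rw [fourierExtension_extensionSymbol hQ hs hz X (𝓕 φ) hint] at hsum
  rw [extensionOperator, diffusionOperator, hb]
  simp only [h2]
  simp only [h1]
  refine smul_eq_zero_of_right _ ?_
  have key := congrArg (fun w : ℂ => (c * z ^ (2 * s)) • w) hsum
  simp only [smul_zero, smul_add, Finset.smul_sum] at key
  rw [← key]
  simp only [smul_add, smul_smul]
  congr 1
  · congr 1
    · refine Finset.sum_congr rfl fun i _ => Finset.sum_congr rfl fun j _ => ?_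
      congr 1
      ring
    · refine Finset.sum_congr rfl fun i _ => ?_
      congr 1
      ring
  · congr 2 <;> ring

/-- The extension is smooth in the open half-space. -/
theorem contDiffOn_extension_complex (hQ : Q.PosSemidef)
    (hK : ∀ t : ℝ, 0 < t → (covariance Q B t).PosDef) {s a : ℝ} (hs : 0 < s)
    (ha : a = 1 - 2 * s) (φ : 𝓢(Space N, ℂ)) :
    ContDiffOn ℝ ∞ (fun q : Space N × ℝ => extension Q B a φ q.1 q.2) (univ ×ˢ Ioi 0) := by
  have hW := (expMajorized_amplitude hQ hK hs (𝓕 φ)).contDiffOn aestronglyMeasurable_extensionForm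
    (isOpen_univ.prod isOpen_Ioi)
  have h1 : ContDiffOn ℝ ∞ (fun q : Space N × ℝ => (q.1, q.2 ^ 2))
      ((univ : Set (Space N)) ×ˢ Ioi (0 : ℝ)) := by fun_prop
  have h2 : ContDiffOn ℝ ∞ (fun q : Space N × ℝ => 1 / (2 ^ (2 * s) * Real.Gamma s) * q.2 ^ (2 * s))
      ((univ : Set (Space N)) ×ˢ Ioi (0 : ℝ)) := fun q hq => by
    have : q.2 ≠ 0 := (show 0 < q.2 from hq.2).ne'
    exact (contDiffAt_const.mul (contDiffAt_snd.rpow_const_of_ne this)).contDiffWithinAt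
  refine (h2.smul (hW.comp h1 fun q hq => ⟨mem_univ _, ?_⟩)).congr fun q hq =>
    extension_eq_fourierExtension hQ hK hs ha φ q.1 hq.2
  have : 0 < q.2 := hq.2
  exact pow_pos this 2

end Equation

/-! ### From complex data to data with values in `𝕜` -/

section ScalarChange

open scoped SchwartzMap

variable {N : ℕ} {Q B : Matrix (Fin N) (Fin N) ℝ}
variable {F G : Type*} [NormedAddCommGroup F] [NormedSpace ℝ F] [NormedAddCommGroup G]
  [NormedSpace ℝ G]

theorem partialDeriv_clm_comp (L : F →L[ℝ] G) (i : Fin N) {u : Space N → F} {X : Space N}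
    (hu : DifferentiableAt ℝ u X) :
    partialDeriv i (fun X' => L (u X')) X = L (partialDeriv i u X) := by
  have h := (L.hasFDerivAt.comp X hu.hasFDerivAt).fderiv
  exact congrArg (fun D : Space N →L[ℝ] G => D (EuclideanSpace.single i 1)) h

theorem extensionOperator_congr (a : ℝ) {V W : Space N → ℝ → F}
    (h : ∀ X ζ, 0 < ζ → V X ζ = W X ζ) (X : Space N) {z : ℝ} (hz : 0 < z) :
    extensionOperator Q B a V X z = extensionOperator Q B a W X z := by
  have e : V X =ᶠ[𝓝 z] W X := by
    filter_upwards [lt_mem_nhds hz] with ζ hζ using h X ζ hζ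
  rw [extensionOperator, extensionOperator, besselOperator, besselOperator, e.deriv_eq,
    e.deriv.deriv_eq, funext fun X' => h X' z hz]

/-- All coefficients of the operator are real scalars, so it commutes with every real-linear map;
smoothness of V justifies the chain rule twice in each variable. -/
theorem extensionOperator_clm_comp (L : F →L[ℝ] G) (a : ℝ) {V : Space N → ℝ → F}
    (hV : ContDiffOn ℝ ∞ (fun q : Space N × ℝ => V q.1 q.2) (univ ×ˢ Ioi 0)) (X : Space N) {z : ℝ}
    (hz : 0 < z) :
    extensionOperator Q B a (fun X z => L (V X z)) X z = L (extensionOperator Q B a V X z) := by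
  have hu : ContDiff ℝ ∞ fun X' => V X' z := by
    rw [← contDiffOn_univ]
    exact hV.comp (f := fun X' : Space N => (X', z)) (by fun_prop) fun X' _ => ⟨mem_univ _, hz⟩
  have hv : ContDiffOn ℝ ∞ (V X) (Ioi 0) :=
    hV.comp (f := fun ζ : ℝ => (X, ζ)) (by fun_prop) fun ζ hζ => ⟨mem_univ _, hζ⟩
  have hpd : ∀ i, ContDiff ℝ ∞ (partialDeriv i fun X' => V X' z) := fun i => by
    unfold partialDeriv
    exact (hu.fderiv_right (m := ∞) (by simp)).clm_apply contDiff_const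
  have h1 : ∀ i, partialDeriv i (fun X' => L (V X' z)) =
      fun X' => L (partialDeriv i (fun X' => V X' z) X') := fun i =>
    funext fun X' => partialDeriv_clm_comp L i (hu.differentiable (by simp) X')
  have h2 : ∀ i j, partialDeriv j (partialDeriv i fun X' => L (V X' z)) X =
      L (partialDeriv j (partialDeriv i fun X' => V X' z) X) := fun i j => by
    rw [h1]
    exact partialDeriv_clm_comp L j ((hpd i).differentiable (by simp) X)
  have hd1 : ∀ ζ ∈ Ioi (0 : ℝ), deriv (fun r => L (V X r)) ζ = L (deriv (V X) ζ) := fun ζ hζ =>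
    (L.hasFDerivAt.comp_hasDerivAt ζ
      ((hv.contDiffAt (Ioi_mem_nhds hζ)).differentiableAt (by simp)).hasDerivAt).deriv
  have hdv : ContDiffOn ℝ ∞ (deriv (V X)) (Ioi 0) := hv.deriv_of_isOpen isOpen_Ioi (by simp)
  have hd2 : deriv (deriv fun r => L (V X r)) z = L (deriv (deriv (V X)) z) := by
    have e : deriv (fun r => L (V X r)) =ᶠ[𝓝 z] fun ζ => L (deriv (V X) ζ) := by
      filter_upwards [Ioi_mem_nhds hz] with ζ hζ using hd1 ζ hζ
    rw [e.deriv_eq]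
    exact (L.hasFDerivAt.comp_hasDerivAt z
      ((hdv.contDiffAt (Ioi_mem_nhds hz)).differentiableAt (by simp)).hasDerivAt).deriv
  rw [extensionOperator, extensionOperator, diffusionOperator, diffusionOperator, besselOperator,
    besselOperator, hd2, hd1 z hz]
  simp only [h2, map_smul, map_add, map_sum]
  simp only [h1]

variable {𝕜 : Type*} [RCLike 𝕜]

theorem rclikeMap_rclikeMap (x : 𝕜) : RCLike.map ℂ 𝕜 (RCLike.map 𝕜 ℂ x) = x := by
  simp [RCLike.map_apply]

/-- The kernel is real, so the integral commutes with real-linear maps, and the map from ℂ back to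
`𝕜` is a left inverse of the map from `𝕜` into ℂ (for `𝕜 = ℝ`, the real part). -/
theorem extension_eq_complex (hK : ∀ t : ℝ, 0 < t → (covariance Q B t).PosDef) {s a : ℝ}
    (hs : 0 < s) (ha : a = 1 - 2 * s) (φ : 𝓢(Space N, 𝕜)) (X : Space N) {z : ℝ} (hz : 0 < z) :
    extension Q B a φ X z = RCLike.map ℂ 𝕜
      (extension Q B a (SchwartzMap.postcompCLM (𝕜 := ℝ) (RCLike.map 𝕜 ℂ) φ) X z) := by
  set ψ := SchwartzMap.postcompCLM (𝕜 := ℝ) (RCLike.map 𝕜 ℂ) φ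
  obtain ⟨K, hb⟩ := exists_norm_le ψ
  rw [extension, extension, ← ContinuousLinearMap.integral_comp_comm _
    (extension_eq hK hs ha hz ψ.continuous.stronglyMeasurable hb X).1]
  refine integral_congr_ae (Eventually.of_forall fun Y => ?_)
  simp only [map_smul]
  congr 1
  exact (rclikeMap_rclikeMap (φ Y)).symm

theorem contDiffOn_extension (hQ : Q.PosSemidef)
    (hK : ∀ t : ℝ, 0 < t → (covariance Q B t).PosDef) {s a : ℝ} (hs : 0 < s)
    (ha : a = 1 - 2 * s) (φ : 𝓢(Space N, 𝕜)) :
    ContDiffOn ℝ ∞ (fun q : Space N × ℝ => extension Q B a φ q.1 q.2) (univ ×ˢ Ioi 0) :=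
  ((RCLike.map ℂ 𝕜).contDiff.comp_contDiffOn (contDiffOn_extension_complex hQ hK hs ha
    (SchwartzMap.postcompCLM (𝕜 := ℝ) (RCLike.map 𝕜 ℂ) φ))).congr fun q hq =>
      extension_eq_complex hK hs ha φ q.1 hq.2

theorem extensionOperator_extension (hQ : Q.PosSemidef)
    (hK : ∀ t : ℝ, 0 < t → (covariance Q B t).PosDef) {s a : ℝ} (hs : 0 < s)
    (ha : a = 1 - 2 * s) (φ : 𝓢(Space N, 𝕜)) (X : Space N) {z : ℝ} (hz : 0 < z) :
    extensionOperator Q B a (extension Q B a φ) X z = 0 := by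
  set ψ := SchwartzMap.postcompCLM (𝕜 := ℝ) (RCLike.map 𝕜 ℂ) φ
  rw [extensionOperator_congr a (fun X' ζ hζ => extension_eq_complex hK hs ha φ X' hζ) X hz,
    extensionOperator_clm_comp (RCLike.map ℂ 𝕜) a (contDiffOn_extension_complex hQ hK hs ha ψ) X hz,
    extensionOperator_extension_complex hQ hK hs ha ψ X hz, map_zero]

end ScalarChange

end HormanderExtension

/-! ### The theorem -/

theorem theorem5p4 {𝕜 : Type*} [RCLike 𝕜] (N : ℕ) (Q B : Matrix (Fin N) (Fin N) ℝ)
    (hQ : Q.PosSemidef) (hK : ∀ t : ℝ, 0 < t → (covariance Q B t).PosDef)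
    (s a : ℝ) (hs0 : 0 < s) (hs1 : s < 1) (ha : a = 1 - 2 * s)
    (φ : SchwartzMap (Space N) 𝕜) :
    -- the integrals that define the kernel, `U` and the fractional power converge
    (∀ X Y : Space N, ∀ z : ℝ, 0 < z →
      IntegrableOn (fun t => poissonKernelTime Q B a X Y z t) (Ioi 0)) ∧
    (∀ X : Space N, ∀ z : ℝ, 0 < z → Integrable (fun Y => subordinatedKernel Q B a X Y z • φ Y)) ∧
    (∀ X : Space N, ∀ t : ℝ, 0 < t → Integrable (fun Y => transitionKernel Q B X Y t • φ Y)) ∧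
    (∀ X : Space N,
      IntegrableOn (fun t : ℝ => t ^ (-s - 1) • (semigroup Q B t φ X - φ X)) (Ioi 0)) ∧
    -- smoothness
    ContDiffOn ℝ ∞ (fun q : Space N × ℝ => extension Q B a φ q.1 q.2) (univ ×ˢ Ioi 0) ∧
    -- the equation
    (∀ X : Space N, ∀ z : ℝ, 0 < z → extensionOperator Q B a (extension Q B a φ) X z = 0) ∧
    -- convergence in `L^∞`
    TendstoInLp ⊤ (extension Q B a φ) φ ∧
    TendstoInLp ⊤
      (fun X z => -((2 ^ (-a) * Real.Gamma ((1 - a) / 2) / Real.Gamma ((1 + a) / 2)) •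
        (z ^ a • deriv (fun ζ => extension Q B a φ X ζ) z)))
      (fractionalPower Q B s φ) ∧
    -- convergence in `L^p`
    (0 ≤ B.trace → ∀ p : ℝ≥0∞, 1 ≤ p → p ≠ ⊤ →
      TendstoInLp p (extension Q B a φ) φ ∧
      TendstoInLp p
        (fun X z => -((2 ^ (-a) * Real.Gamma ((1 - a) / 2) / Real.Gamma ((1 + a) / 2)) •
          (z ^ a • deriv (fun ζ => extension Q B a φ X ζ) z)))
        (fractionalPower Q B s φ)) := by
  obtain ⟨b, hb⟩ := exists_norm_le φ
  have hφ := φ.continuous.stronglyMeasurable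
  refine ⟨fun X Y z hz => ?_, fun X z hz => (extension_eq hK hs0 ha hz hφ hb X).1,
    fun X t ht => integrable_transitionKernel_smul hK X ht hφ hb, fun X => ?_,
    contDiffOn_extension hQ hK hs0 ha φ,
    fun X z hz => extensionOperator_extension hQ hK hs0 ha φ X hz,
    tendstoInLp_extension hK hs0 hs1 ha le_top (Or.inl rfl) φ,
    tendstoInLp_neumann hK hs0 hs1 ha le_top (Or.inl rfl) φ,
    fun hB p hp _ => ⟨tendstoInLp_extension hK hs0 hs1 ha hp (Or.inr hB) φ,
      tendstoInLp_neumann hK hs0 hs1 ha hp (Or.inr hB) φ⟩⟩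
  · simp_rw [poissonKernelTime_eq ha]
    exact integrableOn_weight_mul_transitionKernel hQ hK hs0 hz X Y
  · refine integrableOn_smul_semigroup_sub hK φ (A := 1) (by fun_prop) hs0 hs1 (fun t ht => ?_) X
    rw [one_mul, abs_of_pos (Real.rpow_pos_of_pos ht _), show -s - 1 = -1 - s by ring]
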